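/- Let $k$ be an algebraically closed field, let $g\ge 2$, and suppose that $k$ contains a primitive $(2g+2)$-th root of unity $\varepsilon$ (equivalently, $\operatorname{char} k$ does not divide $2g+2$; in particular $\operatorname{char} k\ne 2$). For a binary form $f(X,Z)$ of degree $2g+2$ over $k$ with nonzero discriminant let $\mathcal X_f$ be the genus $g$ hyperelliptic curve with function field $K_f=k(X,Y)$, $Y^2=f(X,1)$. Let $\mathcal H_g$ be the moduli space of these curves, i.e. the affine variety whose points are the $GL_2(k)$-classes of such forms and whose coordinate ring consists of the $GL_2(k)$-invariant regular functions $P/\Delta^m$ of the coefficients ($\Delta$ the discriminant). An extra involution of $\mathcal X_f$ is an element of order $2$ of $\operatorname{Aut}(K_f/k)$ different from the hyperelliptic involution $Y\mapsto -Y$. Let $\mathcal L_g\subset\mathcal H_g$ be the locus of curves having an extra involution; its coordinate ring is that of $\mathcal H_g$ modulo the functions vanishing on $\mathcal L_g$, and $k(\mathcal L_g)$ is the fraction field of this ring. For $a=(a_1,\dots,a_g)$ let $$f_a = X^{2g+2}+a_gX^{2g}+\dots+a_1X^2+1 ,$$ homogenized with $Z$ to a form of degree $2g+2$. Then: (1)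 Let $a\in k^g$ with $\Delta(f_a)\neq 0$, and let $\gamma\in PGL_2(k)$ commute with $X\mapsto -X$. Then $\gamma$ transforms $f_a$ into a nonzero constant multiple of some $f_{a'}$, $a'\in k^g$, if and only if $\gamma$ lies in the subgroup $\langle\tau_1,\tau_2\rangle\subset PGL_2(k)$ generated by $\tau_1:X\mapsto\varepsilon X$ and $\tau_2:X\mapsto 1/X$. For every $a\in k^g$, $\tau_1$ transforms $f_a$ into $f_{a'}$ with $a'_i=\varepsilon^{2i}a_i$, and $\tau_2$ transforms $f_a$ into $f_{a'}$ with $a'_i=a_{g+1-i}$. (2) There is a homomorphism from $\langle\tau_1,\tau_2\rangle$ to the group of $k$-automorphisms of $k(a_1,\dots,a_g)$ which sends $\tau_1$ to $a_i\mapsto\varepsilon^{2i}a_i$ and $\tau_2$ to $a_i\mapsto a_{g+1-i}$ $(1\le i\le g)$. Its kernel is generated by $X\mapsto -X$, and its image is isomorphic to the dihedral group $D_{g+1}$ of order $2g+2$. (3) $\mathcal L_g$ is irreducible, and $$k(\mathcal L_g)\;\cong\; k(a_1,\dots,a_g)^{D_{g+1}}$$ as $k$-algebras, by an isomorphism that sends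 the restriction to $\mathcal L_g$ of a regular function $F$ on $\mathcal H_g$ to the rational function $a\mapsto F([f_a])$, where $[f_a]$ is the point of $\mathcal H_g$ given by $f_a$. -/

import Mathlib

namespace Hyperelliptic

open MvPolynomial

noncomputable section

/-! ### Binary forms of degree `2g+2`

The coefficient vector `c` stands for the binary form `∑ i, c i * X ^ i * Z ^ (2g+2-i)`. -/

/-- The binary form with coefficient vector `c`, as a polynomial in `X = X 0` and `Z = X 1`. -/
def toPoly {k : Type*} [CommRing k] {g : ℕ} (c : Fin (2 * g + 3) → k) : MvPolynomial (Fin 2) k :=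
  ∑ i : Fin (2 * g + 3), C (c i) * X 0 ^ (i : ℕ) * X 1 ^ (2 * g + 2 - (i : ℕ))

/-- The linear substitution `X ↦ M₀₀ X + M₀₁ Z`, `Z ↦ M₁₀ X + M₁₁ Z`. -/
def subst {k : Type*} [CommRing k] (M : GL (Fin 2) k) :
    MvPolynomial (Fin 2) k →ₐ[k] MvPolynomial (Fin 2) k :=
  aeval fun i => ∑ j : Fin 2, C ((M : Matrix (Fin 2) (Fin 2) k) i j) * X j

/-- The discriminant of the general binary form of degree `2g+2`, a polynomial in its
coefficients `X 0, …, X (2g+2)`. -/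
def disc (g : ℕ) (k : Type*) [CommRing k] : MvPolynomial (Fin (2 * g + 3)) k :=
  Polynomial.discr
    (∑ i : Fin (2 * g + 3), Polynomial.C (X i : MvPolynomial (Fin (2 * g + 3)) k) *
      Polynomial.X ^ (i : ℕ))

/-- The binary forms of degree `2g+2` with nonzero discriminant. Such a form `f` stands for the
genus `g` hyperelliptic curve `Y² Z^(2g) = f(X, Z)`. -/
abbrev Form (g : ℕ) (k : Type*) [CommRing k] : Type _ :=
  {c : Fin (2 * g + 3) → k // eval c (disc g k) ≠ 0}

/-! ### The function field of a hyperelliptic curve and its extra involutions -/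

/-- The function field `k(X)[Y] / (Y² - f(X, 1))` of the curve given by `f`. -/
abbrev FunField {g : ℕ} {k : Type*} [Field k] (f : Form g k) : Type _ :=
  AdjoinRoot ((Polynomial.X : Polynomial (RatFunc k)) ^ 2 -
    Polynomial.C (algebraMap (Polynomial k) (RatFunc k)
      (∑ i : Fin (2 * g + 3), Polynomial.C (f.1 i) * Polynomial.X ^ (i : ℕ))))

/-- The hyperelliptic involution: the nontrivial element of the Galois group over `k(X)`. -/
def IsHyperellipticInvolution {g : ℕ} {k : Type*} [Field k] (f : Form g k)
    (z : FunField f ≃ₐ[k] FunField f) : Prop :=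
  z ≠ 1 ∧ ∀ r : RatFunc k, z (AdjoinRoot.of _ r) = AdjoinRoot.of _ r

/-- An extra involution: an involution in `Aut(K/k)` other than the hyperelliptic one. -/
def IsExtraInvolution {g : ℕ} {k : Type*} [Field k] (f : Form g k)
    (z : FunField f ≃ₐ[k] FunField f) : Prop :=
  z ≠ 1 ∧ z * z = 1 ∧ ¬ IsHyperellipticInvolution f z

/-! ### The moduli space of hyperelliptic curves as an affine variety -/

/-- `f'` arises from `f` by an invertible linear substitution. -/
def Equivalent {g : ℕ} {k : Type*} [CommRing k] (f f' : Form g k) : Prop :=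
  ∃ M : GL (Fin 2) k, toPoly f'.1 = subst M (toPoly f.1)

/-- The points of the moduli space `H_g`: the `GL₂(k)`-classes of binary forms of degree `2g+2`
with nonzero discriminant. -/
def Moduli (g : ℕ) (k : Type*) [CommRing k] : Type _ :=
  Quot (Equivalent (g := g) (k := k))

/-- The point of `H_g` given by a form. -/
def Moduli.mk {g : ℕ} {k : Type*} [CommRing k] (f : Form g k) : Moduli g k :=
  Quot.mk _ f

/-- The coordinate ring of the affine variety `H_g`: the functions on `H_g` whose pull-back to the
forms with nonzero discriminant is regular, i.e. of the shape `P / disc ^ m`; in other words, the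
`GL₂(k)`-invariant regular functions of the coefficients. -/
def coordRing (g : ℕ) (k : Type*) [Field k] : Subalgebra k (Moduli g k → k) where
  carrier := {F | ∃ (P : MvPolynomial (Fin (2 * g + 3)) k) (m : ℕ),
    ∀ f : Form g k, F (Moduli.mk f) * eval f.1 (disc g k) ^ m = eval f.1 P}
  mul_mem' := by
    rintro F G ⟨P, m, hP⟩ ⟨Q, n, hQ⟩
    refine ⟨P * Q, m + n, fun f => ?_⟩
    rw [map_mul, ← hP, ← hQ, Pi.mul_apply]
    ring
  add_mem' := by
    rintro F G ⟨P, m, hP⟩ ⟨Q, n, hQ⟩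
    refine ⟨P * disc g k ^ n + Q * disc g k ^ m, m + n, fun f => ?_⟩
    rw [map_add, map_mul, map_mul, map_pow, map_pow, ← hP, ← hQ, Pi.add_apply]
    ring
  algebraMap_mem' := fun r => ⟨C r, 0, fun f => by simp [Pi.algebraMap_apply]⟩

/-- The locus `L_g` in `H_g` of the hyperelliptic curves with extra involutions. -/
def locus (g : ℕ) (k : Type*) [Field k] : Set (Moduli g k) :=
  {p | ∃ f : Form g k, Moduli.mk f = p ∧ ∃ z, IsExtraInvolution f z}

/-- The ideal of the functions in the coordinate ring of `H_g` that vanish on `L_g`. -/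
def locusIdeal (g : ℕ) (k : Type*) [Field k] : Ideal (coordRing g k) where
  carrier := {F | ∀ p ∈ locus g k, F.1 p = 0}
  add_mem' := fun {F G} hF hG p hp => by
    simp only [Set.mem_ofPred_eq] at hF hG
    simp [hF p hp, hG p hp]
  zero_mem' := fun p _ => rfl
  smul_mem' := fun c F hF p hp => by
    simp only [Set.mem_ofPred_eq] at hF
    simp [hF p hp]

/-- The coordinate ring of (the closure of) `L_g`. -/
def LocusCoordRing (g : ℕ) (k : Type*) [Field k] : Type _ :=
  coordRing g k ⧸ locusIdeal g k

instance (g : ℕ) (k : Type*) [Field k] : CommRing (LocusCoordRing g k) :=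
  inferInstanceAs (CommRing (coordRing g k ⧸ locusIdeal g k))

instance (g : ℕ) (k : Type*) [Field k] : Algebra k (LocusCoordRing g k) :=
  inferInstanceAs (Algebra k (coordRing g k ⧸ locusIdeal g k))

/-- The restriction to `L_g` of the regular functions on `H_g`. -/
def toLocus (g : ℕ) (k : Type*) [Field k] : coordRing g k →ₐ[k] LocusCoordRing g k :=
  Ideal.Quotient.mkₐ k (locusIdeal g k)

/-- The function field `k(L_g)`: the fraction field of the coordinate ring of `L_g`. It is a field
as soon as `locusIdeal g k` is prime, i.e. `L_g` is irreducible. -/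
abbrev LocusFunField (g : ℕ) (k : Type*) [Field k] : Type _ :=
  FractionRing (LocusCoordRing g k)

/-! ### The normal form

The parameters `a_1, …, a_g` are indexed by `Fin g`: `a i` is `a_(i+1)`. -/

/-- The coefficients of `X^(2g+2) + a_g X^(2g) + … + a_1 X² + 1`. -/
def normalForm {g : ℕ} {R : Type*} [CommRing R] (a : Fin g → R) : Fin (2 * g + 3) → R := fun j =>
  if h : (j : ℕ) % 2 = 0 ∧ 0 < (j : ℕ) ∧ (j : ℕ) < 2 * g + 2 then a ⟨(j : ℕ) / 2 - 1, by omega⟩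
  else if (j : ℕ) % 2 = 0 then 1 else 0

/-- The discriminant of the normal form, a polynomial in `a_1, …, a_g`. -/
def normalDisc (g : ℕ) (k : Type*) [CommRing k] : MvPolynomial (Fin g) k :=
  aeval (normalForm (X : Fin g → MvPolynomial (Fin g) k)) (disc g k)

/-- The field `k(a_1, …, a_g)`. -/
abbrev ParamField (g : ℕ) (k : Type*) [Field k] : Type _ :=
  FractionRing (MvPolynomial (Fin g) k)

/-- `r ∈ k(a_1, …, a_g)` is the rational function `a ↦ F([f_a])`, the pull-back of the function `F`
on `H_g` along the map which sends `a` to the class of its normal form `f_a`. -/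
def IsPullback {g : ℕ} {k : Type*} [Field k] (F : Moduli g k → k) (r : ParamField g k) : Prop :=
  ∃ (p : MvPolynomial (Fin g) k) (m : ℕ),
    r * algebraMap _ (ParamField g k) (normalDisc g k) ^ m = algebraMap _ (ParamField g k) p ∧
    ∀ (a : Fin g → k) (ha : eval (normalForm a) (disc g k) ≠ 0),
      F (Moduli.mk ⟨normalForm a, ha⟩) * eval a (normalDisc g k) ^ m = eval a p

/-! ### The changes of coordinate and the dihedral action -/

/-- The matrix of `X ↦ u X`. -/
def scaleGL {k : Type*} [Field k] (u : kˣ) : GL (Fin 2) k :=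
  Matrix.GeneralLinearGroup.mkOfDetNeZero !![(u : k), 0; 0, 1] (by simp)

/-- The matrix of `X ↦ 1 / X`. -/
def swapGL (k : Type*) [Field k] : GL (Fin 2) k :=
  Matrix.GeneralLinearGroup.mkOfDetNeZero !![0, 1; 1, 0] (by simp)

/-- The subgroup of `PGL₂(k)` generated by `X ↦ ε X` and `X ↦ 1 / X`. -/
def coordGroup {k : Type*} [Field k] (ε : kˣ) : Subgroup (Matrix.ProjGenLinGroup (Fin 2) k) :=
  Subgroup.closure {Matrix.ProjGenLinGroup.mk (scaleGL ε), Matrix.ProjGenLinGroup.mk (swapGL k)}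

/-- The automorphism `a_i ↦ ε^(2i) a_i` of `k[a_1, …, a_g]`. -/
def scalePoly (g : ℕ) {k : Type*} [Field k] (ε : kˣ) :
    MvPolynomial (Fin g) k ≃ₐ[k] MvPolynomial (Fin g) k :=
  AlgEquiv.ofAlgHom
    (aeval fun i : Fin g => C ((ε : k) ^ (2 * ((i : ℕ) + 1))) * X i)
    (aeval fun i : Fin g => C (((ε⁻¹ : kˣ) : k) ^ (2 * ((i : ℕ) + 1))) * X i)
    (by
      ext i : 1
      simp only [AlgHom.comp_apply, aeval_X, map_mul, algHom_C, algebraMap_eq, AlgHom.id_apply]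
      rw [← mul_assoc, ← C_mul, ← mul_pow]
      simp)
    (by
      ext i : 1
      simp only [AlgHom.comp_apply, aeval_X, map_mul, algHom_C, algebraMap_eq, AlgHom.id_apply]
      rw [← mul_assoc, ← C_mul, ← mul_pow]
      simp)

/-- The automorphism `a_i ↦ ε^(2i) a_i` of `k(a_1, …, a_g)`. -/
def scaleAut (g : ℕ) {k : Type*} [Field k] (ε : kˣ) : ParamField g k ≃ₐ[k] ParamField g k :=
  IsFractionRing.fieldEquivOfAlgEquiv k (ParamField g k) (ParamField g k) (scalePoly g ε)

/-- The automorphism `a_i ↦ a_(g+1-i)` of `k(a_1, …, a_g)`. -/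
def swapAut (g : ℕ) (k : Type*) [Field k] : ParamField g k ≃ₐ[k] ParamField g k :=
  IsFractionRing.fieldEquivOfAlgEquiv k (ParamField g k) (ParamField g k)
    (renameEquiv k (Fin.revPerm : Equiv.Perm (Fin g)))

/-- The group of automorphisms of `k(a_1, …, a_g)` generated by `a_i ↦ ε^(2i) a_i` and
`a_i ↦ a_(g+1-i)`. -/
def dihedralAut (g : ℕ) {k : Type*} [Field k] (ε : kˣ) :
    Subgroup (ParamField g k ≃ₐ[k] ParamField g k) :=
  Subgroup.closure {scaleAut g ε, swapAut g k}

theorem scale_mem {k : Type*} [Field k] (ε : kˣ) :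
    Matrix.ProjGenLinGroup.mk (scaleGL ε) ∈ coordGroup ε :=
  Subgroup.subset_closure (Or.inl rfl)

theorem swap_mem {k : Type*} [Field k] (ε : kˣ) :
    Matrix.ProjGenLinGroup.mk (swapGL k) ∈ coordGroup ε :=
  Subgroup.subset_closure (Or.inr rfl)

end

end Hyperelliptic

/-! A form is handled through its root vectors `(x_i, z_i)`, so that roots at infinity need no
separate treatment: it is `∏ (z_i X - x_i Z)`, and its discriminant is, up to sign, the product of
all the brackets `x_i z_j - x_j z_i` (`aeval_disc_rootForm`). Symmetric multihomogeneous polynomials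
in the root vectors are polynomials in the coefficients (`exists_poly_of_symmetric`). Hence, for any
linear combination of cross ratios with coefficients `u`, the product of `T - crossSum u` over all
orderings of the roots is a regular function on `H_g` (`exists_coordRing_prod_crossSum`). These are
all the invariants that the proof needs.

The locus is the image of the normal forms (`mem_locus_iff`). An involution of `k(X, Y)` preserves
`k(X)`: otherwise `X` and its image satisfy a relation of bidegree at most `(2, 2)`, whose
discriminant in one variable has degree at most 4 but is a nonzero square times a polynomial of
degree at least 5. If it is not hyperelliptic it therefore induces a Möbius involution, and `Y ↦ β
Y` together with order 2 fixes the sign with which the form is invariant. Diagonalizing the Möbius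
involution makes the form even, and scaling makes it a normal form.

Substituting the normal form gives a map `pullback` from the coordinate ring of `H_g` to `k(a_1, …,
a_g)`. Its kernel is the ideal of the locus, which is therefore prime, and its image is fixed by the
dihedral group. It remains to see that the field `E` generated by the image is the whole fixed field
(`fixedField_dihedralAut`).

This is Galois theory in an algebraic closure `Ω` of `k(a)`, where the generic normal form has roots
`± b_i`. The `b_i` satisfy no homogeneous relation, so homogeneous statements about them can be
tested at arbitrary points of `k^(g+1)`. In this way only the identity and the simultaneous exchange
`b_i ↔ -b_i` turn out to preserve all cross ratios of the roots
(`eq_one_or_eq_partner_of_crossRatio`).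

Two consequences follow. Generic combinations of cross ratios are roots of multiplicity at most 2 of
polynomials over `E`, and since the characteristic divides neither 2 nor `2g+2`, the cross ratios,
then the `b_i`, then the `a_i` are separable over `E`. Moreover an automorphism `τ` of `Ω` over `E`
permutes the roots up to equality of cross ratios, by a permutation that commutes with the exchange.
The cross ratio `4xy/(x+y)²` of two pairs `± x`, `± y` determines `x/y` up to inversion, so `τ`
multiplies the permuted roots, or their inverses, by a constant. The constant term 1 makes this
constant a `(2g+2)`-th root of unity, so `τ` acts on `k(a)` through the dihedral group, and an
element fixed by that group lies in `E`. -/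

namespace Hyperelliptic

noncomputable section

/-! ### Binary forms in terms of their roots -/

/-- The dehomogenization `f(X, 1)` of the form with coefficient vector `c`. -/
def affinePoly {R : Type*} [CommRing R] {g : ℕ} (c : Fin (2 * g + 3) → R) : Polynomial R :=
  ∑ i : Fin (2 * g + 3), Polynomial.C (c i) * Polynomial.X ^ (i : ℕ)

theorem coeff_affinePoly {R : Type*} [CommRing R] {g : ℕ} (c : Fin (2 * g + 3) → R)
    (j : Fin (2 * g + 3)) : (affinePoly c).coeff j = c j := by
  simp only [affinePoly, Polynomial.finsetSum_coeff, Polynomial.coeff_C_mul,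
    Polynomial.coeff_X_pow]
  rw [Finset.sum_eq_single j]
  · simp
  · intro b _ hb
    rw [if_neg (fun h => hb (Fin.ext h.symm)), mul_zero]
  · simp

theorem natDegree_affinePoly_le {R : Type*} [CommRing R] {g : ℕ} (c : Fin (2 * g + 3) → R) :
    (affinePoly c).natDegree ≤ 2 * g + 2 := by
  refine Polynomial.natDegree_sum_le_of_forall_le _ _ fun i _ => ?_
  exact (Polynomial.natDegree_C_mul_X_pow_le _ _).trans (by omega)

theorem affinePoly_coeff {R : Type*} [CommRing R] {g : ℕ} {p : Polynomial R}
    (hp : p.natDegree ≤ 2 * g + 2) :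
    affinePoly (g := g) (fun j => p.coeff j) = p := by
  ext j
  rcases lt_or_ge j (2 * g + 3) with hj | hj
  · exact coeff_affinePoly (fun j : Fin (2 * g + 3) => p.coeff j) ⟨j, hj⟩
  · rw [Polynomial.coeff_eq_zero_of_natDegree_lt ((natDegree_affinePoly_le _).trans_lt (by omega)),
      Polynomial.coeff_eq_zero_of_natDegree_lt (hp.trans_lt (by omega))]

theorem affinePoly_injective {R : Type*} [CommRing R] {g : ℕ} :
    Function.Injective (affinePoly (R := R) (g := g)) := by
  intro c c' h
  ext j
  rw [← coeff_affinePoly c, h, coeff_affinePoly]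

theorem map_affinePoly {R S : Type*} [CommRing R] [CommRing S] (φ : R →+* S) {g : ℕ}
    (c : Fin (2 * g + 3) → R) :
    (affinePoly c).map φ = affinePoly (fun j => φ (c j)) := by
  simp [affinePoly, Polynomial.map_sum]

theorem toPoly_eq_homogenize {R : Type*} [CommRing R] {g : ℕ} (c : Fin (2 * g + 3) → R) :
    toPoly c = (affinePoly c).homogenize (2 * g + 2) := by
  rw [affinePoly, Polynomial.homogenize_finsetSum, toPoly]
  refine Finset.sum_congr rfl fun i _ => ?_
  rw [Polynomial.homogenize_C_mul, Polynomial.homogenize_X_pow (by omega), mul_assoc]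

theorem toPoly_injective {R : Type*} [CommRing R] {g : ℕ} :
    Function.Injective (toPoly (k := R) (g := g)) := by
  intro c c' h
  apply affinePoly_injective
  rw [toPoly_eq_homogenize, toPoly_eq_homogenize] at h
  rw [← Polynomial.aeval_homogenize_X_one _ (natDegree_affinePoly_le c), h,
    Polynomial.aeval_homogenize_X_one _ (natDegree_affinePoly_le c')]

theorem toPoly_smul {R : Type*} [CommRing R] {g : ℕ} (a : R) (c : Fin (2 * g + 3) → R) :
    toPoly (fun j => a * c j) = a • toPoly c := by
  simp [toPoly, Finset.smul_sum, MvPolynomial.smul_eq_C_mul, mul_assoc]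

/-- The polynomial `∏ (z_i X - x_i)` for root vectors `r i = (x_i, z_i)`. -/
def rootPoly {R : Type*} [CommRing R] {n : ℕ} (r : Fin n → Fin 2 → R) : Polynomial R :=
  ∏ i, (Polynomial.C (r i 1) * Polynomial.X - Polynomial.C (r i 0))

theorem natDegree_linear_le {R : Type*} [CommRing R] (a b : R) :
    (Polynomial.C a * Polynomial.X - Polynomial.C b).natDegree ≤ 1 := by
  compute_degree

theorem natDegree_rootPoly_le {R : Type*} [CommRing R] {n : ℕ} (r : Fin n → Fin 2 → R) :
    (rootPoly r).natDegree ≤ n := by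
  refine (Polynomial.natDegree_prod_le _ _).trans ?_
  refine (Finset.sum_le_sum fun i _ => natDegree_linear_le _ _).trans ?_
  simp

/-- The coefficient vector of the binary form `∏ (z_i X - x_i Z)`. -/
def rootForm {R : Type*} [CommRing R] {g : ℕ} (r : Fin (2 * g + 2) → Fin 2 → R) :
    Fin (2 * g + 3) → R :=
  fun j => (rootPoly r).coeff j

theorem affinePoly_rootForm {R : Type*} [CommRing R] {g : ℕ} (r : Fin (2 * g + 2) → Fin 2 → R) :
    affinePoly (rootForm r) = rootPoly r :=
  affinePoly_coeff (natDegree_rootPoly_le r)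

theorem map_rootPoly {R S : Type*} [CommRing R] [CommRing S] (φ : R →+* S) {n : ℕ}
    (r : Fin n → Fin 2 → R) :
    (rootPoly r).map φ = rootPoly (fun i l => φ (r i l)) := by
  simp [rootPoly, Polynomial.map_prod]

theorem map_rootForm {R S : Type*} [CommRing R] [CommRing S] (φ : R →+* S) {g : ℕ}
    (r : Fin (2 * g + 2) → Fin 2 → R) (j : Fin (2 * g + 3)) :
    φ (rootForm r j) = rootForm (fun i l => φ (r i l)) j := by
  rw [rootForm, rootForm, ← map_rootPoly, Polynomial.coeff_map]

theorem rootForm_last {R : Type*} [CommRing R] {g : ℕ} (r : Fin (2 * g + 2) → Fin 2 → R) :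
    rootForm r (Fin.last _) = ∏ i, r i 1 := by
  have h := Polynomial.coeff_prod_of_natDegree_le (s := Finset.univ)
    (fun i => Polynomial.C (r i 1) * Polynomial.X - Polynomial.C (r i 0)) 1
    (fun i _ => natDegree_linear_le (r i 1) (r i 0))
  simp only [Finset.card_univ, Fintype.card_fin, mul_one] at h
  change (rootPoly r).coeff (2 * g + 2) = _
  rw [rootPoly, h]
  simp [Polynomial.coeff_C]

theorem toPoly_rootForm {R : Type*} [CommRing R] {g : ℕ} (r : Fin (2 * g + 2) → Fin 2 → R) :
    toPoly (rootForm r) = ∏ i, (MvPolynomial.C (r i 1) * MvPolynomial.X 0 -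
      MvPolynomial.C (r i 0) * MvPolynomial.X 1) := by
  rw [toPoly_eq_homogenize, affinePoly_rootForm, rootPoly]
  have h := Polynomial.homogenize_finsetProd (s := Finset.univ)
    (p := fun i => Polynomial.C (r i 1) * Polynomial.X - Polynomial.C (r i 0)) (n := fun _ => 1)
    (fun i _ => natDegree_linear_le (r i 1) (r i 0))
  simp only [Finset.sum_const, Finset.card_univ, Fintype.card_fin, smul_eq_mul, mul_one] at h
  rw [h]
  refine Finset.prod_congr rfl fun i _ => ?_
  rw [Polynomial.homogenize_sub, Polynomial.homogenize_C_mul, Polynomial.homogenize_X one_ne_zero,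
    Polynomial.homogenize_C]
  simp

/-- The determinant `x_i z_j - x_j z_i` of two root vectors. -/
def bracket {R : Type*} [CommRing R] {n : ℕ} (r : Fin n → Fin 2 → R) (i j : Fin n) : R :=
  r i 0 * r j 1 - r j 0 * r i 1

/-- The product of all the brackets. -/
def bracketProd {R : Type*} [CommRing R] {n : ℕ} (r : Fin n → Fin 2 → R) : R :=
  ∏ i, ∏ j ∈ Finset.univ.erase i, bracket r i j

theorem bracketProd_map {R S : Type*} [CommRing R] [CommRing S] (φ : R →+* S) {n : ℕ}
    (r : Fin n → Fin 2 → R) :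
    φ (bracketProd r) = bracketProd (fun i l => φ (r i l)) := by
  simp [bracketProd, bracket]

theorem bracketProd_comp_perm {R : Type*} [CommRing R] {n : ℕ} (r : Fin n → Fin 2 → R)
    (π : Equiv.Perm (Fin n)) : bracketProd (fun i => r (π i)) = bracketProd r := by
  rw [bracketProd, bracketProd,
    ← Equiv.prod_comp π fun i => ∏ j ∈ Finset.univ.erase i, bracket r i j]
  refine Finset.prod_congr rfl fun i _ => ?_
  refine Finset.prod_bij (fun j _ => π j) ?_ ?_ ?_ ?_
  · simp
  · simp
  · intro b hb
    exact ⟨π.symm b, by simpa [Equiv.symm_apply_eq] using hb, by simp⟩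
  · intros
    rfl

theorem bracketProd_ne_zero_iff {K : Type*} [Field K] {n : ℕ} (r : Fin n → Fin 2 → K) :
    bracketProd r ≠ 0 ↔ ∀ i j, i ≠ j → bracket r i j ≠ 0 := by
  simp only [bracketProd, Finset.prod_ne_zero_iff, Finset.mem_univ, Finset.mem_erase, true_imp_iff,
    and_true]
  exact ⟨fun h i j hij => h i j hij.symm, fun h i j hij => h i j hij.symm⟩

theorem natDegree_generic {k : Type*} [Field k] (g : ℕ) :
    (affinePoly (MvPolynomial.X : Fin (2 * g + 3) → MvPolynomial (Fin (2 * g + 3)) k)).natDegree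
      = 2 * g + 2 := by
  refine le_antisymm (natDegree_affinePoly_le _) (Polynomial.le_natDegree_of_ne_zero ?_)
  have := coeff_affinePoly (MvPolynomial.X : Fin (2 * g + 3) → MvPolynomial (Fin (2 * g + 3)) k)
    (Fin.last _)
  simp only [Fin.val_last] at this
  rw [this]
  exact MvPolynomial.X_ne_zero _

/-- The sign between the discriminant and the product of the brackets. -/
def discSign (g : ℕ) (K : Type*) [CommRing K] : K :=
  (-1) ^ ((2 * g + 2) * (2 * g + 2 - 1) / 2)

theorem discSign_mul_self (g : ℕ) (K : Type*) [CommRing K] :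
    discSign g K * discSign g K = 1 := by
  rw [discSign, ← mul_pow]; simp

theorem discSign_ne_zero (g : ℕ) (K : Type*) [Field K] : discSign g K ≠ 0 := fun h => by
  simpa [h] using discSign_mul_self g K

/-- The formula relating the resultant of `F` and `F'` to the discriminant is applied to the generic
form, whose degree really is `2g+2`, and then specialized. A resultant with prescribed formal
degrees commutes with specialization, so a vanishing leading coefficient does no harm. -/
theorem resultant_eq_disc {k K : Type*} [Field k] [Field K] [Algebra k K] {g : ℕ}
    (c : Fin (2 * g + 3) → K) :
    Polynomial.resultant (affinePoly c) (affinePoly c).derivative (2 * g + 2) (2 * g + 1) =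
      discSign g K * c (Fin.last _) * MvPolynomial.aeval c (disc g k) := by
  set F := affinePoly (MvPolynomial.X : Fin (2 * g + 3) → MvPolynomial (Fin (2 * g + 3)) k)
    with hF
  have hd : F.natDegree = 2 * g + 2 := natDegree_generic g
  have h := Polynomial.resultant_deriv (f := F)
    (by rw [← Polynomial.natDegree_pos_iff_degree_pos, hd]; omega)
  rw [Polynomial.leadingCoeff, hd] at h
  have hl : F.coeff (2 * g + 2) = MvPolynomial.X (Fin.last _) :=
    coeff_affinePoly (MvPolynomial.X : Fin (2 * g + 3) → MvPolynomial (Fin (2 * g + 3)) k)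
      (Fin.last _)
  rw [hl] at h
  have hm : F.map (MvPolynomial.aeval c : MvPolynomial (Fin (2 * g + 3)) k →ₐ[k] K).toRingHom
      = affinePoly c := by
    rw [hF, map_affinePoly]
    simp
  have h2 := congrArg (MvPolynomial.aeval c : MvPolynomial (Fin (2 * g + 3)) k →ₐ[k] K).toRingHom h
  rw [← Polynomial.resultant_map_map, ← Polynomial.derivative_map, hm] at h2
  have hdisc : disc g k = F.discr := rfl
  rw [hdisc]
  simpa [discSign] using h2

theorem rootPoly_eq_of_ne_zero {K : Type*} [Field K] {n : ℕ} (r : Fin n → Fin 2 → K)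
    (h : ∀ i, r i 1 ≠ 0) :
    rootPoly r = Polynomial.C (∏ i, r i 1) *
      ∏ i, (Polynomial.X - Polynomial.C (r i 0 / r i 1)) := by
  rw [map_prod, ← Finset.prod_mul_distrib, rootPoly]
  refine Finset.prod_congr rfl fun i _ => ?_
  rw [mul_sub, ← Polynomial.C_mul, mul_div_cancel₀ _ (h i)]

theorem eval_derivative_prod_X_sub_C {K : Type*} [Field K] {n : ℕ} (t : Fin n → K) (i : Fin n) :
    (∏ j, (Polynomial.X - Polynomial.C (t j))).derivative.eval (t i) =
      ∏ j ∈ Finset.univ.erase i, (t i - t j) := by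
  rw [Polynomial.derivative_prod_finset, Polynomial.eval_finsetSum, Finset.sum_eq_single i]
  · simp [Polynomial.eval_prod]
  · intro b _ hb
    rw [Polynomial.eval_mul, Polynomial.eval_prod, Finset.prod_eq_zero (i := i)]
    · simp
    · simpa using hb.symm
    · simp
  · simp

/-- With all roots `t_i = x_i / z_i` finite, the resultant is a power of the leading coefficient `L
= ∏ z_i` times `∏ f'(t_i)`, and `f'(t_i) = L ∏ (t_i - t_j)`. Comparing powers of `L` with the
brackets `z_i z_j (t_i - t_j)` gives the claim after cancelling one `L`. -/
theorem aeval_disc_rootForm_of_ne_zero {k K : Type*} [Field k] [Field K] [Algebra k K] {g : ℕ}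
    (r : Fin (2 * g + 2) → Fin 2 → K) (h : ∀ i, r i 1 ≠ 0) :
    MvPolynomial.aeval (rootForm r) (disc g k) = discSign g K * bracketProd r := by
  have hres := resultant_eq_disc (k := k) (rootForm r)
  set t : Fin (2 * g + 2) → K := fun i => r i 0 / r i 1 with ht
  set L : K := ∏ i, r i 1 with hL
  have hL0 : L ≠ 0 := Finset.prod_ne_zero_iff.2 fun i _ => h i
  rw [rootForm_last, affinePoly_rootForm, ← hL] at hres
  have hf : rootPoly r = Polynomial.C L * ∏ i, (Polynomial.X - Polynomial.C (t i)) :=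
    rootPoly_eq_of_ne_zero r h
  have hd : (rootPoly r).natDegree = 2 * g + 2 := by
    rw [hf, Polynomial.natDegree_C_mul hL0, Polynomial.natDegree_finsetProd_X_sub_C_eq_card]
    simp
  have hlead : (rootPoly r).leadingCoeff = L := by
    rw [Polynomial.leadingCoeff, hd, hL, ← rootForm_last]; rfl
  have hsplit : (rootPoly r).Splits := by
    rw [hf]
    exact (Polynomial.Splits.C _).mul (Polynomial.Splits.prod fun i _ => Polynomial.Splits.X_sub_C _)
  have hroots : (rootPoly r).roots = Finset.univ.val.map t := by
    rw [hf, Polynomial.roots_C_mul _ hL0, Polynomial.roots_prod _ _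
      (Finset.prod_ne_zero_iff.2 fun i _ => Polynomial.X_sub_C_ne_zero _)]
    simp [Multiset.bind_singleton]
  have hder : (rootPoly r).derivative.natDegree ≤ 2 * g + 1 :=
    (Polynomial.natDegree_derivative_le _).trans (by omega)
  have h2 := Polynomial.resultant_eq_prod_eval (rootPoly r) (rootPoly r).derivative (2 * g + 1)
    hder hsplit
  rw [hd, hlead, hroots, Multiset.map_map] at h2
  rw [h2] at hres
  have h3 : (Multiset.map (fun i => (rootPoly r).derivative.eval (t i)) Finset.univ.val).prod =
      L ^ (2 * g + 2) * ∏ i, ∏ j ∈ Finset.univ.erase i, (t i - t j) := by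
    change ∏ i, (rootPoly r).derivative.eval (t i) = _
    simp only [hf, Polynomial.derivative_mul, Polynomial.derivative_C, zero_mul, zero_add,
      Polynomial.eval_mul, Polynomial.eval_C, eval_derivative_prod_X_sub_C]
    rw [Finset.prod_mul_distrib]
    simp
  -- Each index occurs in `2 (2g+1)` of the brackets, hence the exponent `4g+2`.
  have h4 : bracketProd r = L ^ (4 * g + 2) * ∏ i, ∏ j ∈ Finset.univ.erase i, (t i - t j) := by
    have hb : ∀ i j, bracket r i j = r i 1 * r j 1 * (t i - t j) := by
      intro i j
      simp only [bracket, ht]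
      field_simp [h i, h j]
    have hc : ∀ i : Fin (2 * g + 2), ∏ j ∈ Finset.univ.erase i, r j 1 = L / r i 1 := by
      intro i
      rw [eq_div_iff (h i), mul_comm]
      exact Finset.mul_prod_erase _ (fun j => r j 1) (Finset.mem_univ i)
    simp only [bracketProd, hb, Finset.prod_mul_distrib, hc, Finset.prod_const,
      Finset.card_erase_of_mem (Finset.mem_univ _), Finset.card_univ, Fintype.card_fin,
      Finset.prod_div_distrib, Finset.prod_pow]
    rw [← hL]
    have he : 2 * g + 2 - 1 = 2 * g + 1 := rfl
    rw [he]
    field_simp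
    ring
  have h5 : (Multiset.map ((fun x => Polynomial.eval x (Polynomial.derivative (rootPoly r))) ∘ t)
      Finset.univ.val).prod = _ := h3
  rw [h5] at hres
  rw [h4]
  have h6 : L * (discSign g K * MvPolynomial.aeval (rootForm r) (disc g k)) =
      L * (L ^ (4 * g + 2) * ∏ i, ∏ j ∈ Finset.univ.erase i, (t i - t j)) := by
    rw [mul_left_comm, ← mul_assoc, ← hres]
    ring
  rw [← mul_left_cancel₀ hL0 h6, ← mul_assoc, discSign_mul_self, one_mul]

/-- The root vectors with indeterminate entries. -/
def genericRoots (k : Type*) [CommRing k] (n : ℕ) : Fin n → Fin 2 → MvPolynomial (Fin n × Fin 2) k :=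
  fun i l => MvPolynomial.X (i, l)

/-- The universal case: indeterminate `z_i` are nonzero in the fraction field, so the formula for
finite roots applies there. Every other system of root vectors, with roots at infinity allowed, is a
specialization of this one. -/
theorem aeval_disc_genericRoots (k : Type*) [Field k] (g : ℕ) :
    MvPolynomial.aeval (rootForm (genericRoots k (2 * g + 2))) (disc g k) =
      discSign g _ * bracketProd (genericRoots k (2 * g + 2)) := by
  let A := MvPolynomial (Fin (2 * g + 2) × Fin 2) k
  let K := FractionRing A
  have hinj : Function.Injective (algebraMap A K) := IsFractionRing.injective A K
  apply hinj
  have h := aeval_disc_rootForm_of_ne_zero (k := k) (K := K)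
    (fun i l => algebraMap A K (genericRoots k (2 * g + 2) i l))
    (fun i => (map_ne_zero_iff _ hinj).2 (MvPolynomial.X_ne_zero _))
  rw [← bracketProd_map] at h
  have h1 : (rootForm fun i l => algebraMap A K (genericRoots k (2 * g + 2) i l)) =
      fun j => algebraMap A K (rootForm (genericRoots k (2 * g + 2)) j) :=
    funext fun j => (map_rootForm _ _ _).symm
  rw [h1] at h
  have h2 := MvPolynomial.aeval_algebraMap_apply (R := k) K
    (rootForm (genericRoots k (2 * g + 2))) (disc g k)
  rw [map_mul, ← h2]
  refine h.trans ?_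
  simp [discSign, A, K]

/-- The discriminant of the form with given root vectors. -/
theorem aeval_disc_rootForm {k A : Type*} [Field k] [CommRing A] [Algebra k A] {g : ℕ}
    (r : Fin (2 * g + 2) → Fin 2 → A) :
    MvPolynomial.aeval (rootForm r) (disc g k) = discSign g A * bracketProd r := by
  have h := congrArg (MvPolynomial.aeval (R := k) (fun p : Fin (2 * g + 2) × Fin 2 => r p.1 p.2))
    (aeval_disc_genericRoots k g)
  have h1 : ∀ j, MvPolynomial.aeval (R := k) (fun p : Fin (2 * g + 2) × Fin 2 => r p.1 p.2)
      (rootForm (genericRoots k (2 * g + 2)) j) = rootForm r j := by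
    intro j
    have := map_rootForm
      (MvPolynomial.aeval (R := k) (fun p : Fin (2 * g + 2) × Fin 2 => r p.1 p.2)).toRingHom
      (genericRoots k (2 * g + 2)) j
    simpa [genericRoots] using this
  have h2 := bracketProd_map
    (MvPolynomial.aeval (R := k) (fun p : Fin (2 * g + 2) × Fin 2 => r p.1 p.2)).toRingHom
      (genericRoots k (2 * g + 2))
  rw [MvPolynomial.comp_aeval_apply] at h
  simp only [h1, map_mul] at h
  rw [h]
  congr 1
  · simp [discSign]
  · simpa [genericRoots] using h2

theorem eval_disc_rootForm {k : Type*} [Field k] {g : ℕ} (r : Fin (2 * g + 2) → Fin 2 → k) :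
    MvPolynomial.eval (rootForm r) (disc g k) = discSign g k * bracketProd r := by
  rw [← aeval_disc_rootForm (k := k) r]
  rfl

theorem exists_C_mul_rootPoly {k : Type*} [Field k] [IsAlgClosed k] (n : ℕ) :
    ∀ p : Polynomial k, p.natDegree ≤ n →
      ∃ (a : k) (r : Fin n → Fin 2 → k), p = Polynomial.C a * rootPoly r := by
  induction n with
  | zero =>
    intro p hp
    exact ⟨p.coeff 0, Fin.elim0, by
      rw [rootPoly, Fin.prod_univ_zero, mul_one]
      exact Polynomial.eq_C_of_natDegree_le_zero hp⟩
  | succ n ih =>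
    intro p hp
    rcases hp.lt_or_eq with h | h
    · obtain ⟨a, r, hr⟩ := ih p (by omega)
      -- A missing degree becomes a root at infinity: the vector `(-1, 0)` contributes the factor `0
      -- * X + 1`.
      refine ⟨a, Fin.cons ![-1, 0] r, ?_⟩
      rw [rootPoly, Fin.prod_univ_succ]
      simp only [Fin.cons_zero, Fin.cons_succ]
      simpa [rootPoly] using hr
    · obtain ⟨x, hx⟩ := IsAlgClosed.exists_root p (by
        intro h0
        rw [Polynomial.natDegree_eq_of_degree_eq_some h0] at h
        exact absurd h (by simp))
      obtain ⟨q, hq⟩ := Polynomial.dvd_iff_isRoot.2 hx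
      have hq0 : q ≠ 0 := by
        rintro rfl
        rw [hq, mul_zero, Polynomial.natDegree_zero] at h
        omega
      have hqd : q.natDegree ≤ n := by
        rw [hq, Polynomial.natDegree_mul (Polynomial.X_sub_C_ne_zero x) hq0,
          Polynomial.natDegree_X_sub_C] at h
        omega
      obtain ⟨a, r, hr⟩ := ih q hqd
      refine ⟨a, Fin.cons ![x, 1] r, ?_⟩
      rw [rootPoly, Fin.prod_univ_succ]
      simp only [Fin.cons_zero, Fin.cons_succ]
      rw [hq, hr, rootPoly]
      simp
      ring

/-- Over an algebraically closed field every binary form is a product of linear forms. -/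
theorem exists_rootForm {k : Type*} [Field k] [IsAlgClosed k] {g : ℕ} (c : Fin (2 * g + 3) → k) :
    ∃ r : Fin (2 * g + 2) → Fin 2 → k, rootForm r = c := by
  obtain ⟨a, r, hr⟩ := exists_C_mul_rootPoly (2 * g + 2) (affinePoly c) (natDegree_affinePoly_le c)
  -- The constant is absorbed into one of the root vectors.
  refine ⟨fun i => if i = 0 then fun l => a * r i l else r i, affinePoly_injective ?_⟩
  rw [affinePoly_rootForm, hr, rootPoly, rootPoly, Fin.prod_univ_succ,
    Fin.prod_univ_succ fun i => Polynomial.C (r i 1) * Polynomial.X - Polynomial.C (r i 0)]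
  simp only [if_true, Fin.succ_ne_zero, if_false]
  rw [← mul_assoc]
  congr 1
  simp only [Polynomial.C_mul]
  ring

/-! ### Linear substitutions -/

/-- The action of a linear substitution on root vectors. -/
def substRoots {k : Type*} [CommRing k] (M : GL (Fin 2) k) {n : ℕ} (r : Fin n → Fin 2 → k) :
    Fin n → Fin 2 → k :=
  fun i => ![M 1 1 * r i 0 - M 0 1 * r i 1, M 0 0 * r i 1 - M 1 0 * r i 0]

/-- Collecting terms in `z (M₀₀ X + M₀₁ Z) - x (M₁₀ X + M₁₁ Z)` shows that the root vector is
transformed by the adjugate of `M`. The adjugate, in contrast to the inverse, introduces no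
denominators. -/
theorem subst_toPoly_rootForm {k : Type*} [CommRing k] {g : ℕ} (M : GL (Fin 2) k)
    (r : Fin (2 * g + 2) → Fin 2 → k) :
    subst M (toPoly (rootForm r)) = toPoly (rootForm (substRoots M r)) := by
  rw [toPoly_rootForm, toPoly_rootForm, map_prod]
  refine Finset.prod_congr rfl fun i _ => ?_
  simp [subst, substRoots, Fin.sum_univ_two]
  ring

theorem bracket_substRoots {k : Type*} [CommRing k] (M : GL (Fin 2) k) {n : ℕ}
    (r : Fin n → Fin 2 → k) (i j : Fin n) :
    bracket (substRoots M r) i j = (M : Matrix (Fin 2) (Fin 2) k).det * bracket r i j := by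
  simp [bracket, substRoots, Matrix.det_fin_two]
  ring

theorem bracketProd_substRoots {k : Type*} [CommRing k] (M : GL (Fin 2) k) {n : ℕ}
    (r : Fin n → Fin 2 → k) :
    bracketProd (substRoots M r) =
      (M : Matrix (Fin 2) (Fin 2) k).det ^ (n * (n - 1)) * bracketProd r := by
  simp only [bracketProd, bracket_substRoots, Finset.prod_mul_distrib, Finset.prod_const,
    Finset.card_erase_of_mem (Finset.mem_univ _), Finset.card_univ, Fintype.card_fin]
  rw [← pow_mul, mul_comm n]

theorem det_ne_zero_of_GL {k : Type*} [Field k] (M : GL (Fin 2) k) :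
    (M : Matrix (Fin 2) (Fin 2) k).det ≠ 0 :=
  ((Matrix.isUnit_iff_isUnit_det _).1 M.isUnit).ne_zero

theorem exists_subst_eq {k : Type*} [Field k] [IsAlgClosed k] {g : ℕ} (M : GL (Fin 2) k)
    (c : Fin (2 * g + 3) → k) (hc : MvPolynomial.eval c (disc g k) ≠ 0) :
    ∃ c' : Fin (2 * g + 3) → k, toPoly c' = subst M (toPoly c) ∧
      MvPolynomial.eval c' (disc g k) ≠ 0 := by
  obtain ⟨r, rfl⟩ := exists_rootForm c
  refine ⟨_, (subst_toPoly_rootForm M r).symm, ?_⟩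
  rw [eval_disc_rootForm, bracketProd_substRoots] 
  rw [eval_disc_rootForm] at hc
  exact mul_ne_zero (left_ne_zero_of_mul hc)
    (mul_ne_zero (pow_ne_zero _ (det_ne_zero_of_GL M)) (right_ne_zero_of_mul hc))

theorem subst_mul {k : Type*} [CommRing k] (M N : GL (Fin 2) k) (p : MvPolynomial (Fin 2) k) :
    subst (M * N) p = subst N (subst M p) := by
  rw [← AlgHom.comp_apply]
  refine DFunLike.congr_fun (MvPolynomial.algHom_ext fun i => ?_) p
  simp [subst, Fin.sum_univ_two, Matrix.mul_apply]
  ring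


/-! ### Symmetric multihomogeneous functions of the roots -/

/-- The value of a polynomial in the entries of the root vectors. -/
def evalRoots {k : Type*} [CommRing k] {n : ℕ} (r : Fin n → Fin 2 → k)
    (Ψ : MvPolynomial (Fin n × Fin 2) k) : k :=
  MvPolynomial.eval (fun p => r p.1 p.2) Ψ

theorem eval_esymm {k : Type*} [Field k] {n : ℕ} (t : Fin n → k) (i : Fin n) :
    MvPolynomial.eval t (MvPolynomial.esymm (Fin n) k (i + 1)) =
      (-1) ^ ((i : ℕ) + 1) *
        (∏ j, (Polynomial.X - Polynomial.C (t j))).coeff (n - ((i : ℕ) + 1)) := by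
  have h1 := MvPolynomial.aeval_esymm_eq_multiset_esymm (Fin n) k (i + 1) t
  have hcard : (Finset.univ.val.map t).card = n := by simp
  have h2 := Multiset.prod_X_sub_C_coeff (Finset.univ.val.map t) (k := n - ((i : ℕ) + 1))
    (by rw [hcard]; omega)
  have h3 : n - (n - ((i : ℕ) + 1)) = i + 1 := by omega
  rw [hcard, h3, Multiset.map_map] at h2
  have h4 : (Multiset.map ((fun t => Polynomial.X - Polynomial.C t) ∘ t) Finset.univ.val).prod =
    ∏ j, (Polynomial.X - Polynomial.C (t j)) := rfl
  rw [h4] at h2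
  rw [h2, ← mul_assoc, ← mul_pow, ← h1]
  simp only [mul_neg, mul_one, neg_neg, one_pow, one_mul]
  rfl

/-- Meant for the elementary symmetric functions of finite roots, which are, up to the signs `e i`,
the quotients of coefficients by the leading coefficient `c l`. -/
theorem exists_homogenized {k : Type*} [Field k] {σ τ : Type*} (l : τ) (s : σ → τ) (e : σ → k)
    (Q : MvPolynomial σ k) :
    ∃ (d : ℕ) (P : MvPolynomial τ k), ∀ c : τ → k, c l ≠ 0 →
      MvPolynomial.eval (fun i => e i * (c (s i) / c l)) Q * c l ^ d = MvPolynomial.eval c P := by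
  induction Q using MvPolynomial.induction_on with
  | C a => exact ⟨0, MvPolynomial.C a, fun c _ => by simp⟩
  | add p q hp hq =>
    obtain ⟨d, P, hP⟩ := hp
    obtain ⟨d', P', hP'⟩ := hq
    refine ⟨d + d', P * MvPolynomial.X l ^ d' + P' * MvPolynomial.X l ^ d, fun c hc => ?_⟩
    simp only [map_add, map_mul, map_pow, MvPolynomial.eval_X, ← hP c hc, ← hP' c hc]
    ring
  | mul_X p i hp =>
    obtain ⟨d, P, hP⟩ := hp
    refine ⟨d + 1, P * (MvPolynomial.C (e i) * MvPolynomial.X (s i)), fun c hc => ?_⟩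
    simp only [map_mul, MvPolynomial.eval_X, MvPolynomial.eval_C, ← hP c hc]
    field_simp
    ring

/-- Setting `X l` to zero kills `P`, because a polynomial over an infinite field is determined by
its values; and this substitution is the identity modulo `X l`. -/
theorem X_dvd_of_eval_eq_zero {k : Type*} [Field k] [Infinite k] {σ : Type*}
    (l : σ) (P : MvPolynomial σ k)
    (h : ∀ c : σ → k, c l = 0 → MvPolynomial.eval c P = 0) : MvPolynomial.X l ∣ P := by
  classical
  have h0 : MvPolynomial.aeval (fun j => if j = l then (0 : MvPolynomial σ k) else
      MvPolynomial.X j) P = 0 := by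
    apply MvPolynomial.funext
    intro c
    rw [map_zero, ← h (fun j => if j = l then 0 else c j) (by simp)]
    have := MvPolynomial.comp_aeval_apply (R := k)
      (fun j => if j = l then (0 : MvPolynomial σ k) else MvPolynomial.X j)
      (MvPolynomial.aeval (R := k) c) P
    change MvPolynomial.aeval c _ = MvPolynomial.aeval _ P
    rw [this]
    congr 2
    ext j
    split_ifs <;> simp
  rw [← Ideal.mem_span_singleton, ← Ideal.Quotient.eq_zero_iff_mem]
  have h1 : (Ideal.Quotient.mkₐ k (Ideal.span {MvPolynomial.X l})).comp
      (MvPolynomial.aeval (fun j => if j = l then (0 : MvPolynomial σ k) else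
      MvPolynomial.X j)) = Ideal.Quotient.mkₐ k (Ideal.span {MvPolynomial.X (R := k) l}) := by
    ext j : 1
    simp only [AlgHom.comp_apply, MvPolynomial.aeval_X]
    split_ifs with hj
    · subst hj
      rw [map_zero]
      exact (Ideal.Quotient.eq_zero_iff_mem.2 (Ideal.mem_span_singleton_self _)).symm
    · rfl
  have h2 := DFunLike.congr_fun h1 P
  rw [AlgHom.comp_apply, h0, map_zero] at h2
  exact h2.symm

theorem eval_rootForm_eq {k : Type*} [Field k] {g : ℕ} (P : MvPolynomial (Fin (2 * g + 3)) k)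
    (r : Fin (2 * g + 2) → Fin 2 → k) :
    evalRoots r (MvPolynomial.aeval (rootForm (genericRoots k (2 * g + 2))) P) =
      MvPolynomial.eval (rootForm r) P := by
  have h := MvPolynomial.comp_aeval_apply (R := k) (rootForm (genericRoots k (2 * g + 2)))
    (MvPolynomial.aeval (R := k) (fun p : Fin (2 * g + 2) × Fin 2 => r p.1 p.2)) P
  refine h.trans ?_
  have h1 : ∀ j, MvPolynomial.aeval (R := k) (fun p : Fin (2 * g + 2) × Fin 2 => r p.1 p.2)
      (rootForm (genericRoots k (2 * g + 2)) j) = rootForm r j := by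
    intro j
    have := map_rootForm
      (MvPolynomial.aeval (R := k) (fun p : Fin (2 * g + 2) × Fin 2 => r p.1 p.2)).toRingHom
      (genericRoots k (2 * g + 2)) j
    simpa [genericRoots] using this
  simp only [h1]
  rfl

/-- While a factor `∏ z_i` is present, `Q` vanishes on all forms with leading coefficient zero,
hence is divisible by that coefficient. One factor is cancelled among polynomials in the generic
roots, and the argument repeats. -/
theorem exists_poly_of_mul_pow {k : Type*} [Field k] [IsAlgClosed k] {g : ℕ}
    (Ψ : MvPolynomial (Fin (2 * g + 2) × Fin 2) k) (d : ℕ) :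
    ∀ Q : MvPolynomial (Fin (2 * g + 3)) k,
      (∀ r, MvPolynomial.eval (rootForm r) Q = evalRoots r Ψ * (∏ i, r i 1) ^ d) →
      ∃ P : MvPolynomial (Fin (2 * g + 3)) k,
        ∀ r, MvPolynomial.eval (rootForm r) P = evalRoots r Ψ := by
  have : Infinite k := IsAlgClosed.instInfinite
  induction d with
  | zero => exact fun Q hQ => ⟨Q, fun r => by rw [hQ, pow_zero, mul_one]⟩
  | succ d ih =>
    intro Q hQ
    have hdvd : MvPolynomial.X (Fin.last _) ∣ Q := by
      refine X_dvd_of_eval_eq_zero _ _ fun c hc => ?_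
      obtain ⟨r, rfl⟩ := exists_rootForm c
      rw [rootForm_last] at hc
      rw [hQ, hc]
      simp
    obtain ⟨Q', rfl⟩ := hdvd
    refine ih Q' fun r => ?_
    let L : MvPolynomial (Fin (2 * g + 2) × Fin 2) k := ∏ i, MvPolynomial.X (i, 1)
    have hL : ∀ r : Fin (2 * g + 2) → Fin 2 → k, evalRoots r L = ∏ i, r i 1 := by
      intro r
      simp [evalRoots, L]
    have hL0 : L ≠ 0 := Finset.prod_ne_zero_iff.2 fun i _ => MvPolynomial.X_ne_zero _
    have key : L * MvPolynomial.aeval (rootForm (genericRoots k (2 * g + 2))) Q' =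
        L * (Ψ * L ^ d) := by
      apply MvPolynomial.funext
      intro x
      have h1 := hQ (fun i l => x (i, l))
      have h2 := eval_rootForm_eq Q' (fun i l => x (i, l))
      have h3 := hL (fun i l => x (i, l))
      simp only [evalRoots] at h1 h2 h3
      simp only [map_mul, MvPolynomial.eval_X, rootForm_last] at h1
      simp only [map_mul, map_pow]
      rw [h2, h3, h1]
      ring
    have key2 := mul_left_cancel₀ hL0 key
    rw [← eval_rootForm_eq, key2, ← hL]
    simp [evalRoots]

/-- A symmetric multihomogeneous polynomial in the root vectors is a polynomial in the
coefficients of the form. -/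
theorem exists_poly_of_symmetric {k : Type*} [Field k] [IsAlgClosed k] {g : ℕ}
    (Ψ : MvPolynomial (Fin (2 * g + 2) × Fin 2) k) (D : ℕ)
    (hsym : ∀ (π : Equiv.Perm (Fin (2 * g + 2))) (r : Fin (2 * g + 2) → Fin 2 → k),
      evalRoots (fun i => r (π i)) Ψ = evalRoots r Ψ)
    (hhom : ∀ (a : Fin (2 * g + 2) → k) (r : Fin (2 * g + 2) → Fin 2 → k),
      evalRoots (fun i l => a i * r i l) Ψ = (∏ i, a i) ^ D * evalRoots r Ψ) :
    ∃ P : MvPolynomial (Fin (2 * g + 3)) k,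
      ∀ r, MvPolynomial.eval (rootForm r) P = evalRoots r Ψ := by
  have : Infinite k := IsAlgClosed.instInfinite
  -- Dehomogenizing at `z_i = 1` gives an ordinary symmetric polynomial in the `x_i`, to which the
  -- fundamental theorem on symmetric polynomials applies.
  let Ψ₁ : MvPolynomial (Fin (2 * g + 2)) k :=
    MvPolynomial.aeval (fun p : Fin (2 * g + 2) × Fin 2 => ![MvPolynomial.X p.1, 1] p.2) Ψ
  have hΨ₁ : ∀ t, MvPolynomial.eval t Ψ₁ = evalRoots (fun i => ![t i, 1]) Ψ := by
    intro t
    refine (MvPolynomial.comp_aeval_apply (R := k) _ (MvPolynomial.aeval (R := k) t) Ψ).trans ?_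
    have : (fun p : Fin (2 * g + 2) × Fin 2 => MvPolynomial.aeval (R := k) t
        ((![MvPolynomial.X p.1, 1] : Fin 2 → MvPolynomial (Fin (2 * g + 2)) k) p.2)) =
        fun p => (![t p.1, 1] : Fin 2 → k) p.2 := by
      funext ⟨i, l⟩
      fin_cases l <;> simp
    rw [this]
    rfl
  have hsymm : Ψ₁.IsSymmetric := by
    intro π
    apply MvPolynomial.funext
    intro t
    rw [MvPolynomial.eval_rename, hΨ₁, hΨ₁]
    exact hsym π fun i => ![t i, 1]
  obtain ⟨Q, hQ⟩ := MvPolynomial.esymmAlgHom_surjective (σ := Fin (2 * g + 2)) (n := 2 * g + 2) k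
    (by simp) ⟨Ψ₁, hsymm⟩
  have hQ' := congrArg Subtype.val hQ
  rw [MvPolynomial.esymmAlgHom_apply] at hQ'
  have hQ2 : ∀ t, MvPolynomial.eval (fun i : Fin (2 * g + 2) => (-1) ^ ((i : ℕ) + 1) *
        (∏ j, (Polynomial.X - Polynomial.C (t j))).coeff (2 * g + 2 - ((i : ℕ) + 1))) Q =
      MvPolynomial.eval t Ψ₁ := by
    intro t
    change _ = MvPolynomial.eval t (⟨Ψ₁, hsymm⟩ : MvPolynomial.symmetricSubalgebra _ k).val
    rw [← hQ']
    simp only [← eval_esymm]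
    exact (MvPolynomial.comp_aeval_apply (R := k) _ (MvPolynomial.aeval (R := k) t) Q).symm
  obtain ⟨d, P, hP⟩ := exists_homogenized (Fin.last (2 * g + 2))
    (fun i : Fin (2 * g + 2) => (⟨2 * g + 2 - ((i : ℕ) + 1), by omega⟩ : Fin (2 * g + 3)))
    (fun i => (-1) ^ ((i : ℕ) + 1)) Q
  -- For finite roots `Ψ` is `(∏ z_i)^D` times the value of `Ψ₁` at the quotients `x_i / z_i`.
  -- Clearing denominators costs `(∏ z_i)^d`, a factor which is then removed again.
  refine exists_poly_of_mul_pow Ψ d (MvPolynomial.X (Fin.last _) ^ D * P) fun r => ?_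
  let L : MvPolynomial (Fin (2 * g + 2) × Fin 2) k := ∏ i, MvPolynomial.X (i, 1)
  have hL0 : L ≠ 0 := Finset.prod_ne_zero_iff.2 fun i _ => MvPolynomial.X_ne_zero _
  have hL : ∀ r : Fin (2 * g + 2) → Fin 2 → k, evalRoots r L = ∏ i, r i 1 := by
    intro r
    simp [evalRoots, L]
  have main : ∀ r : Fin (2 * g + 2) → Fin 2 → k, (∀ i, r i 1 ≠ 0) →
      MvPolynomial.eval (rootForm r) (MvPolynomial.X (Fin.last _) ^ D * P) =
        evalRoots r Ψ * (∏ i, r i 1) ^ d := by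
    intro r hr
    have hL1 : ∏ i, r i 1 ≠ 0 := Finset.prod_ne_zero_iff.2 fun i _ => hr i
    have h1 := hP (rootForm r) (by rw [rootForm_last]; exact hL1)
    have h2 := hhom (fun i => r i 1) (fun i => ![r i 0 / r i 1, 1])
    have h3 : (fun (i : Fin (2 * g + 2)) (l : Fin 2) => r i 1 *
        (![r i 0 / r i 1, 1] : Fin 2 → k) l) = r := by
      funext i l
      fin_cases l
      · simp [mul_div_cancel₀ _ (hr i)]
      · simp
    rw [h3] at h2
    have h4 : ∀ i : Fin (2 * g + 2),
        (∏ j, (Polynomial.X - Polynomial.C (r j 0 / r j 1))).coeff (2 * g + 2 - ((i : ℕ) + 1)) =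
        rootForm r ⟨2 * g + 2 - ((i : ℕ) + 1), by omega⟩ / rootForm r (Fin.last _) := by
      intro i
      rw [rootForm_last, eq_div_iff hL1, rootForm, rootPoly_eq_of_ne_zero r hr,
        Polynomial.coeff_C_mul, mul_comm]
    have h5 := hQ2 (fun j => r j 0 / r j 1)
    simp only [h4, hΨ₁] at h5
    rw [map_mul, map_pow, MvPolynomial.eval_X, ← h1, h5, h2, rootForm_last]
    ring
  generalize (MvPolynomial.X (Fin.last _) ^ D * P : MvPolynomial (Fin (2 * g + 3)) k) = R at main ⊢
  -- The additional factor `L` makes both sides vanish as soon as some `z_i` is zero, so that the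
  -- identity for finite roots suffices at every point.
  have key : L * MvPolynomial.aeval (rootForm (genericRoots k (2 * g + 2))) R = L * (Ψ * L ^ d) := by
    apply MvPolynomial.funext
    intro x
    have h2 := eval_rootForm_eq R (fun i l => x (i, l))
    have h3 := hL (fun i l => x (i, l))
    simp only [evalRoots] at h2 h3
    rw [map_mul, h2, h3, map_mul, map_mul, map_pow, h3]
    by_cases hx : ∀ i, x (i, 1) ≠ 0
    · rw [main (fun i l => x (i, l)) hx, evalRoots]
    · push Not at hx
      obtain ⟨i, hi⟩ := hx
      rw [Finset.prod_eq_zero (Finset.mem_univ i) hi, zero_mul, zero_mul]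
  have key2 := mul_left_cancel₀ hL0 key
  rw [← eval_rootForm_eq, key2, ← hL]
  simp [evalRoots]

end

end Hyperelliptic

namespace Hyperelliptic

universe u

noncomputable section

/-! ### Cross ratios and invariant functions -/

/-- The cross ratio of four root vectors. -/
def crossRatio {K : Type*} [Field K] {n : ℕ} (r : Fin n → Fin 2 → K) (q : Fin 4 ↪ Fin n) : K :=
  bracket r (q 0) (q 1) * bracket r (q 2) (q 3) / (bracket r (q 0) (q 3) * bracket r (q 2) (q 1))

/-- A linear combination of cross ratios. -/
def crossSum {k K : Type*} [Field k] [Field K] [Algebra k K] {n : ℕ} (u : (Fin 4 ↪ Fin n) → k)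
    (r : Fin n → Fin 2 → K) : K :=
  ∑ q, u q • crossRatio r q

/-- The pairs of indices whose brackets are left when the denominator of the cross ratio is
removed from the product of all the brackets. -/
def restPairs {n : ℕ} (q : Fin 4 ↪ Fin n) : Finset (Fin n × Fin n) :=
  (Finset.univ.offDiag.erase (q 0, q 3)).erase (q 2, q 1)

/-- The cross ratio multiplied by all the brackets. -/
def crossNum {R : Type*} [CommRing R] {n : ℕ} (r : Fin n → Fin 2 → R) (q : Fin 4 ↪ Fin n) : R :=
  bracket r (q 0) (q 1) * bracket r (q 2) (q 3) *
    ∏ p ∈ restPairs q, bracket r p.1 p.2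

theorem prod_offDiag {M : Type*} [CommMonoid M] {n : ℕ} (f : Fin n × Fin n → M) :
    ∏ p ∈ Finset.univ.offDiag, f p = ∏ i, ∏ j ∈ Finset.univ.erase i, f (i, j) := by
  rw [Finset.prod_sigma']
  refine Finset.prod_nbij' (fun p => ⟨p.1, p.2⟩) (fun p => (p.1, p.2)) ?_ ?_ ?_ ?_ ?_
  · simp [eq_comm]
  · simp [eq_comm]
  · simp
  · simp
  · simp

theorem mul_prod_restPairs {M : Type*} [CommMonoid M] {n : ℕ} (f : Fin n × Fin n → M)
    (q : Fin 4 ↪ Fin n) :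
    f (q 0, q 3) * f (q 2, q 1) * ∏ p ∈ restPairs q, f p =
      ∏ i, ∏ j ∈ Finset.univ.erase i, f (i, j) := by
  have h03 : q 0 ≠ q 3 := q.injective.ne (by decide)
  have h21 : q 2 ≠ q 1 := q.injective.ne (by decide)
  have h20 : q 2 ≠ q 0 := q.injective.ne (by decide)
  rw [← prod_offDiag, ← Finset.mul_prod_erase Finset.univ.offDiag f (a := (q 0, q 3))
      (by simp),
    ← Finset.mul_prod_erase (Finset.univ.offDiag.erase (q 0, q 3)) f (a := (q 2, q 1))
      (by simp [h20]), mul_assoc]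
  rfl

theorem crossNum_map {R S : Type*} [CommRing R] [CommRing S] (φ : R →+* S) {n : ℕ}
    (r : Fin n → Fin 2 → R) (q : Fin 4 ↪ Fin n) :
    φ (crossNum r q) = crossNum (fun i l => φ (r i l)) q := by
  simp [crossNum, bracket]

theorem crossNum_eq {K : Type*} [Field K] {n : ℕ} (r : Fin n → Fin 2 → K)
    (h : bracketProd r ≠ 0) (q : Fin 4 ↪ Fin n) :
    crossNum r q = crossRatio r q * bracketProd r := by
  rw [bracketProd_ne_zero_iff] at h
  have h03 := h _ _ (q.injective.ne (show (0 : Fin 4) ≠ 3 by decide))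
  have h21 := h _ _ (q.injective.ne (show (2 : Fin 4) ≠ 1 by decide))
  have h1 := mul_prod_restPairs (fun p => bracket r p.1 p.2) q
  rw [bracketProd, ← h1, crossNum, crossRatio]
  field_simp

/-- Every index occurs `n - 1` times in the first place of a pair and `n - 1` times in the second.
-/
theorem prod_pairs_mul {R : Type*} [CommRing R] {n : ℕ} (a : Fin n → R) :
    ∏ i, ∏ j ∈ Finset.univ.erase i, (a i * a j) = (∏ i, a i) ^ (2 * (n - 1)) := by
  rcases n with _ | n
  · simp
  simp only [Finset.prod_mul_distrib, Finset.prod_const,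
    Finset.card_erase_of_mem (Finset.mem_univ _), Finset.card_univ, Fintype.card_fin]
  have h : ∏ i : Fin (n + 1), ∏ j ∈ Finset.univ.erase i, a j =
      ∏ i : Fin (n + 1), ∏ j ∈ Finset.univ.erase i, a i := by
    rw [← prod_offDiag fun p => a p.2, ← prod_offDiag fun p => a p.1]
    refine Finset.prod_nbij' Prod.swap Prod.swap ?_ ?_ ?_ ?_ ?_ <;> simp [eq_comm]
  rw [h]
  simp only [Finset.prod_const,
    Finset.card_erase_of_mem (Finset.mem_univ _), Finset.card_univ, Fintype.card_fin,
    Finset.prod_pow]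
  rw [← pow_add, two_mul]

theorem bracket_scale {R : Type*} [CommRing R] {n : ℕ} (a : Fin n → R)
    (r : Fin n → Fin 2 → R) (i j : Fin n) :
    bracket (fun i l => a i * r i l) i j = a i * a j * bracket r i j := by
  simp only [bracket]
  ring

theorem bracketProd_scale {R : Type*} [CommRing R] {n : ℕ} (a : Fin n → R)
    (r : Fin n → Fin 2 → R) :
    bracketProd (fun i l => a i * r i l) = (∏ i, a i) ^ (2 * (n - 1)) * bracketProd r := by
  simp only [bracketProd, bracket_scale]
  rw [← prod_pairs_mul, ← Finset.prod_mul_distrib]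
  exact Finset.prod_congr rfl fun i _ => Finset.prod_mul_distrib

theorem crossNum_scale {R : Type*} [CommRing R] {n : ℕ} (a : Fin n → R)
    (r : Fin n → Fin 2 → R) (q : Fin 4 ↪ Fin n) :
    crossNum (fun i l => a i * r i l) q = (∏ i, a i) ^ (2 * (n - 1)) * crossNum r q := by
  rw [← prod_pairs_mul, ← mul_prod_restPairs (fun p => a p.1 * a p.2) q]
  simp only [crossNum, bracket_scale]
  rw [Finset.prod_mul_distrib]
  ring

theorem crossRatio_substRoots {K : Type*} [Field K] {n : ℕ} (M : GL (Fin 2) K)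
    (r : Fin n → Fin 2 → K) (q : Fin 4 ↪ Fin n) :
    crossRatio (substRoots M r) q = crossRatio r q := by
  simp only [crossRatio, bracket_substRoots]
  rw [mul_mul_mul_comm, mul_mul_mul_comm _ _ _ (bracket r (q 2) (q 1))]
  exact mul_div_mul_left _ _ (mul_ne_zero (det_ne_zero_of_GL M) (det_ne_zero_of_GL M))

/-- The product of `T - crossSum u` over all the orderings of the roots, with the denominators
cleared. -/
def invPoly {k R : Type*} [CommRing k] [CommRing R] [Algebra k R] {n : ℕ}
    (u : (Fin 4 ↪ Fin n) → k) (T : k) (r : Fin n → Fin 2 → R) : R :=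
  ∏ π : Equiv.Perm (Fin n), (algebraMap k R T * bracketProd r -
    ∑ q, algebraMap k R (u q) * crossNum (fun i => r (π i)) q)

theorem invPoly_map {k R S : Type*} [CommRing k] [CommRing R] [CommRing S] [Algebra k R]
    [Algebra k S] (φ : R →ₐ[k] S) {n : ℕ}
    (u : (Fin 4 ↪ Fin n) → k) (T : k) (r : Fin n → Fin 2 → R) :
    φ (invPoly u T r) = invPoly u T (fun i l => φ (r i l)) := by
  have h1 := bracketProd_map φ.toRingHom r
  have h2 := fun π : Equiv.Perm (Fin n) => crossNum_map φ.toRingHom (fun i => r (π i))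
  simp only [AlgHom.toRingHom_eq_coe, RingHom.coe_coe] at h1 h2
  simp [invPoly, h1, h2]

theorem invPoly_eq {k K : Type*} [Field k] [Field K] [Algebra k K] {n : ℕ}
    (u : (Fin 4 ↪ Fin n) → k) (T : k) (r : Fin n → Fin 2 → K) (h : bracketProd r ≠ 0) :
    invPoly u T r = bracketProd r ^ Fintype.card (Equiv.Perm (Fin n)) *
      ∏ π : Equiv.Perm (Fin n), (algebraMap k K T - crossSum u (fun i => r (π i))) := by
  rw [← Finset.card_univ, ← Finset.prod_const, ← Finset.prod_mul_distrib, invPoly]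
  refine Finset.prod_congr rfl fun π _ => ?_
  have hπ : ∀ q, crossNum (fun i => r (π i)) q = crossRatio (fun i => r (π i)) q * bracketProd r := by
    intro q
    rw [crossNum_eq _ (by rwa [bracketProd_comp_perm]), bracketProd_comp_perm]
  simp only [hπ, crossSum, Algebra.smul_def, mul_sub, Finset.mul_sum]
  congr 1
  · ring
  · exact Finset.sum_congr rfl fun q _ => by ring

/-- The product over all permutations is symmetric. It is multihomogeneous because `crossNum` arises
from the product of all brackets by replacing two brackets with two others on the same four indices,
so that both terms of each factor have the same degree in every root vector. -/
theorem exists_poly_invPoly {k : Type*} [Field k] [IsAlgClosed k] {g : ℕ}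
    (u : (Fin 4 ↪ Fin (2 * g + 2)) → k) (T : k) :
    ∃ P : MvPolynomial (Fin (2 * g + 3)) k,
      MvPolynomial.aeval (rootForm (genericRoots k (2 * g + 2))) P =
        invPoly u T (genericRoots k (2 * g + 2)) := by
  have : Infinite k := IsAlgClosed.instInfinite
  have hev : ∀ r : Fin (2 * g + 2) → Fin 2 → k,
      evalRoots r (invPoly u T (genericRoots k (2 * g + 2))) = invPoly u T r := by
    intro r
    have := invPoly_map (MvPolynomial.aeval (R := k) (fun p : Fin (2 * g + 2) × Fin 2 => r p.1 p.2))
      u T (genericRoots k (2 * g + 2))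
    simpa [genericRoots, evalRoots] using this
  have hsym : ∀ (π : Equiv.Perm (Fin (2 * g + 2))) (r : Fin (2 * g + 2) → Fin 2 → k),
      evalRoots (fun i => r (π i)) (invPoly u T (genericRoots k (2 * g + 2))) =
        evalRoots r (invPoly u T (genericRoots k (2 * g + 2))) := by
    intro π r
    rw [hev, hev, invPoly, invPoly, bracketProd_comp_perm]
    exact Equiv.prod_comp (Equiv.mulLeft π) fun τ : Equiv.Perm (Fin (2 * g + 2)) =>
      (algebraMap k k T * bracketProd r -
        ∑ q, algebraMap k k (u q) * crossNum (fun i => r (τ i)) q)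
  have hhom : ∀ (a : Fin (2 * g + 2) → k) (r : Fin (2 * g + 2) → Fin 2 → k),
      evalRoots (fun i l => a i * r i l) (invPoly u T (genericRoots k (2 * g + 2))) =
        (∏ i, a i) ^ (2 * (2 * g + 2 - 1) * Fintype.card (Equiv.Perm (Fin (2 * g + 2)))) *
          evalRoots r (invPoly u T (genericRoots k (2 * g + 2))) := by
    intro a r
    rw [hev, hev, invPoly, invPoly, pow_mul, ← Finset.card_univ, ← Finset.prod_const,
      ← Finset.prod_mul_distrib]
    refine Finset.prod_congr rfl fun π _ => ?_
    have h : ∀ q, crossNum (fun i l => a (π i) * r (π i) l) q =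
        (∏ i, a i) ^ (2 * (2 * g + 2 - 1)) * crossNum (fun i => r (π i)) q := by
      intro q
      rw [crossNum_scale (fun i => a (π i)) (fun i => r (π i)), Equiv.prod_comp π a]
    rw [bracketProd_scale]
    simp only [h, mul_sub, Finset.mul_sum]
    congr 1
    · ring
    · exact Finset.sum_congr rfl fun q _ => by ring
  obtain ⟨P, hP⟩ := exists_poly_of_symmetric _ _ hsym hhom
  refine ⟨P, MvPolynomial.funext fun x => ?_⟩
  have h := eval_rootForm_eq P (fun i l => x (i, l))
  rw [hP] at h
  exact h

/-- One polynomial over `k` serves all extensions `K`: the same function can be evaluated at the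
points of `H_g` and at the generic normal form over an algebraic closure. The power of `discSign`
converts powers of `bracketProd` into powers of the discriminant. -/
theorem exists_poly_prod_crossSum {k : Type u} [Field k] [IsAlgClosed k] {g : ℕ}
    (u : (Fin 4 ↪ Fin (2 * g + 2)) → k) (T : k) :
    ∃ P : MvPolynomial (Fin (2 * g + 3)) k, ∀ {K : Type u} [Field K] [Algebra k K]
      (r : Fin (2 * g + 2) → Fin 2 → K), bracketProd r ≠ 0 →
      MvPolynomial.aeval (rootForm r) P =
        MvPolynomial.aeval (rootForm r) (disc g k) ^ Fintype.card (Equiv.Perm (Fin (2 * g + 2))) *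
        ∏ π : Equiv.Perm (Fin (2 * g + 2)), (algebraMap k K T - crossSum u (fun i => r (π i))) := by
  obtain ⟨P, hP⟩ := exists_poly_invPoly u T
  refine ⟨MvPolynomial.C (discSign g k ^ Fintype.card (Equiv.Perm (Fin (2 * g + 2)))) * P, ?_⟩
  intro K _ _ r hr
  have h := congrArg (MvPolynomial.aeval (R := k) (fun p : Fin (2 * g + 2) × Fin 2 => r p.1 p.2)) hP
  rw [invPoly_map, MvPolynomial.comp_aeval_apply] at h
  have h1 : ∀ j, MvPolynomial.aeval (R := k) (fun p : Fin (2 * g + 2) × Fin 2 => r p.1 p.2)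
      (rootForm (genericRoots k (2 * g + 2)) j) = rootForm r j := by
    intro j
    have := map_rootForm
      (MvPolynomial.aeval (R := k) (fun p : Fin (2 * g + 2) × Fin 2 => r p.1 p.2)).toRingHom
      (genericRoots k (2 * g + 2)) j
    simpa [genericRoots] using this
  simp only [h1] at h
  simp only [genericRoots, MvPolynomial.aeval_X] at h
  rw [map_mul, h, invPoly_eq u T r hr, aeval_disc_rootForm, mul_pow, mul_assoc]
  congr 1
  simp [discSign]

theorem crossSum_substRoots {k : Type*} [Field k] {n : ℕ} (u : (Fin 4 ↪ Fin n) → k)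
    (M : GL (Fin 2) k) (r : Fin n → Fin 2 → k) :
    crossSum u (substRoots M r) = crossSum u r := by
  simp only [crossSum, crossRatio_substRoots]

/-- The product of `T - crossSum u` over all the orderings of the roots is a regular function on
the moduli space. -/
theorem exists_coordRing_prod_crossSum {k : Type u} [Field k] [IsAlgClosed k] {g : ℕ}
    (u : (Fin 4 ↪ Fin (2 * g + 2)) → k) (T : k) :
    ∃ (F : coordRing g k) (P : MvPolynomial (Fin (2 * g + 3)) k) (m : ℕ),
      (∀ f : Form g k, F.1 (Moduli.mk f) * MvPolynomial.eval f.1 (disc g k) ^ m =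
        MvPolynomial.eval f.1 P) ∧
      ∀ {K : Type u} [Field K] [Algebra k K] (r : Fin (2 * g + 2) → Fin 2 → K),
        bracketProd r ≠ 0 → MvPolynomial.aeval (rootForm r) P =
        MvPolynomial.aeval (rootForm r) (disc g k) ^ m *
        ∏ π : Equiv.Perm (Fin (2 * g + 2)), (algebraMap k K T - crossSum u (fun i => r (π i))) := by
  obtain ⟨P, hP⟩ := exists_poly_prod_crossSum u T
  set m := Fintype.card (Equiv.Perm (Fin (2 * g + 2)))
  have hval : ∀ (r : Fin (2 * g + 2) → Fin 2 → k),
      MvPolynomial.eval (rootForm r) (disc g k) ≠ 0 →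
      MvPolynomial.eval (rootForm r) P / MvPolynomial.eval (rootForm r) (disc g k) ^ m =
        ∏ π : Equiv.Perm (Fin (2 * g + 2)), (T - crossSum u (fun i => r (π i))) := by
    intro r hr
    have hb : bracketProd r ≠ 0 := by
      rw [eval_disc_rootForm] at hr
      exact right_ne_zero_of_mul hr
    rw [div_eq_iff (pow_ne_zero _ hr)]
    exact (hP r hb).trans (mul_comm _ _)
  let F : Moduli g k → k := Quot.lift
    (fun f => MvPolynomial.eval f.1 P / MvPolynomial.eval f.1 (disc g k) ^ m) (by
      rintro ⟨c, hc⟩ ⟨c', hc'⟩ ⟨M, hM⟩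
      obtain ⟨r, rfl⟩ := exists_rootForm c
      simp only [subst_toPoly_rootForm] at hM
      obtain rfl := toPoly_injective hM
      simp only
      rw [hval r hc, hval _ hc']
      exact Finset.prod_congr rfl fun π _ =>
        congrArg (T - ·) (crossSum_substRoots u M fun i => r (π i)).symm)
  have hF : ∀ f : Form g k, F (Moduli.mk f) * MvPolynomial.eval f.1 (disc g k) ^ m =
      MvPolynomial.eval f.1 P := fun f => div_mul_cancel₀ _ (pow_ne_zero _ f.2)
  exact ⟨⟨F, P, m, hF⟩, P, m, hF, hP⟩


/-! ### Forms with nonzero discriminant -/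

theorem bracketProd_ne_zero_of_disc {k : Type*} [Field k] {g : ℕ}
    (r : Fin (2 * g + 2) → Fin 2 → k) (h : MvPolynomial.eval (rootForm r) (disc g k) ≠ 0) :
    bracketProd r ≠ 0 := by
  rw [eval_disc_rootForm] at h
  exact right_ne_zero_of_mul h

theorem isCoprime_linear {k : Type*} [Field k] {n : ℕ} (r : Fin n → Fin 2 → k) (i j : Fin n)
    (h : bracket r i j ≠ 0) :
    IsCoprime (Polynomial.C (r i 1) * Polynomial.X - Polynomial.C (r i 0))
      (Polynomial.C (r j 1) * Polynomial.X - Polynomial.C (r j 0)) := by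
  refine ⟨-Polynomial.C ((bracket r i j)⁻¹ * r j 1), Polynomial.C ((bracket r i j)⁻¹ * r i 1), ?_⟩
  have h1 : Polynomial.C ((bracket r i j)⁻¹) * Polynomial.C (bracket r i j) = 1 := by
    rw [← Polynomial.C_mul, inv_mul_cancel₀ h, Polynomial.C_1]
  rw [← h1]
  simp only [bracket, map_sub, map_mul]
  ring

theorem squarefree_linear {k : Type*} [Field k] {a b : k} (h : a ≠ 0 ∨ b ≠ 0) :
    Squarefree (Polynomial.C a * Polynomial.X - Polynomial.C b) := by
  apply Polynomial.Separable.squarefree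
  rcases eq_or_ne a 0 with rfl | ha
  · have hb : b ≠ 0 := by simpa using h
    refine ⟨Polynomial.C (-b⁻¹), 0, ?_⟩
    simp only [map_zero, zero_mul, zero_sub, add_zero]
    rw [← Polynomial.C_neg, ← Polynomial.C_mul]
    simp [hb]
  · refine ⟨0, Polynomial.C a⁻¹, ?_⟩
    simp [← Polynomial.C_mul, ha]

theorem squarefree_rootPoly {k : Type*} [Field k] {n : ℕ} (hn : 2 ≤ n) (r : Fin n → Fin 2 → k)
    (h : bracketProd r ≠ 0) : Squarefree (rootPoly r) := by
  rw [bracketProd_ne_zero_iff] at h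
  refine Finset.squarefree_prod_of_pairwise_isCoprime
    (fun i _ j _ hij => (isCoprime_linear r i j (h i j hij)).isRelPrime) fun i _ => squarefree_linear ?_
  by_contra! hc
  have : Nontrivial (Fin n) := Fin.nontrivial_iff_two_le.2 hn
  obtain ⟨j, hj⟩ := exists_ne i
  apply h i j hj.symm
  simp [bracket, hc.1, hc.2]

/-- The bracket of two vectors with `z = 0` vanishes, so at most one root lies at infinity. -/
theorem le_natDegree_rootPoly {k : Type*} [Field k] {n : ℕ} (hn : 2 ≤ n) (r : Fin n → Fin 2 → k)
    (h : bracketProd r ≠ 0) : n - 1 ≤ (rootPoly r).natDegree := by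
  classical
  have hsq := squarefree_rootPoly hn r h
  have h0 := hsq.ne_zero
  rw [rootPoly, Finset.prod_ne_zero_iff] at h0
  rw [bracketProd_ne_zero_iff] at h
  rw [rootPoly, Polynomial.natDegree_prod _ _ h0]
  have hdeg : ∀ i, (Polynomial.C (r i 1) * Polynomial.X - Polynomial.C (r i 0)).natDegree =
      if r i 1 = 0 then 0 else 1 := by
    intro i
    split_ifs with hi
    · simp [hi]
    · rw [Polynomial.natDegree_sub_C, Polynomial.natDegree_C_mul_X _ hi]
  simp only [hdeg, Finset.sum_ite, Finset.sum_const, smul_eq_mul, mul_one]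
  have hcard : (Finset.univ.filter fun i => r i 1 = 0).card ≤ 1 := by
    rw [Finset.card_le_one]
    intro i hi j hj
    simp only [Finset.mem_filter, Finset.mem_univ, true_and] at hi hj
    by_contra hij
    apply h i j hij
    simp [bracket, hi, hj]
  have htot := Finset.card_filter_add_card_filter_not (s := (Finset.univ : Finset (Fin n)))
    (fun i => r i 1 = 0)
  simp only [Finset.card_univ, Fintype.card_fin] at htot
  omega

theorem squarefree_affinePoly {k : Type*} [Field k] [IsAlgClosed k] {g : ℕ}
    (c : Fin (2 * g + 3) → k) (hc : MvPolynomial.eval c (disc g k) ≠ 0) :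
    Squarefree (affinePoly c) := by
  obtain ⟨r, rfl⟩ := exists_rootForm c
  rw [affinePoly_rootForm]
  exact squarefree_rootPoly (by omega) r (bracketProd_ne_zero_of_disc r hc)

theorem le_natDegree_affinePoly {k : Type*} [Field k] [IsAlgClosed k] {g : ℕ}
    (c : Fin (2 * g + 3) → k) (hc : MvPolynomial.eval c (disc g k) ≠ 0) :
    2 * g + 1 ≤ (affinePoly c).natDegree := by
  obtain ⟨r, rfl⟩ := exists_rootForm c
  rw [affinePoly_rootForm]
  exact le_natDegree_rootPoly (by omega) r (bracketProd_ne_zero_of_disc r hc)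

/-- From `N² p = W D²` with `N` and `D` coprime, `D²` divides the squarefree `p`; hence the
denominator is trivial. -/
theorem exists_eq_algebraMap_of_sq_mul_aux {k K : Type*} [Field k] [Field K]
    (φ : Polynomial k →+* K) (hφ : Function.Injective φ) {p W N D : Polynomial k}
    (hp : Squarefree p) (w : K) (hcop : IsCoprime N D) (hD : D.Monic) (hw : w * φ D = φ N)
    (h : w ^ 2 * φ p = φ W) : w = φ N ∧ N ^ 2 * p = W := by
  have h1 : N ^ 2 * p = W * D ^ 2 := by
    apply hφ
    simp only [map_mul, map_pow]
    rw [← h, ← hw]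
    ring
  have hcop2 : IsCoprime (D ^ 2) (N ^ 2) := hcop.symm.pow
  have h2 : D ^ 2 ∣ p := hcop2.dvd_of_dvd_mul_left ⟨W, by rw [h1, mul_comm]⟩
  have hu : IsUnit D := hp _ (by rwa [← sq])
  obtain rfl : D = 1 := hD.eq_one_of_isUnit hu
  exact ⟨by simpa using hw, by simpa using h1⟩

/-- A rational function whose square times a squarefree polynomial is a polynomial is itself a
polynomial. -/
theorem exists_eq_algebraMap_of_sq_mul {k : Type*} [Field k] {p W : Polynomial k}
    (hp : Squarefree p) (w : RatFunc k)
    (h : w ^ 2 * algebraMap (Polynomial k) (RatFunc k) p = algebraMap _ _ W) :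
    ∃ w' : Polynomial k, w = algebraMap _ _ w' ∧ w' ^ 2 * p = W := by
  have hd : algebraMap (Polynomial k) (RatFunc k) w.denom ≠ 0 :=
    (map_ne_zero_iff _ (RatFunc.algebraMap_injective k)).2 w.denom_ne_zero
  have h2 : w * algebraMap (Polynomial k) (RatFunc k) w.denom = algebraMap _ _ w.num := by
    rw [← eq_div_iff hd, RatFunc.num_div_denom]
  exact ⟨w.num, exists_eq_algebraMap_of_sq_mul_aux _ (RatFunc.algebraMap_injective k) hp w
    (RatFunc.isCoprime_num_denom w) w.monic_denom h2 h⟩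

/-! ### Diagonal substitutions and even forms -/

theorem subst_toPoly {k : Type*} [CommRing k] {g : ℕ} (M : GL (Fin 2) k)
    (c : Fin (2 * g + 3) → k) :
    subst M (toPoly c) = ∑ i : Fin (2 * g + 3), MvPolynomial.C (c i) *
      (MvPolynomial.C (M 0 0) * MvPolynomial.X 0 + MvPolynomial.C (M 0 1) * MvPolynomial.X 1)
        ^ (i : ℕ) *
      (MvPolynomial.C (M 1 0) * MvPolynomial.X 0 + MvPolynomial.C (M 1 1) * MvPolynomial.X 1)
        ^ (2 * g + 2 - (i : ℕ)) := by
  simp [subst, toPoly, Fin.sum_univ_two]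

theorem subst_diagonal {k : Type*} [CommRing k] {g : ℕ} (M : GL (Fin 2) k) (h01 : M 0 1 = 0)
    (h10 : M 1 0 = 0) (c : Fin (2 * g + 3) → k) :
    subst M (toPoly c) =
      toPoly (fun j => M 0 0 ^ (j : ℕ) * M 1 1 ^ (2 * g + 2 - (j : ℕ)) * c j) := by
  rw [subst_toPoly, toPoly, h01, h10]
  refine Finset.sum_congr rfl fun i _ => ?_
  simp only [map_zero, zero_mul, add_zero, zero_add, mul_pow, map_mul, map_pow]
  ring

theorem subst_antidiagonal {k : Type*} [CommRing k] {g : ℕ} (M : GL (Fin 2) k) (h00 : M 0 0 = 0)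
    (h11 : M 1 1 = 0) (c : Fin (2 * g + 3) → k) :
    subst M (toPoly c) =
      toPoly (fun j => M 0 1 ^ (2 * g + 2 - (j : ℕ)) * M 1 0 ^ (j : ℕ) * c j.rev) := by
  rw [subst_toPoly, toPoly, h00, h11, ← Equiv.sum_comp Fin.revPerm]
  refine Finset.sum_congr rfl fun i _ => ?_
  have h1 : 2 * g + 2 - (2 * g + 2 - (i : ℕ)) = i := by omega
  have h2 : (i.rev : ℕ) = 2 * g + 2 - i := by rw [Fin.val_rev]; omega
  simp only [Fin.revPerm_apply, h2, h1, map_zero, zero_mul, add_zero, zero_add, mul_pow, map_mul,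
    map_pow]
  ring

theorem normalForm_odd {R : Type*} [CommRing R] {g : ℕ} (a : Fin g → R) (j : Fin (2 * g + 3))
    (hj : (j : ℕ) % 2 = 1) : normalForm a j = 0 := by
  rw [normalForm, dif_neg (by omega), if_neg (by omega)]

theorem normalForm_zero {R : Type*} [CommRing R] {g : ℕ} (a : Fin g → R) :
    normalForm a 0 = 1 := by
  rw [normalForm, dif_neg (by simp), if_pos (by simp)]

theorem normalForm_last {R : Type*} [CommRing R] {g : ℕ} (a : Fin g → R) :
    normalForm a (Fin.last _) = 1 := by
  rw [normalForm, dif_neg (by simp), if_pos (by simp)]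

theorem normalForm_middle {R : Type*} [CommRing R] {g : ℕ} (a : Fin g → R) (i : Fin g) :
    normalForm a ⟨2 * (i + 1), by omega⟩ = a i := by
  rw [normalForm, dif_pos ⟨by simp, by simp, by simp; omega⟩]
  congr 1
  ext
  simp

/-- Every index is odd, zero, the last one, or twice a positive number. -/
theorem index_cases {g : ℕ} (j : Fin (2 * g + 3)) :
    (j : ℕ) % 2 = 1 ∨ j = 0 ∨ j = Fin.last _ ∨ ∃ i : Fin g, j = ⟨2 * (i + 1), by omega⟩ := by
  rcases Nat.mod_two_eq_zero_or_one j with h | h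
  · right
    by_cases h0 : (j : ℕ) = 0
    · exact Or.inl (Fin.ext h0)
    by_cases h1 : (j : ℕ) = 2 * g + 2
    · exact Or.inr (Or.inl (Fin.ext h1))
    · refine Or.inr (Or.inr ⟨⟨j / 2 - 1, by omega⟩, Fin.ext ?_⟩)
      simp only
      omega
  · exact Or.inl h

theorem eq_normalForm {R : Type*} [CommRing R] {g : ℕ} (c : Fin (2 * g + 3) → R)
    (hodd : ∀ j : Fin (2 * g + 3), (j : ℕ) % 2 = 1 → c j = 0) (h0 : c 0 = 1)
    (hl : c (Fin.last _) = 1) :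
    c = normalForm (fun i : Fin g => c ⟨2 * (i + 1), by omega⟩) := by
  funext j
  rcases index_cases j with h | rfl | rfl | ⟨i, rfl⟩
  · rw [hodd j h, normalForm_odd _ j h]
  · rw [h0, normalForm_zero]
  · rw [hl, normalForm_last]
  · rw [normalForm_middle]

theorem normalForm_map {R S : Type*} [CommRing R] [CommRing S] (φ : R →+* S) {g : ℕ}
    (a : Fin g → R) (j : Fin (2 * g + 3)) :
    φ (normalForm a j) = normalForm (fun i => φ (a i)) j := by
  rcases index_cases j with h | rfl | rfl | ⟨i, rfl⟩
  · rw [normalForm_odd _ j h, normalForm_odd _ j h, map_zero]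
  · rw [normalForm_zero, normalForm_zero, map_one]
  · rw [normalForm_last, normalForm_last, map_one]
  · rw [normalForm_middle, normalForm_middle]

/-- An even form with nonzero discriminant is equivalent to a normal form. -/
theorem exists_equivalent_normalForm_of_even {k : Type*} [Field k] [IsAlgClosed k] {g : ℕ}
    (f : Form g k) (hodd : ∀ j : Fin (2 * g + 3), (j : ℕ) % 2 = 1 → f.1 j = 0) :
    ∃ (a : Fin g → k) (ha : MvPolynomial.eval (normalForm a) (disc g k) ≠ 0),
      Equivalent f ⟨normalForm a, ha⟩ := by
  obtain ⟨c, hc⟩ := f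
  simp only at hodd
  have hsq := squarefree_affinePoly c hc
  have hdeg := le_natDegree_affinePoly c hc
  -- The degree is at least `2g+1`, and the coefficient at the odd exponent `2g+1` is zero.
  have hlast : c (Fin.last _) ≠ 0 := by
    intro h
    have h1 : (affinePoly c).coeff (affinePoly c).natDegree ≠ 0 := by
      rw [Polynomial.coeff_natDegree, Polynomial.leadingCoeff_ne_zero]
      exact hsq.ne_zero
    rcases (natDegree_affinePoly_le c).lt_or_eq with h2 | h2
    · have h3 : (affinePoly c).natDegree = 2 * g + 1 := by omega
      rw [h3] at h1
      apply h1
      exact (coeff_affinePoly c ⟨2 * g + 1, by omega⟩).trans (hodd _ (by simp only; omega))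
    · rw [h2] at h1
      exact h1 ((coeff_affinePoly c (Fin.last _)).trans h)
  -- The coefficient of `X` is zero too, so a vanishing constant term would give the square factor
  -- `X²`.
  have hzero : c 0 ≠ 0 := by
    intro h
    have hdvd : Polynomial.X ^ 2 ∣ affinePoly c := by
      rw [Polynomial.X_pow_dvd_iff]
      intro d hd
      interval_cases d
      · exact (coeff_affinePoly c 0).trans h
      · exact (coeff_affinePoly c ⟨1, by omega⟩).trans (hodd _ (by simp))
    rw [sq] at hdvd
    exact Polynomial.not_isUnit_X (hsq _ hdvd)
  -- Under `diag(α, δ)` the coefficient `c j` is multiplied by `α^j δ^(2g+2-j)`; the two roots are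
  -- chosen to make the extreme coefficients equal to 1.
  obtain ⟨α, hα⟩ := IsAlgClosed.exists_pow_nat_eq (c (Fin.last _))⁻¹ (n := 2 * g + 2) (by omega)
  obtain ⟨δ, hδ⟩ := IsAlgClosed.exists_pow_nat_eq (c 0)⁻¹ (n := 2 * g + 2) (by omega)
  have hα0 : α ≠ 0 := by
    rintro rfl
    rw [zero_pow (by omega)] at hα
    exact inv_ne_zero hlast hα.symm
  have hδ0 : δ ≠ 0 := by
    rintro rfl
    rw [zero_pow (by omega)] at hδ
    exact inv_ne_zero hzero hδ.symm
  let M : GL (Fin 2) k := Matrix.GeneralLinearGroup.mkOfDetNeZero !![α, 0; 0, δ]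
    (by simp [hα0, hδ0])
  have hM := subst_diagonal M (by simp [M, Matrix.GeneralLinearGroup.mkOfDetNeZero])
    (by simp [M, Matrix.GeneralLinearGroup.mkOfDetNeZero]) c
  have hM00 : M 0 0 = α := by simp [M, Matrix.GeneralLinearGroup.mkOfDetNeZero]
  have hM11 : M 1 1 = δ := by simp [M, Matrix.GeneralLinearGroup.mkOfDetNeZero]
  rw [hM00, hM11] at hM
  obtain ⟨c', hc', hd'⟩ := exists_subst_eq M c hc
  rw [hM] at hc'
  have hcc := toPoly_injective hc'
  have hnf := eq_normalForm c' (fun j hj => by rw [hcc]; simp only; rw [hodd j hj, mul_zero])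
    (by rw [hcc]; simp [hδ, hzero]) (by rw [hcc]; simp [hα, hlast])
  rw [hnf] at hd'
  refine ⟨_, hd', M, ?_⟩
  simp only
  rw [hM, ← hcc, ← hnf]


/-! ### Involutions of a quadratic extension of `k(X)` -/

/-- `L` is the free `k(X)`-module on `1` and `y`, with `y ^ 2 = p`. -/
structure IsQuadraticExt {k L : Type*} [Field k] [CommRing L] [Algebra k L] (p : Polynomial k)
    (ι : RatFunc k →+* L) (y : L) : Prop where
  algebraMap_eq : ∀ a : k, ι (algebraMap (Polynomial k) (RatFunc k) (Polynomial.C a)) =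
    algebraMap k L a
  sq_eq : y ^ 2 = ι (algebraMap (Polynomial k) (RatFunc k) p)
  exists_eq : ∀ l : L, ∃ a b : RatFunc k, l = ι a + ι b * y
  eq_zero : ∀ a b : RatFunc k, ι a + ι b * y = 0 → a = 0 ∧ b = 0

namespace IsQuadraticExt

open Polynomial

variable {k L : Type*} [Field k] [CommRing L] [Algebra k L] {p : Polynomial k}
  {ι : RatFunc k →+* L} {y : L}

theorem injective (h : IsQuadraticExt p ι y) : Function.Injective ι := by
  rw [injective_iff_map_eq_zero]
  intro a ha
  exact (h.eq_zero a 0 (by simp [ha])).1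

theorem map_algebraMap (h : IsQuadraticExt p ι y) (f : k[X]) :
    ι (algebraMap k[X] (RatFunc k) f) = aeval (ι (algebraMap k[X] (RatFunc k) X)) f := by
  induction f using Polynomial.induction_on' with
  | add f₁ f₂ h₁ h₂ => simp only [map_add, h₁, h₂]
  | monomial n a =>
    rw [← C_mul_X_pow_eq_monomial]
    simp only [map_mul, map_pow, aeval_C, aeval_X, h.algebraMap_eq]

theorem map_alg (h : IsQuadraticExt p ι y) (z : L →ₐ[k] L) (f : k[X]) :
    z (ι (algebraMap k[X] (RatFunc k) f)) = aeval (z (ι (algebraMap k[X] (RatFunc k) X))) f := by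
  rw [h.map_algebraMap]
  exact (aeval_algHom_apply z _ f).symm

theorem aeval_map_ratFunc (h : IsQuadraticExt p ι y) (a : RatFunc k) (f : k[X]) :
    aeval (ι a) f = ι (aeval a f) := by
  induction f using Polynomial.induction_on' with
  | add f₁ f₂ h₁ h₂ => simp only [map_add, h₁, h₂]
  | monomial n c =>
    rw [← C_mul_X_pow_eq_monomial]
    simp only [map_mul, map_pow, aeval_C, aeval_X, ← h.algebraMap_eq]
    rfl

theorem natDegree_coeff_le_swap (G : k[X][X]) (i : ℕ) :
    (G.coeff i).natDegree ≤ (Bivariate.swap G).natDegree := by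
  have key : ∀ (G : k[X][X]) (i j : ℕ), ((Bivariate.swap G).coeff j).coeff i =
      (G.coeff i).coeff j := by
    intro G i j
    induction G using Polynomial.induction_on' with
    | add f₁ f₂ h₁ h₂ => simp only [map_add, coeff_add, h₁, h₂]
    | monomial n a =>
      rw [Bivariate.swap_monomial]
      simp only [coeff_mul_C, coeff_map, coeff_monomial, coeff_C_mul, coeff_X_pow]
      by_cases h : i = n
      · simp [h]
      · simp [h, Ne.symm h]
  rw [natDegree_le_iff_coeff_eq_zero]
  intro j hj
  rw [← key, coeff_eq_zero_of_natDegree_lt hj, coeff_zero]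

/-- The minimal relation between `X` and its image under an involution has the same degree in both
variables. -/
theorem exists_bidegree (h : IsQuadraticExt p ι y) (z : L →ₐ[k] L) (hz : ∀ l, z (z l) = l)
    (m : (RatFunc k)[X]) (hm : m.Monic)
    (hm0 : eval₂ ι (z (ι (algebraMap k[X] (RatFunc k) X))) m = 0)
    (hdvd : ∀ q : (RatFunc k)[X], eval₂ ι (z (ι (algebraMap k[X] (RatFunc k) X))) q = 0 → m ∣ q) :
    ∃ (G : k[X][X]) (c : RatFunc k), c ≠ 0 ∧ G.map (algebraMap k[X] (RatFunc k)) = C c * m ∧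
      ∀ i, (G.coeff i).natDegree ≤ m.natDegree := by
  classical
  let : NormalizedGCDMonoid k[X] := UniqueFactorizationMonoid.toNormalizedGCDMonoid _
  set x := ι (algebraMap k[X] (RatFunc k) X) with hx
  set v := z x with hv
  obtain ⟨⟨b, hb⟩, hG0⟩ : ∃ b : nonZeroDivisors k[X],
      (IsLocalization.integerNormalization (nonZeroDivisors k[X]) m).map
        (algebraMap k[X] (RatFunc k)) = b.1 • m := by
    obtain ⟨b, hb, h⟩ := IsLocalization.integerNormalization_spec (nonZeroDivisors k[X]) m
    exact ⟨⟨b, hb⟩, h⟩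
  set G₀ := IsLocalization.integerNormalization (nonZeroDivisors k[X]) m
  have hinj := RatFunc.algebraMap_injective k
  have hb0 : algebraMap k[X] (RatFunc k) b ≠ 0 :=
    (map_ne_zero_iff _ hinj).2 (nonZeroDivisors.ne_zero hb)
  have hG0' : G₀.map (algebraMap k[X] (RatFunc k)) = C (algebraMap k[X] (RatFunc k) b) * m := by
    rw [hG0, Algebra.smul_def]
    rfl
  have hG00 : G₀ ≠ 0 := by
    intro h0
    rw [h0, Polynomial.map_zero] at hG0'
    exact mul_ne_zero (C_ne_zero.2 hb0) hm.ne_zero hG0'.symm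
  have hcont : algebraMap k[X] (RatFunc k) G₀.content ≠ 0 := by
    rw [map_ne_zero_iff _ hinj]
    simpa [content_eq_zero_iff] using hG00
  set G := G₀.primPart with hG
  have hGm : G.map (algebraMap k[X] (RatFunc k)) =
      C ((algebraMap k[X] (RatFunc k) G₀.content)⁻¹ * algebraMap k[X] (RatFunc k) b) * m := by
    rw [C_mul, mul_assoc, ← hG0', G₀.eq_C_content_mul_primPart, Polynomial.map_mul, map_C,
      ← mul_assoc, ← C_mul]
    rw [← G₀.eq_C_content_mul_primPart, inv_mul_cancel₀ hcont, C_1, one_mul]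
  have hc : (algebraMap k[X] (RatFunc k) G₀.content)⁻¹ * algebraMap k[X] (RatFunc k) b ≠ 0 :=
    mul_ne_zero (inv_ne_zero hcont) hb0
  have hev : ∀ (H : k[X][X]) (w : L), eval₂ ι w (H.map (algebraMap k[X] (RatFunc k))) =
      aevalAeval x w H := by
    intro H w
    induction H using Polynomial.induction_on' with
    | add f₁ f₂ h₁ h₂ => simp only [Polynomial.map_add, eval₂_add, map_add, h₁, h₂]
    | monomial n a =>
      rw [← C_mul_X_pow_eq_monomial]
      rw [Polynomial.map_mul, Polynomial.map_pow, map_C, map_X, eval₂_mul, eval₂_C, eval₂_pow,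
        eval₂_X, map_mul, map_pow, aevalAeval_C, aevalAeval_Y, h.map_algebraMap]
  have hGv : aevalAeval x v G = 0 := by
    rw [← hev, hGm, eval₂_mul, hm0, mul_zero]
  have hzz : ∀ (H : k[X][X]), z (aevalAeval x v H) = aevalAeval v x H := by
    intro H
    induction H using Polynomial.induction_on' with
    | add f₁ f₂ h₁ h₂ => rw [map_add, map_add, map_add, h₁, h₂]
    | monomial n a =>
      have hzv : z v = x := hz x
      rw [← C_mul_X_pow_eq_monomial, map_mul, map_mul (aevalAeval v x), map_pow,
        map_pow (aevalAeval v x), aevalAeval_C, aevalAeval_C, aevalAeval_Y, aevalAeval_Y, map_mul,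
        map_pow, hzv, ← aeval_algHom_apply]
  -- The involution exchanges `x` and `v`, so it turns `G(x, v) = 0` into `G(v, x) = 0`.
  have hsw : aevalAeval x v (Bivariate.swap G) = 0 := by
    rw [Bivariate.aevalAeval_swap, ← hzz, hGv, map_zero]
  -- Gauss's lemma: `G` is primitive, so divisibility over `k(X)` descends to `k[X]`. Swapping the
  -- variables back then bounds the degree in `X` by the degree in `Y`.
  have hdiv : G ∣ Bivariate.swap G := by
    apply (isPrimitive_primPart G₀).dvd_of_fraction_map_dvd_fraction_map (K := RatFunc k)
    rw [← hG, hGm]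
    rw [← hev] at hsw
    exact (IsUnit.mul_left_dvd ((isUnit_C).2 (IsUnit.mk0 _ hc))).2 (hdvd _ hsw)
  have hG1 : G ≠ 0 := primPart_ne_zero _
  have hdeg : (Bivariate.swap G).natDegree ≤ G.natDegree := by
    obtain ⟨H, hH⟩ := hdiv
    have h1 : G = Bivariate.swap G * Bivariate.swap H := by
      rw [← map_mul, ← hH, Bivariate.swap_swap_apply]
    apply natDegree_le_of_dvd ⟨_, h1⟩ hG1
  have hdG : G.natDegree = m.natDegree := by
    have := congrArg natDegree hGm
    rwa [natDegree_map_eq_of_injective hinj, natDegree_C_mul hc] at this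
  exact ⟨G, _, hc, hGm, fun i => (natDegree_coeff_le_swap G i).trans (hdeg.trans hdG.le)⟩

/-- An involution maps `X` into `k(X)`. -/
theorem exists_ratFunc (h : IsQuadraticExt p ι y) (h2 : (2 : k) ≠ 0) (hp : Squarefree p)
    (hdeg : 5 ≤ p.natDegree) (z : L →ₐ[k] L) (hz : ∀ l, z (z l) = l) :
    ∃ a : RatFunc k, z (ι (algebraMap k[X] (RatFunc k) X)) = ι a := by
  obtain ⟨a, b, hab⟩ := h.exists_eq (z (ι (algebraMap k[X] (RatFunc k) X)))
  by_cases hb : b = 0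
  · exact ⟨a, by rw [hab, hb]; simp⟩
  -- If `b ≠ 0`, the image of `X` has the minimal polynomial `m` of degree 2, with discriminant `4
  -- b² p`. The cleared relation `G` has degree at most 2 in each variable, so its discriminant in
  -- `Y` has degree at most 4. But this discriminant is a nonzero square times `p`, and the square
  -- root is a polynomial because `p` is squarefree, so the degree is at least 5.
  exfalso
  set P := algebraMap k[X] (RatFunc k) p with hP
  obtain ⟨e₁, he₁⟩ : ∃ e, e = -(2 * a) := ⟨_, rfl⟩
  obtain ⟨e₀, he₀⟩ : ∃ e, e = a ^ 2 - b ^ 2 * P := ⟨_, rfl⟩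
  set m : (RatFunc k)[X] := X ^ 2 + C e₁ * X + C e₀ with hm
  have hmonic : m.Monic := by
    rw [hm]
    monicity!
  have hmdeg : m.natDegree = 2 := by
    rw [hm]
    compute_degree!
  have hm0 : eval₂ ι (z (ι (algebraMap k[X] (RatFunc k) X))) m = 0 := by
    rw [hab, hm]
    simp only [eval₂_add, eval₂_mul, eval₂_pow, eval₂_X, eval₂_C]
    simp only [he₁, he₀, map_neg, map_sub, map_mul, map_pow, map_ofNat]
    rw [← h.sq_eq]
    ring
  have hdvd : ∀ q : (RatFunc k)[X],
      eval₂ ι (z (ι (algebraMap k[X] (RatFunc k) X))) q = 0 → m ∣ q := by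
    intro q hq
    rw [← modByMonic_eq_zero_iff_dvd hmonic]
    have h1 := modByMonic_add_div q m
    have hr : (q %ₘ m).natDegree ≤ 1 := by
      have := natDegree_modByMonic_lt q hmonic (by intro h; rw [h] at hmdeg; simp at hmdeg)
      omega
    obtain ⟨r₁, r₀, hr'⟩ := exists_eq_X_add_C_of_natDegree_le_one hr
    rw [← h1, eval₂_add, eval₂_mul, hm0, zero_mul, add_zero, hr', hab] at hq
    simp only [eval₂_add, eval₂_mul, eval₂_X, eval₂_C] at hq
    have h3 := h.eq_zero (r₁ * a + r₀) (r₁ * b) (by rw [← hq]; simp only [map_add, map_mul]; ring)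
    have h4 : r₁ = 0 := (mul_eq_zero.1 h3.2).resolve_right hb
    have h5 : r₀ = 0 := by simpa [h4] using h3.1
    rw [hr', h4, h5]
    simp
  obtain ⟨G, c, hc, hG, hGd⟩ := h.exists_bidegree z hz m hmonic hm0 hdvd
  rw [hmdeg] at hGd
  have hcoef : ∀ i, algebraMap k[X] (RatFunc k) (G.coeff i) = c * m.coeff i := by
    intro i
    rw [← coeff_map, hG, coeff_C_mul]
  have hm2 : m.coeff 2 = 1 := by rw [← hmdeg]; exact hmonic
  have hm1 : m.coeff 1 = -(2 * a) := by
    rw [← he₁]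
    simp [hm, coeff_C]
  have hm00 : m.coeff 0 = a ^ 2 - b ^ 2 * P := by
    rw [← he₀]
    simp [hm]
  have h22 : (2 : RatFunc k) ≠ 0 := by
    rw [← map_ofNat (algebraMap k (RatFunc k)) 2]
    exact (map_ne_zero_iff _ (algebraMap k _).injective).2 h2
  have hW : (2 * c * b) ^ 2 * P =
      algebraMap k[X] (RatFunc k) (G.coeff 1 ^ 2 - 4 * G.coeff 2 * G.coeff 0) := by
    simp only [map_sub, map_mul, map_pow, hcoef, hm2, hm1, hm00, map_ofNat]
    ring
  obtain ⟨w, hw, hw2⟩ := exists_eq_algebraMap_of_sq_mul hp _ hW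
  have hw0 : w ≠ 0 := by
    rintro rfl
    rw [map_zero] at hw
    exact mul_ne_zero (mul_ne_zero h22 hc) hb hw
  have hd1 : (G.coeff 1 ^ 2 - 4 * G.coeff 2 * G.coeff 0).natDegree ≤ 4 := by
    have e0 := hGd 0
    have e1 := hGd 1
    have e2 := hGd 2
    refine (natDegree_sub_le _ _).trans (max_le (natDegree_pow_le_of_le 2 e1) ?_)
    refine (natDegree_mul_le_of_le (natDegree_mul_le_of_le (m := 0) ?_ e2) e0)
    exact (natDegree_ofNat 4).le
  rw [← hw2, natDegree_mul (pow_ne_zero 2 hw0) hp.ne_zero] at hd1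
  omega

/-- An involution which does not fix `X` acts on it as an involutory Möbius transformation. -/
theorem exists_moebius (h : IsQuadraticExt p ι y) (z : L →ₐ[k] L) (hz : ∀ l, z (z l) = l)
    (hne : z (ι (algebraMap k[X] (RatFunc k) X)) ≠ ι (algebraMap k[X] (RatFunc k) X))
    (a : RatFunc k) (ha : z (ι (algebraMap k[X] (RatFunc k) X)) = ι a) :
    ∃ q₁ q₂ q₃ : k, q₁ ^ 2 + q₂ * q₃ ≠ 0 ∧
      algebraMap k[X] (RatFunc k) (C q₃ * X - C q₁) ≠ 0 ∧
      a * algebraMap k[X] (RatFunc k) (C q₃ * X - C q₁) =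
        algebraMap k[X] (RatFunc k) (C q₁ * X + C q₂) := by
  have hinj := RatFunc.algebraMap_injective k
  have hdvd : ∀ q : (RatFunc k)[X],
      eval₂ ι (z (ι (algebraMap k[X] (RatFunc k) X))) q = 0 → (X - C a) ∣ q := by
    intro q hq
    rw [ha, eval₂_hom, map_eq_zero_iff _ h.injective] at hq
    exact dvd_iff_isRoot.2 hq
  obtain ⟨G, c, hc, hG, hGd⟩ := h.exists_bidegree z hz (X - C a) (monic_X_sub_C a)
    (by rw [ha, eval₂_hom]; simp) hdvd
  rw [natDegree_X_sub_C] at hGd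
  have hcoef : ∀ i, algebraMap k[X] (RatFunc k) (G.coeff i) = c * (X - C a).coeff i := by
    intro i
    rw [← coeff_map, hG, coeff_C_mul]
  -- The relation has bidegree at most `(1, 1)`: it reads `(sX + t) Y + (uX + w)`, so the image of
  -- `X` is `-(uX + w) / (sX + t)`.
  obtain ⟨s, t, hD⟩ := exists_eq_X_add_C_of_natDegree_le_one (hGd 1)
  obtain ⟨u, w, hU⟩ := exists_eq_X_add_C_of_natDegree_le_one (hGd 0)
  have h1 := hcoef 1
  have h0 := hcoef 0
  rw [hD] at h1
  rw [hU] at h0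
  simp only [coeff_sub, coeff_X_one, coeff_C_succ, sub_zero, mul_one] at h1
  simp only [coeff_sub, coeff_X_zero, coeff_C_zero, zero_sub, mul_neg] at h0
  have hrel : a * algebraMap k[X] (RatFunc k) (C s * X + C t) =
      algebraMap k[X] (RatFunc k) (C (-u) * X + C (-w)) := by
    rw [h1, mul_comm, ← neg_neg (c * a), ← h0, ← map_neg]
    congr 1
    simp only [map_neg]
    ring
  have hden : algebraMap k[X] (RatFunc k) (C s * X + C t) ≠ 0 := by rwa [h1]
  -- applying the involution once more
  set x := algebraMap k[X] (RatFunc k) X with hx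
  have hAx : ∀ e : k, algebraMap k[X] (RatFunc k) (C e) = algebraMap k (RatFunc k) e :=
    fun e => rfl
  have hrel2 : x * (algebraMap k (RatFunc k) s * a + algebraMap k (RatFunc k) t) =
      algebraMap k (RatFunc k) (-u) * a + algebraMap k (RatFunc k) (-w) := by
    apply h.injective
    have h3 := congrArg (fun l => z (ι l)) hrel
    simp only [map_mul] at h3
    rw [h.map_alg z (C s * X + C t), h.map_alg z (C (-u) * X + C (-w)), ← ha, hz, ha, h.aeval_map_ratFunc, h.aeval_map_ratFunc,
      ← map_mul] at h3
    simpa only [map_add, map_mul, aeval_C, aeval_X] using h3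
  have hpoly : X * (C s * (C (-u) * X + C (-w)) + C t * (C s * X + C t)) =
      C (-u) * (C (-u) * X + C (-w)) + C (-w) * (C s * X + C t) := by
    apply hinj
    have h3 := congrArg (· * algebraMap k[X] (RatFunc k) (C s * X + C t)) hrel2
    simp only [add_mul, mul_assoc, hrel] at h3
    simp only [map_add, map_mul, hAx] at h3 ⊢
    exact h3
  have c2 := congrArg (fun f : k[X] => f.coeff 2) hpoly
  have c1 := congrArg (fun f : k[X] => f.coeff 1) hpoly
  have c0 := congrArg (fun f : k[X] => f.coeff 0) hpoly
  simp [coeff_X, coeff_C] at c0 c1 c2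
  -- The coefficients of the identity `a(a(X)) = X` all carry the trace `t - u` as a factor. Trace
  -- zero is the asserted shape; a nonzero trace forces `s = w = 0` and `t = -u`, so that `X` would
  -- be fixed.
  by_cases htr : t = u
  · refine ⟨-u, -w, s, ?_, ?_, ?_⟩
    -- With determinant zero `a` would be a constant, hence fixed by the involution, and so `X`
    -- would be fixed.
    · intro hdet
      have h3 : algebraMap k[X] (RatFunc k) (C s * (C (-u) * X + C (-w)) + C u * (C s * X + C t)) =
          0 := by
        rw [map_eq_zero_iff _ hinj, htr]
        have h4 : C ((-u) ^ 2 + -w * s) = (0 : k[X]) := by rw [hdet, C_0]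
        simp only [map_add, map_mul, map_neg, map_pow] at h4 ⊢
        linear_combination h4
      rw [map_add, map_mul, ← hrel, map_mul, mul_left_comm, ← mul_assoc, ← add_mul, hAx, hAx] at h3
      have h4 := (mul_eq_zero.1 h3).resolve_right hden
      have hs : s ≠ 0 := by
        rintro rfl
        have hu : u = 0 := by simpa using hdet
        apply hden
        rw [htr, hu]
        simp
      have ha' : a = algebraMap k (RatFunc k) (-u / s) := by
        have : algebraMap k (RatFunc k) s ≠ 0 := (map_ne_zero_iff _ (algebraMap k _).injective).2 hs
        rw [map_div₀, map_neg, eq_div_iff this]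
        linear_combination h4
      apply hne
      have h5 : z (ι a) = ι a := by
        rw [ha', ← hAx, h.algebraMap_eq, AlgHom.commutes]
      rw [← ha, hz] at h5
      exact h5.symm
    · rw [← htr]
      convert hden using 3
      simp
    · rw [← hrel, ← htr]
      congr 2
      simp
  · exfalso
    have hs : s = 0 := by
      have h3 : s * (t - u) = 0 := by linear_combination c2
      exact (mul_eq_zero.1 h3).resolve_right (sub_ne_zero.2 htr)
    have hw : w = 0 := by
      have h3 : w * (t - u) = 0 := by linear_combination c0
      exact (mul_eq_zero.1 h3).resolve_right (sub_ne_zero.2 htr)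
    have ht : t = -u := by
      have h3 : (t + u) * (t - u) = 0 := by linear_combination c1
      exact eq_neg_of_add_eq_zero_left ((mul_eq_zero.1 h3).resolve_right (sub_ne_zero.2 htr))
    apply hne
    rw [ha]
    congr 1
    rw [hs, hw, ht] at hrel
    rw [hs, ht] at hden
    simp only [map_zero, zero_mul, zero_add, neg_zero, add_zero] at hrel hden
    rw [map_mul, mul_comm] at hrel
    exact mul_left_cancel₀ hden hrel

end IsQuadraticExt


namespace IsQuadraticExt

open Polynomial

variable {k L : Type*} [Field k] [CommRing L] [Algebra k L] {p : Polynomial k}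
  {ι : RatFunc k →+* L} {y : L}

/-- An involution which fixes `X` fixes `k(X)`. -/
theorem map_eq_of_fixes_X (h : IsQuadraticExt p ι y) (z : L →ₐ[k] L)
    (hX : z (ι (algebraMap k[X] (RatFunc k) X)) = ι (algebraMap k[X] (RatFunc k) X))
    (w : RatFunc k) : z (ι w) = ι w := by
  have h1 : (z : L →+* L).comp ι = ι := by
    apply IsLocalization.ringHom_ext (nonZeroDivisors k[X])
    exact RingHom.ext fun f => (h.map_alg z f).trans (by rw [hX, ← h.map_algebraMap]; rfl)
  exact congrArg (fun φ : RatFunc k →+* L => φ w) h1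

theorem ne_zero_of_map (h : IsQuadraticExt p ι y) (z : L →ₐ[k] L) (hz : ∀ l, z (z l) = l)
    (a : RatFunc k) (ha : z (ι (algebraMap k[X] (RatFunc k) X)) = ι a) (v : k[X]) (hv : v ≠ 0) :
    aeval a v ≠ 0 := by
  intro h0
  have h1 : z (ι (algebraMap k[X] (RatFunc k) v)) = 0 := by
    rw [h.map_alg, ha, h.aeval_map_ratFunc, h0, map_zero]
  have h2 : ι (algebraMap k[X] (RatFunc k) v) = 0 := by rw [← hz (ι _), h1, map_zero]
  exact hv (by
    rwa [map_eq_zero_iff _ h.injective, map_eq_zero_iff _ (RatFunc.algebraMap_injective k)] at h2)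

/-- An involution which maps `X` into `k(X)` preserves `k(X)`. -/
theorem exists_map_ratFunc (h : IsQuadraticExt p ι y) (z : L →ₐ[k] L) (hz : ∀ l, z (z l) = l)
    (a : RatFunc k) (ha : z (ι (algebraMap k[X] (RatFunc k) X)) = ι a) (w : RatFunc k) :
    ∃ w', z (ι w) = ι w' := by
  obtain ⟨u, v, hv, rfl⟩ := IsFractionRing.div_surjective (A := k[X]) w
  have hv0 : v ≠ 0 := nonZeroDivisors.ne_zero hv
  have hv1 : algebraMap k[X] (RatFunc k) v ≠ 0 :=
    (map_ne_zero_iff _ (RatFunc.algebraMap_injective k)).2 hv0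
  have hv2 := h.ne_zero_of_map z hz a ha v hv0
  refine ⟨aeval a u / aeval a v, ?_⟩
  have h1 : z (ι (algebraMap k[X] (RatFunc k) u / algebraMap k[X] (RatFunc k) v)) *
      ι (aeval a v) = ι (aeval a u) := by
    rw [← h.aeval_map_ratFunc, ← h.aeval_map_ratFunc, ← ha, ← h.map_alg, ← h.map_alg, ← map_mul,
      ← map_mul, div_mul_cancel₀ _ hv1]
  calc _ = z (ι (algebraMap k[X] (RatFunc k) u / algebraMap k[X] (RatFunc k) v)) *
      ι (aeval a v) * ι (aeval a v)⁻¹ := by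
        rw [mul_assoc, ← map_mul, mul_inv_cancel₀ hv2, map_one, mul_one]
    _ = _ := by rw [h1, ← map_mul, div_eq_mul_inv]

/-- The effect of an involution on `y`. -/
theorem exists_map_y (h : IsQuadraticExt p ι y) (h2 : (2 : k) ≠ 0) (z : L →ₐ[k] L)
    (hz : ∀ l, z (z l) = l)
    (a : RatFunc k) (ha : z (ι (algebraMap k[X] (RatFunc k) X)) = ι a) :
    ∃ β β' : RatFunc k, z (ι β) = ι β' ∧ β' * β = 1 ∧
      β ^ 2 * algebraMap k[X] (RatFunc k) p = aeval a p := by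
  obtain ⟨α, β, hαβ⟩ := h.exists_eq (z y)
  obtain ⟨β', hβ'⟩ := h.exists_map_ratFunc z hz a ha β
  obtain ⟨α', hα'⟩ := h.exists_map_ratFunc z hz a ha α
  have hsq : (z y) ^ 2 = ι (aeval a p) := by
    rw [← map_pow, h.sq_eq, h.map_alg, ha, h.aeval_map_ratFunc]
  rw [hαβ] at hsq
  -- The square of `z y = α + β y` lies in `k(X)`, hence `2 α β = 0`. The case `β = 0` is impossible
  -- because it would put `y = z (z y)` into `k(X)`.
  have h3 := h.eq_zero (α ^ 2 + β ^ 2 * algebraMap k[X] (RatFunc k) p - aeval a p) (2 * α * β) (by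
    rw [map_sub, map_add, map_mul, map_pow, map_pow, map_mul, map_mul, map_ofNat, ← hsq,
      ← h.sq_eq]
    ring)
  have h22 : (2 : RatFunc k) ≠ 0 := by
    rw [← map_ofNat (algebraMap k (RatFunc k)) 2]
    exact (map_ne_zero_iff _ (algebraMap k _).injective).2 h2
  have hβ : β ≠ 0 := by
    rintro rfl
    have h4 : y = ι α' := by rw [← hz y, hαβ, map_zero, zero_mul, add_zero, hα']
    have h5 := h.eq_zero (-α') 1 (by rw [h4]; simp)
    exact one_ne_zero h5.2
  have hα : α = 0 := by
    rcases mul_eq_zero.1 h3.2 with h4 | h4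
    · exact (mul_eq_zero.1 h4).resolve_left h22
    · exact absurd h4 hβ
  subst hα
  refine ⟨β, β', hβ', ?_, ?_⟩
  · have h4 : z (z y) = ι β' * (ι β * y) := by
      rw [hαβ, map_zero, zero_add, map_mul, hβ', hαβ, map_zero, zero_add]
    rw [hz] at h4
    have h5 := h.eq_zero 0 (β' * β - 1) (by
      rw [map_sub, map_mul, map_one]
      linear_combination map_zero ι - h4)
    exact sub_eq_zero.1 h5.2
  · have := h3.1
    linear_combination this

end IsQuadraticExt

/-! ### From an involution of the function field to the invariance of the binary form -/

theorem aeval_subst_toPoly {k : Type*} [Field k] {g : ℕ} (M : GL (Fin 2) k)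
    (c : Fin (2 * g + 3) → k) {K : Type*} [Field K] [Algebra k K] (x a : K)
    (h : a * (algebraMap k K (M 1 0) * x + algebraMap k K (M 1 1)) =
      algebraMap k K (M 0 0) * x + algebraMap k K (M 0 1)) :
    MvPolynomial.aeval ![x, 1] (subst M (toPoly c)) =
      (algebraMap k K (M 1 0) * x + algebraMap k K (M 1 1)) ^ (2 * g + 2) *
        Polynomial.aeval a (affinePoly c) := by
  rw [subst_toPoly, affinePoly, map_sum, map_sum, Finset.mul_sum]
  refine Finset.sum_congr rfl fun i _ => ?_
  simp only [map_mul, map_pow, map_add, MvPolynomial.aeval_C, MvPolynomial.aeval_X,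
    Matrix.cons_val_zero, Matrix.cons_val_one, mul_one, Polynomial.aeval_C, Polynomial.aeval_X]
  rw [← h, mul_pow]
  have h1 : 2 * g + 2 = (i : ℕ) + (2 * g + 2 - (i : ℕ)) := by omega
  conv_rhs => rw [h1, pow_add]
  ring

theorem aeval_toPoly {k : Type*} [Field k] {g : ℕ} (c : Fin (2 * g + 3) → k) {K : Type*} [Field K]
    [Algebra k K] (x : K) :
    MvPolynomial.aeval ![x, 1] (toPoly c) = Polynomial.aeval x (affinePoly c) := by
  rw [toPoly, affinePoly, map_sum, map_sum]
  refine Finset.sum_congr rfl fun i _ => ?_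
  simp

/-- The binary form is invariant, up to a known constant, under the involutory Möbius
transformation given by an involution of the function field. -/
theorem IsQuadraticExt.exists_subst_eq_smul {k L : Type*} [Field k] [IsAlgClosed k] [CommRing L]
    [Algebra k L] {g : ℕ} (hg : 2 ≤ g) (h2 : (2 : k) ≠ 0) (c : Fin (2 * g + 3) → k)
    (hc : MvPolynomial.eval c (disc g k) ≠ 0) {ι : RatFunc k →+* L} {y : L}
    (h : IsQuadraticExt (affinePoly c) ι y) (z : L →ₐ[k] L) (hz : ∀ l, z (z l) = l)
    (hne : ∃ w, z (ι w) ≠ ι w) :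
    ∃ (q₁ q₂ q₃ : k) (M : GL (Fin 2) k), q₁ ^ 2 + q₂ * q₃ ≠ 0 ∧
      (M : Matrix (Fin 2) (Fin 2) k) = !![q₁, q₂; q₃, -q₁] ∧
      subst M (toPoly c) = (q₁ ^ 2 + q₂ * q₃) ^ (g + 1) • toPoly c := by
  have hsq := squarefree_affinePoly c hc
  have hdeg := le_natDegree_affinePoly c hc
  obtain ⟨a, ha⟩ := h.exists_ratFunc h2 hsq (by omega) z hz
  have hX : z (ι (algebraMap (Polynomial k) (RatFunc k) Polynomial.X)) ≠
      ι (algebraMap (Polynomial k) (RatFunc k) Polynomial.X) := by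
    intro hX
    obtain ⟨w, hw⟩ := hne
    exact hw (h.map_eq_of_fixes_X z hX w)
  obtain ⟨q₁, q₂, q₃, hμ, hden, hmob⟩ := h.exists_moebius z hz hX a ha
  obtain ⟨β, β', hβ, hββ, hP⟩ := h.exists_map_y h2 z hz a ha
  obtain ⟨M, hM⟩ : ∃ M : GL (Fin 2) k, (M : Matrix (Fin 2) (Fin 2) k) = !![q₁, q₂; q₃, -q₁] :=
    ⟨Matrix.GeneralLinearGroup.mkOfDetNeZero !![q₁, q₂; q₃, -q₁] (by
      rw [Matrix.det_fin_two_of]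
      intro h0
      exact hμ (by linear_combination -h0)), rfl⟩
  refine ⟨q₁, q₂, q₃, M, hμ, hM, ?_⟩
  have h00 : M 0 0 = q₁ := by rw [hM]; simp
  have h01 : M 0 1 = q₂ := by rw [hM]; simp
  have h10 : M 1 0 = q₃ := by rw [hM]; simp
  have h11 : M 1 1 = -q₁ := by rw [hM]; simp
  obtain ⟨x, hx⟩ : ∃ x, x = algebraMap (Polynomial k) (RatFunc k) Polynomial.X := ⟨_, rfl⟩
  have hAx : ∀ e : k, algebraMap (Polynomial k) (RatFunc k) (Polynomial.C e) =
    algebraMap k (RatFunc k) e := fun e => rfl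
  have hAp : ∀ q : Polynomial k, Polynomial.aeval x q = algebraMap _ (RatFunc k) q := by
    intro q
    rw [hx, Polynomial.aeval_algebraMap_apply, Polynomial.aeval_X_left_apply]
  obtain ⟨d, hd⟩ : ∃ d, d = algebraMap k (RatFunc k) (M 1 0) * x + algebraMap k _ (M 1 1) :=
    ⟨_, rfl⟩
  have hd' : d = algebraMap (Polynomial k) (RatFunc k)
      (Polynomial.C q₃ * Polynomial.X - Polynomial.C q₁) := by
    rw [hd, h10, h11, map_sub, map_mul, hAx, hAx, ← hx, map_neg, sub_eq_add_neg]
  have hd0 : d ≠ 0 := hd' ▸ hden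
  have hmob' : a * d = algebraMap k (RatFunc k) q₁ * x + algebraMap k _ q₂ := by
    rw [hd', hmob, map_add, map_mul, hAx, hAx, ← hx]
  obtain ⟨c', hcc, hc'⟩ := exists_subst_eq M c hc
  have hp' := aeval_subst_toPoly M c x a (by rw [← hd, h00, h01, hmob'])
  rw [← hcc, aeval_toPoly, hAp, ← hd, ← hP] at hp'
  -- The transformed form, dehomogenized, is `d^(2g+2) p(a) = (β d^(g+1))² p`. Hence `β d^(g+1)` is
  -- a polynomial, and it is a constant `e` because the transformed form is squarefree.
  obtain ⟨w, hw, hw2⟩ := exists_eq_algebraMap_of_sq_mul hsq (β * d ^ (g + 1))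
    (W := affinePoly c') (by rw [hp']; ring)
  have hsq' := squarefree_affinePoly c' hc'
  obtain ⟨e, he, hwe⟩ := Polynomial.isUnit_iff.1 (hsq' w ⟨affinePoly c, by rw [← hw2, sq]⟩)
  have hd2 : d * (algebraMap k (RatFunc k) q₃ * a - algebraMap k _ q₁) =
      algebraMap k _ (q₁ ^ 2 + q₂ * q₃) := by
    rw [mul_sub, mul_left_comm, mul_comm d a, hmob', hd, h10, h11]
    simp only [map_add, map_mul, map_pow, map_neg]
    ring
  have hzd : z (ι d) = ι (algebraMap k (RatFunc k) q₃ * a - algebraMap k _ q₁) := by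
    rw [hd', h.map_alg, ha, h.aeval_map_ratFunc]
    simp
  have hw' : β' * (algebraMap k (RatFunc k) q₃ * a - algebraMap k _ q₁) ^ (g + 1) =
      algebraMap k _ e := by
    apply h.injective
    rw [map_mul, map_pow, ← hzd, ← hβ, ← map_pow, ← map_pow, ← map_mul, ← map_mul, hw, ← hwe,
      h.algebraMap_eq, AlgHom.commutes, ← h.algebraMap_eq, hAx]
  -- The constant `e` is its own image under the involution. Multiplying the expressions `β d^(g+1)`
  -- and `β' z(d)^(g+1)` for it and using `β' β = 1` and `d z(d) = q₁² + q₂ q₃` gives `e²` with its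
  -- correct sign.
  have he2 : e ^ 2 = (q₁ ^ 2 + q₂ * q₃) ^ (g + 1) := by
    apply (algebraMap k (RatFunc k)).injective
    rw [← hwe, hAx] at hw
    rw [map_pow, map_pow, ← hd2, sq, mul_pow]
    nth_rewrite 1 [← hw]
    rw [← hw']
    linear_combination (d ^ (g + 1) * (algebraMap k (RatFunc k) q₃ * a - algebraMap k _ q₁) ^
      (g + 1)) * hββ
  rw [← hcc, ← toPoly_smul]
  congr 1
  apply affinePoly_injective
  rw [← hw2, ← hwe, ← map_pow, he2, affinePoly, affinePoly, Finset.mul_sum]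
  refine Finset.sum_congr rfl fun i _ => ?_
  rw [map_mul, mul_assoc]

/-- A form invariant under an involutory Möbius transformation is equivalent to a normal form. -/
theorem exists_equivalent_normalForm_of_subst_eq {k : Type*} [Field k] [IsAlgClosed k] {g : ℕ}
    (h2 : (2 : k) ≠ 0) (f : Form g k) (q₁ q₂ q₃ : k) (M : GL (Fin 2) k)
    (hμ : q₁ ^ 2 + q₂ * q₃ ≠ 0) (hM : (M : Matrix (Fin 2) (Fin 2) k) = !![q₁, q₂; q₃, -q₁])
    (hsub : subst M (toPoly f.1) = (q₁ ^ 2 + q₂ * q₃) ^ (g + 1) • toPoly f.1) :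
    ∃ (a : Fin g → k) (ha : MvPolynomial.eval (normalForm a) (disc g k) ≠ 0),
      Moduli.mk f = Moduli.mk ⟨normalForm a, ha⟩ := by
  -- The trace-zero matrix `M` has eigenvalues `± l`. The sign of `l` is chosen so that the matrix
  -- `N` of eigenvectors below, of determinant `2 l (l + q₁)`, is invertible.
  obtain ⟨l, hl, hlq⟩ : ∃ l : k, l ^ 2 = q₁ ^ 2 + q₂ * q₃ ∧ l + q₁ ≠ 0 := by
    obtain ⟨l, hl⟩ := IsAlgClosed.exists_pow_nat_eq (q₁ ^ 2 + q₂ * q₃) (n := 2) (by omega)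
    by_cases h : l + q₁ = 0
    · refine ⟨-l, by rw [neg_sq, hl], fun h' => ?_⟩
      have h3 : 2 * l = 0 := by linear_combination h - h'
      rw [(mul_eq_zero.1 h3).resolve_left h2] at hl
      exact hμ (by rw [← hl]; ring)
    · exact ⟨l, hl, h⟩
  have hl0 : l ≠ 0 := by
    rintro rfl
    exact hμ (by rw [← hl]; ring)
  let N : GL (Fin 2) k := Matrix.GeneralLinearGroup.mkOfDetNeZero
    !![q₁ + l, -q₂; q₃, q₁ + l] (by
      rw [Matrix.det_fin_two_of]
      intro h0
      have h3 : 2 * l * (l + q₁) = 0 := by linear_combination h0 + hl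
      exact mul_ne_zero (mul_ne_zero h2 hl0) hlq h3)
  let D : GL (Fin 2) k := Matrix.GeneralLinearGroup.mkOfDetNeZero !![l, 0; 0, -l] (by
    rw [Matrix.det_fin_two_of]
    simpa using hl0)
  have hN : (N : Matrix (Fin 2) (Fin 2) k) = !![q₁ + l, -q₂; q₃, q₁ + l] := rfl
  have hD : (D : Matrix (Fin 2) (Fin 2) k) = !![l, 0; 0, -l] := rfl
  have hMN : M * N = N * D := by
    apply Units.ext
    rw [Units.val_mul, Units.val_mul, hM, hN, hD]
    ext i j
    fin_cases i <;> fin_cases j <;> simp [Matrix.mul_apply, Fin.sum_univ_two] <;>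
      first | linear_combination hl | linear_combination -hl | linear_combination 0 * hl
  obtain ⟨c, hc, hcd⟩ := exists_subst_eq N f.1 f.2
  have hinv : subst D (toPoly c) = (q₁ ^ 2 + q₂ * q₃) ^ (g + 1) • toPoly c := by
    rw [hc, ← subst_mul, ← hMN, subst_mul, hsub, map_smul]
  rw [subst_diagonal D (by rw [hD]; simp) (by rw [hD]; simp), ← toPoly_smul] at hinv
  -- In the new coordinates the `j`-th coefficient is multiplied by `l^j (-l)^(2g+2-j)`, that is by
  -- `(-1)^j (q₁² + q₂ q₃)^(g+1)`. With the opposite sign in the invariance the even coefficients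
  -- would vanish instead.
  have hodd : ∀ j : Fin (2 * g + 3), (j : ℕ) % 2 = 1 → c j = 0 := by
    intro j hj
    have h3 := congrFun (toPoly_injective hinv) j
    have h00 : D 0 0 = l := by rw [hD]; simp
    have h11 : D 1 1 = -l := by rw [hD]; simp
    have h4 : Odd (2 * g + 2 - (j : ℕ)) := by rw [Nat.odd_iff]; omega
    rw [h00, h11, h4.neg_pow, ← hl, ← pow_mul, mul_neg, ← pow_add,
      show (j : ℕ) + (2 * g + 2 - (j : ℕ)) = 2 * (g + 1) by omega] at h3
    have h5 : 2 * l ^ (2 * (g + 1)) * c j = 0 := by linear_combination -h3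
    exact (mul_eq_zero.1 h5).resolve_left (mul_ne_zero h2 (pow_ne_zero _ hl0))
  obtain ⟨a, ha, hE⟩ := exists_equivalent_normalForm_of_even ⟨c, hcd⟩ hodd
  exact ⟨a, ha, (Quot.sound (⟨N, hc⟩ : Equivalent f ⟨c, hcd⟩)).trans (Quot.sound hE)⟩


/-! ### The function field of the curve and the points of the locus -/

theorem isQuadraticExt_adjoinRoot {k : Type*} [Field k] (p : Polynomial k) (m : Polynomial (RatFunc k))
    (hm : m = Polynomial.X ^ 2 - Polynomial.C (algebraMap (Polynomial k) (RatFunc k) p)) :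
    IsQuadraticExt p (AdjoinRoot.of m) (AdjoinRoot.root m) where
  algebraMap_eq a := rfl
  sq_eq := by
    have h := (congrArg (Polynomial.eval₂ (AdjoinRoot.of m) (AdjoinRoot.root m)) hm).symm.trans
      (AdjoinRoot.eval₂_root m)
    rw [Polynomial.eval₂_sub, Polynomial.eval₂_pow, Polynomial.eval₂_X, Polynomial.eval₂_C] at h
    exact sub_eq_zero.1 h
  exists_eq l := by
    obtain ⟨q, rfl⟩ := AdjoinRoot.mk_surjective l
    have hmon : m.Monic := hm ▸ Polynomial.monic_X_pow_sub_C _ (by norm_num)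
    have hdeg : m.natDegree = 2 := by rw [hm, Polynomial.natDegree_X_pow_sub_C]
    have hd : (q %ₘ m).natDegree ≤ 1 := by
      have h1 := Polynomial.natDegree_modByMonic_lt q hmon (by
        intro h
        rw [h, Polynomial.natDegree_one] at hdeg
        omega)
      omega
    obtain ⟨b, a, hab⟩ := Polynomial.exists_eq_X_add_C_of_natDegree_le_one hd
    refine ⟨a, b, ?_⟩
    rw [← Polynomial.modByMonic_add_div q m, map_add, map_mul, hab, AdjoinRoot.mk_self, zero_mul,
      add_zero, map_add, map_mul, AdjoinRoot.mk_C, AdjoinRoot.mk_C, AdjoinRoot.mk_X]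
    exact add_comm _ _
  eq_zero a b h := by
    have h1 : AdjoinRoot.mk m (Polynomial.C b * Polynomial.X + Polynomial.C a) = 0 := by
      rw [map_add, map_mul, AdjoinRoot.mk_C, AdjoinRoot.mk_C, AdjoinRoot.mk_X, ← h]
      exact add_comm _ _
    have hz := Polynomial.eq_zero_of_dvd_of_natDegree_lt (AdjoinRoot.mk_eq_zero.1 h1) (by
      rw [hm, Polynomial.natDegree_X_pow_sub_C]
      exact lt_of_le_of_lt Polynomial.natDegree_linear_le (by norm_num))
    have h2 := congrArg (fun q => Polynomial.coeff q 0) hz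
    have h3 := congrArg (fun q => Polynomial.coeff q 1) hz
    simp at h2 h3
    exact ⟨h2, h3⟩

/-- The function field of the curve is a quadratic extension of `k(X)`. -/
theorem isQuadraticExt_funField {k : Type*} [Field k] {g : ℕ} (f : Form g k) :
    IsQuadraticExt (L := FunField f) (affinePoly f.1) (AdjoinRoot.of _) (AdjoinRoot.root _) :=
  isQuadraticExt_adjoinRoot _ _ rfl

/-- A curve with an extra involution is given by a normal form. -/
theorem exists_mk_eq_normalForm_of_isExtraInvolution {k : Type*} [Field k] [IsAlgClosed k] {g : ℕ}
    (hg : 2 ≤ g) (h2 : (2 : k) ≠ 0) (f : Form g k) (z : FunField f ≃ₐ[k] FunField f)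
    (hz : IsExtraInvolution f z) :
    ∃ (a : Fin g → k) (ha : MvPolynomial.eval (normalForm a) (disc g k) ≠ 0),
      Moduli.mk f = Moduli.mk ⟨normalForm a, ha⟩ := by
  obtain ⟨hz1, hz2, hz3⟩ := hz
  obtain ⟨q₁, q₂, q₃, M, hμ, hM, hsub⟩ := (isQuadraticExt_funField f).exists_subst_eq_smul hg h2 f.1
    f.2 (z : FunField f →ₐ[k] FunField f) (fun l => congrArg (fun w : FunField f ≃ₐ[k] _ => w l) hz2)
    (by
      by_contra! h
      exact hz3 ⟨hz1, h⟩)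
  exact exists_equivalent_normalForm_of_subst_eq h2 f q₁ q₂ q₃ M hμ hM hsub

theorem exists_algEquiv_adjoinRoot {k K : Type*} [Field k] [Field K] [Algebra k K] (s : K ≃ₐ[k] K)
    (m : Polynomial K) (hm : m.map (s : K →+* K) = m) :
    ∃ z : AdjoinRoot m ≃ₐ[k] AdjoinRoot m, (∀ r, z (AdjoinRoot.of m r) = AdjoinRoot.of m (s r)) ∧
      z (AdjoinRoot.root m) = AdjoinRoot.root m :=
  ⟨AdjoinRoot.mapAlgEquiv s m m (Associated.of_eq hm), fun r => by simp, by simp⟩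

/-- The curve of a normal form has the extra involution `X ↦ -X`, `Y ↦ Y`. -/
theorem exists_isExtraInvolution_normalForm {k : Type*} [Field k] {g : ℕ} (h2 : (2 : k) ≠ 0)
    (f : Form g k) (hodd : ∀ j : Fin (2 * g + 3), (j : ℕ) % 2 = 1 → f.1 j = 0) :
    ∃ z, IsExtraInvolution f z := by
  let s : RatFunc k ≃ₐ[k] RatFunc k := IsFractionRing.fieldEquivOfAlgEquiv k (RatFunc k) (RatFunc k)
    (Polynomial.algEquivAevalNegX (R := k))
  have hs : ∀ q : Polynomial k, s (algebraMap (Polynomial k) (RatFunc k) q) =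
      algebraMap _ _ (Polynomial.aeval (-Polynomial.X) q) := fun q =>
    IsFractionRing.fieldEquivOfAlgEquiv_algebraMap _ _ _ _ _
  have hss : ∀ q, s (s q) = q := by
    intro q
    obtain ⟨u, v, hv, rfl⟩ := IsFractionRing.div_surjective (A := Polynomial k) q
    have h1 : ∀ u : Polynomial k, Polynomial.aeval (-Polynomial.X)
        (Polynomial.aeval (-Polynomial.X : Polynomial k) u) = u := by
      intro u
      rw [← Polynomial.aeval_algHom_apply]
      simp
    rw [map_div₀, map_div₀, hs, hs, hs, hs, h1, h1]
  have hp : s (algebraMap (Polynomial k) (RatFunc k) (affinePoly f.1)) =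
      algebraMap _ _ (affinePoly f.1) := by
    rw [hs, affinePoly, map_sum]
    congr 1
    refine Finset.sum_congr rfl fun i _ => ?_
    rcases Nat.mod_two_eq_zero_or_one (i : ℕ) with h | h
    · rw [map_mul, map_pow, Polynomial.aeval_X, Polynomial.aeval_C, (Nat.even_iff.2 h).neg_pow]
      rfl
    · rw [hodd i h]
      simp
  obtain ⟨z, hzof, hzroot⟩ : ∃ z : FunField f ≃ₐ[k] FunField f,
      (∀ r, z (AdjoinRoot.of _ r) = AdjoinRoot.of _ (s r)) ∧
        z (AdjoinRoot.root _) = AdjoinRoot.root _ :=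
    exists_algEquiv_adjoinRoot s _ (by
      rw [Polynomial.map_sub, Polynomial.map_pow, Polynomial.map_X, Polynomial.map_C]
      exact congrArg (fun w => Polynomial.X ^ 2 - Polynomial.C w) hp)
  have hne : z (AdjoinRoot.of _ (algebraMap (Polynomial k) (RatFunc k) Polynomial.X)) ≠
      AdjoinRoot.of _ (algebraMap (Polynomial k) (RatFunc k) Polynomial.X) := by
    rw [hzof, hs]
    intro h
    have h3 := RatFunc.algebraMap_injective k ((isQuadraticExt_funField f).injective h)
    rw [Polynomial.aeval_X] at h3
    have h4 := congrArg (fun q => Polynomial.coeff q 1) h3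
    simp at h4
    exact h2 (by linear_combination -h4)
  refine ⟨z, ?_, ?_, fun h => hne (h.2 _)⟩
  · intro h
    rw [h] at hne
    exact hne rfl
  · refine AlgEquiv.ext fun l => ?_
    obtain ⟨a, b, rfl⟩ := (isQuadraticExt_funField f).exists_eq l
    rw [AlgEquiv.mul_apply]
    simp only [map_add, map_mul, hzof, hzroot, hss]
    rfl

/-- From here on the function fields of the curves are no longer needed: the locus is parametrized
by the normal forms. -/
theorem mem_locus_iff {k : Type*} [Field k] [IsAlgClosed k] {g : ℕ} (hg : 2 ≤ g)
    (h2 : (2 : k) ≠ 0) (p : Moduli g k) : p ∈ locus g k ↔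
      ∃ (a : Fin g → k) (ha : MvPolynomial.eval (normalForm a) (disc g k) ≠ 0),
        p = Moduli.mk ⟨normalForm a, ha⟩ := by
  constructor
  · rintro ⟨f, rfl, z, hz⟩
    exact exists_mk_eq_normalForm_of_isExtraInvolution hg h2 f z hz
  · rintro ⟨a, ha, rfl⟩
    exact ⟨_, rfl, exists_isExtraInvolution_normalForm h2 _ fun j hj => normalForm_odd a j hj⟩


/-! ### The pull-back of the regular functions on the moduli space -/

theorem aeval_normalDisc {k A : Type*} [Field k] [CommRing A] [Algebra k A] {g : ℕ}
    (b : Fin g → A) : MvPolynomial.aeval b (normalDisc g k) =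
      MvPolynomial.aeval (normalForm b) (disc g k) := by
  rw [normalDisc, MvPolynomial.comp_aeval_apply]
  congr 2
  funext j
  refine (normalForm_map (MvPolynomial.aeval b : MvPolynomial (Fin g) k →ₐ[k] A).toRingHom _ j).trans
    ?_
  simp

theorem aeval_aeval_normalForm {k A : Type*} [Field k] [CommRing A] [Algebra k A] {g : ℕ}
    (b : Fin g → A) (P : MvPolynomial (Fin (2 * g + 3)) k) :
    MvPolynomial.aeval b (MvPolynomial.aeval
      (normalForm (MvPolynomial.X : Fin g → MvPolynomial (Fin g) k)) P) =
      MvPolynomial.aeval (normalForm b) P := by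
  rw [MvPolynomial.comp_aeval_apply]
  congr 2
  funext j
  refine (normalForm_map (MvPolynomial.aeval b : MvPolynomial (Fin g) k →ₐ[k] A).toRingHom _ j).trans
    ?_
  simp

theorem eval_normalDisc {k : Type*} [Field k] {g : ℕ} (b : Fin g → k) :
    MvPolynomial.eval b (normalDisc g k) = MvPolynomial.eval (normalForm b) (disc g k) :=
  aeval_normalDisc b

theorem affinePoly_normalForm_zero {k : Type*} [Field k] (g : ℕ) :
    affinePoly (normalForm (0 : Fin g → k)) =
      Polynomial.X ^ (2 * g + 2) - Polynomial.C (-1 : k) := by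
  apply Eq.symm
  have h : (Polynomial.X ^ (2 * g + 2) - Polynomial.C (-1 : k)).natDegree ≤ 2 * g + 2 := by
    rw [Polynomial.natDegree_X_pow_sub_C]
  rw [← affinePoly_coeff h]
  congr 1
  funext j
  have hj := j.2
  rcases index_cases j with h | rfl | rfl | ⟨i, rfl⟩
  · rw [normalForm_odd _ j h, Polynomial.coeff_sub, Polynomial.coeff_X_pow, Polynomial.coeff_C,
      if_neg (by omega), if_neg (by omega), sub_zero]
  · rw [normalForm_zero]
    simp
  · rw [normalForm_last]
    simp [Polynomial.coeff_one]
  · rw [normalForm_middle, Polynomial.coeff_sub, Polynomial.coeff_X_pow, Polynomial.coeff_C,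
      if_neg (by simp only; omega), if_neg (by simp only; omega), sub_zero]
    rfl

/-- At `a = 0` the form is `X^(2g+2) + 1`, which is separable when `2g+2` is invertible. A vanishing
bracket would mean two proportional linear factors, hence a square factor. -/
theorem normalDisc_ne_zero {k : Type*} [Field k] [IsAlgClosed k] {g : ℕ}
    (hn : ((2 * g + 2 : ℕ) : k) ≠ 0) : normalDisc g k ≠ 0 := by
  intro h0
  have h1 := eval_normalDisc (0 : Fin g → k)
  rw [h0, map_zero] at h1
  obtain ⟨r, hr⟩ := exists_rootForm (normalForm (0 : Fin g → k))
  have haff := affinePoly_rootForm r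
  rw [hr, affinePoly_normalForm_zero] at haff
  have hsq : Squarefree (rootPoly r) := by
    rw [← haff]
    exact (Polynomial.separable_X_pow_sub_C (-1 : k) hn (by simp)).squarefree
  have hz : ∀ i, r i 1 ≠ 0 := by
    have h2 := rootForm_last r
    rw [hr, normalForm_last] at h2
    intro i hi
    exact one_ne_zero (h2.trans (Finset.prod_eq_zero (Finset.mem_univ i) hi))
  rw [← hr, eval_disc_rootForm] at h1
  have h3 := (mul_eq_zero.1 h1.symm).resolve_left (discSign_ne_zero g k)
  refine (bracketProd_ne_zero_iff r).2 ?_ h3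
  intro i j hij hb
  have h4 : (Polynomial.C (r i 1) * Polynomial.X - Polynomial.C (r i 0)) *
      (Polynomial.C (r i 1) * Polynomial.X - Polynomial.C (r i 0)) ∣ rootPoly r := by
    have h5 : Polynomial.C (r i 1) * Polynomial.X - Polynomial.C (r i 0) =
        Polynomial.C (r i 1 / r j 1) * (Polynomial.C (r j 1) * Polynomial.X -
          Polynomial.C (r j 0)) := by
      rw [mul_sub, ← mul_assoc, ← Polynomial.C_mul, ← Polynomial.C_mul, div_mul_cancel₀ _ (hz j)]
      congr 2
      rw [div_mul_eq_mul_div, eq_div_iff (hz j)]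
      unfold bracket at hb
      linear_combination hb
    have h6 : IsUnit (Polynomial.C (r i 1 / r j 1)) :=
      Polynomial.isUnit_C.2 (IsUnit.mk0 _ (div_ne_zero (hz i) (hz j)))
    rw [rootPoly, ← Finset.mul_prod_erase _ _ (Finset.mem_univ i)]
    apply mul_dvd_mul_left
    rw [h5, h6.mul_left_dvd]
    exact Finset.dvd_prod_of_mem (fun m => Polynomial.C (r m 1) * Polynomial.X -
      Polynomial.C (r m 0)) (Finset.mem_erase.2 ⟨hij.symm, Finset.mem_univ j⟩)
  have h7 := Polynomial.natDegree_eq_zero_of_isUnit (hsq _ h4)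
  rw [sub_eq_add_neg, ← Polynomial.C_neg, Polynomial.natDegree_linear (hz i)] at h7
  omega

section Pullback

variable {k : Type*} [Field k] {g : ℕ}

/-- The pull-back of a function is determined by its values on the normal forms. -/
theorem eq_of_forall_normalForm [IsAlgClosed k] (hN : normalDisc g k ≠ 0) {F : Moduli g k → k}
    {r r' : ParamField g k} {p q p' q' : MvPolynomial (Fin g) k} (hq : q ≠ 0) (hq' : q' ≠ 0)
    (hr : r * algebraMap _ (ParamField g k) q = algebraMap _ _ p)
    (hr' : r' * algebraMap _ (ParamField g k) q' = algebraMap _ _ p')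
    (h : ∀ (a : Fin g → k) (ha : MvPolynomial.eval (normalForm a) (disc g k) ≠ 0),
      F (Moduli.mk ⟨normalForm a, ha⟩) * MvPolynomial.eval a q = MvPolynomial.eval a p)
    (h' : ∀ (a : Fin g → k) (ha : MvPolynomial.eval (normalForm a) (disc g k) ≠ 0),
      F (Moduli.mk ⟨normalForm a, ha⟩) * MvPolynomial.eval a q' = MvPolynomial.eval a p') :
    r = r' := by
  have : Infinite k := IsAlgClosed.instInfinite
  -- The hypotheses say nothing about degenerate normal forms; the factor `normalDisc` makes the
  -- identity hold at those points too.
  have h1 : (p * q' - p' * q) * normalDisc g k = 0 := by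
    apply MvPolynomial.funext
    intro a
    rw [map_mul, map_zero]
    by_cases ha : MvPolynomial.eval (normalForm a) (disc g k) = 0
    · rw [eval_normalDisc, ha, mul_zero]
    · rw [map_sub, map_mul, map_mul, ← h a ha, ← h' a ha]
      ring
  have h2 := sub_eq_zero.1 ((mul_eq_zero.1 h1).resolve_right hN)
  have hinj := IsFractionRing.injective (MvPolynomial (Fin g) k) (ParamField g k)
  have hq0 : algebraMap _ (ParamField g k) q ≠ 0 := (map_ne_zero_iff _ hinj).2 hq
  have hq0' : algebraMap _ (ParamField g k) q' ≠ 0 := (map_ne_zero_iff _ hinj).2 hq'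
  have h3 := congrArg (algebraMap _ (ParamField g k)) h2
  rw [map_mul, map_mul, ← hr, ← hr'] at h3
  exact mul_right_cancel₀ (mul_ne_zero hq0 hq0') (by linear_combination h3)

theorem IsPullback.unique [IsAlgClosed k] (hN : normalDisc g k ≠ 0) {F : Moduli g k → k} {r r' : ParamField g k}
    (h : IsPullback F r) (h' : IsPullback F r') : r = r' := by
  obtain ⟨p, m, h1, h2⟩ := h
  obtain ⟨p', m', h1', h2'⟩ := h'
  refine eq_of_forall_normalForm hN (F := F) (q := normalDisc g k ^ m) (q' := normalDisc g k ^ m')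
    (p := p) (p' := p') (pow_ne_zero _ hN) (pow_ne_zero _ hN) (by rw [map_pow, h1])
    (by rw [map_pow, h1']) (fun a ha => ?_) (fun a ha => ?_)
  · rw [map_pow, h2]
  · rw [map_pow, h2']

theorem IsPullback.add {F G : Moduli g k → k} {r s : ParamField g k}
    (h : IsPullback F r) (h' : IsPullback G s) : IsPullback (F + G) (r + s) := by
  obtain ⟨p, m, h1, h2⟩ := h
  obtain ⟨q, n, h1', h2'⟩ := h'
  refine ⟨p * normalDisc g k ^ n + q * normalDisc g k ^ m, m + n, ?_, fun a ha => ?_⟩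
  · rw [map_add, map_mul, map_mul, map_pow, map_pow, ← h1, ← h1']
    ring
  · rw [map_add, map_mul, map_mul, map_pow, map_pow, ← h2 a ha, ← h2' a ha, Pi.add_apply]
    ring

theorem IsPullback.mul {F G : Moduli g k → k} {r s : ParamField g k}
    (h : IsPullback F r) (h' : IsPullback G s) : IsPullback (F * G) (r * s) := by
  obtain ⟨p, m, h1, h2⟩ := h
  obtain ⟨q, n, h1', h2'⟩ := h'
  refine ⟨p * q, m + n, ?_, fun a ha => ?_⟩
  · rw [map_mul, ← h1, ← h1']
    ring
  · rw [map_mul, ← h2 a ha, ← h2' a ha, Pi.mul_apply]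
    ring

theorem IsPullback.const (c : k) :
    IsPullback (algebraMap k (Moduli g k → k) c) (algebraMap k (ParamField g k) c) := by
  refine ⟨MvPolynomial.C c, 0, ?_, fun a ha => ?_⟩
  · rw [pow_zero, mul_one]
    exact IsScalarTower.algebraMap_apply k (MvPolynomial (Fin g) k) (ParamField g k) c
  · simp

/-- The pull-back of a regular function is given by substituting the generic normal form. -/
theorem isPullback_of_eval_eq (hN : normalDisc g k ≠ 0) {F : Moduli g k → k}
    {P : MvPolynomial (Fin (2 * g + 3)) k} {m : ℕ}
    (h : ∀ f : Form g k, F (Moduli.mk f) * MvPolynomial.eval f.1 (disc g k) ^ m =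
      MvPolynomial.eval f.1 P) :
    IsPullback F (MvPolynomial.aeval (normalForm fun i : Fin g =>
        algebraMap (MvPolynomial (Fin g) k) (ParamField g k) (MvPolynomial.X i)) P /
      algebraMap _ (ParamField g k) (normalDisc g k) ^ m) := by
  have hinj := IsFractionRing.injective (MvPolynomial (Fin g) k) (ParamField g k)
  have hN0 := (map_ne_zero_iff _ hinj).2 hN
  refine ⟨MvPolynomial.aeval (normalForm MvPolynomial.X) P, m, ?_, fun a ha => ?_⟩
  · rw [div_mul_cancel₀ _ (pow_ne_zero _ hN0), ← MvPolynomial.aeval_algebraMap_apply]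
    congr 2
    funext j
    exact (normalForm_map _ _ j).symm
  · rw [eval_normalDisc, h ⟨normalForm a, ha⟩]
    exact (aeval_aeval_normalForm a P).symm

theorem exists_isPullback [IsAlgClosed k] (hN : normalDisc g k ≠ 0) (F : coordRing g k) :
    ∃ r, IsPullback F.1 r := by
  obtain ⟨P, m, h⟩ := F.2
  exact ⟨_, isPullback_of_eval_eq hN h⟩

/-- The pull-back of the regular functions on the moduli space to `k(a_1, …, a_g)`. -/
def pullback [IsAlgClosed k] (hN : normalDisc g k ≠ 0) : coordRing g k →ₐ[k] ParamField g k where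
  toFun F := (exists_isPullback hN F).choose
  map_one' := ((exists_isPullback hN 1).choose_spec).unique hN (by
    have := IsPullback.const (g := g) (1 : k)
    rwa [map_one, map_one] at this)
  map_mul' F G := ((exists_isPullback hN (F * G)).choose_spec).unique hN
    ((exists_isPullback hN F).choose_spec.mul (exists_isPullback hN G).choose_spec)
  map_zero' := ((exists_isPullback hN 0).choose_spec).unique hN (by
    have := IsPullback.const (g := g) (0 : k)
    rwa [map_zero, map_zero] at this)
  map_add' F G := ((exists_isPullback hN (F + G)).choose_spec).unique hN
    ((exists_isPullback hN F).choose_spec.add (exists_isPullback hN G).choose_spec)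
  commutes' c := ((exists_isPullback hN (algebraMap k _ c)).choose_spec).unique hN
    (IsPullback.const c)

theorem isPullback_pullback [IsAlgClosed k] (hN : normalDisc g k ≠ 0) (F : coordRing g k) :
    IsPullback F.1 (pullback hN F) :=
  (exists_isPullback hN F).choose_spec

/-- The functions with vanishing pull-back are those which vanish on the locus. -/
theorem mem_locusIdeal_iff [IsAlgClosed k] (hg : 2 ≤ g) (h2 : (2 : k) ≠ 0) (hN : normalDisc g k ≠ 0)
    (F : coordRing g k) : F ∈ locusIdeal g k ↔ pullback hN F = 0 := by
  constructor
  · intro hF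
    refine (isPullback_pullback hN F).unique hN ⟨0, 0, by simp, fun a ha => ?_⟩
    have h3 : F.1 (Moduli.mk ⟨normalForm a, ha⟩) = 0 :=
      hF _ ((mem_locus_iff hg h2 _).2 ⟨a, ha, rfl⟩)
    rw [h3, zero_mul, map_zero]
  · intro hF p hp
    obtain ⟨a, ha, rfl⟩ := (mem_locus_iff hg h2 p).1 hp
    obtain ⟨q, m, h3, h4⟩ := isPullback_pullback hN F
    rw [hF, zero_mul] at h3
    have hq : q = 0 := by
      rw [eq_comm, map_eq_zero_iff _ (IsFractionRing.injective (MvPolynomial (Fin g) k) _)] at h3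
      exact h3
    have h5 := h4 a ha
    rw [hq, map_zero, eval_normalDisc] at h5
    exact (mul_eq_zero.1 h5).resolve_right (pow_ne_zero _ ha)

theorem locusIdeal_eq_ker [IsAlgClosed k] (hg : 2 ≤ g) (h2 : (2 : k) ≠ 0) (hN : normalDisc g k ≠ 0) :
    locusIdeal g k = RingHom.ker (pullback (g := g) hN) :=
  Ideal.ext fun F => (mem_locusIdeal_iff hg h2 hN F).trans RingHom.mem_ker.symm

/-- The quotient embeds into the field `k(a_1, …, a_g)`. -/
theorem locusIdeal_isPrime [IsAlgClosed k] (hg : 2 ≤ g) (h2 : (2 : k) ≠ 0) (hN : normalDisc g k ≠ 0) :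
    (locusIdeal g k).IsPrime := by
  rw [locusIdeal_eq_ker hg h2 hN]
  exact RingHom.ker_isPrime _

/-- An automorphism of the parameters which permutes the normal forms within their classes fixes
the pull-backs. -/
theorem map_pullback_eq [IsAlgClosed k] (hN : normalDisc g k ≠ 0) (F : coordRing g k)
    (s : MvPolynomial (Fin g) k ≃ₐ[k] MvPolynomial (Fin g) k) (t : (Fin g → k) → (Fin g → k))
    (hst : ∀ a q, MvPolynomial.eval a (s q) = MvPolynomial.eval (t a) q)
    (M : GL (Fin 2) k)
    (hM : ∀ a : Fin g → k, subst M (toPoly (normalForm a)) = toPoly (normalForm (t a))) :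
    IsFractionRing.fieldEquivOfAlgEquiv k (ParamField g k) (ParamField g k) s (pullback hN F) =
      pullback hN F := by
  obtain ⟨p, m, h1, h2⟩ := isPullback_pullback hN F
  -- The transformed pull-back has denominator `s (normalDisc ^ m)` instead of a power of
  -- `normalDisc`, but it takes the same values, because `f_a` and `f_(t a)` define the same point
  -- of `H_g`.
  refine eq_of_forall_normalForm hN (F := F.1) (q := s (normalDisc g k ^ m)) (p := s p)
    (q' := normalDisc g k ^ m) (p' := p)
    ((map_ne_zero_iff _ s.injective).2 (pow_ne_zero _ hN)) (pow_ne_zero _ hN) ?_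
    (by rw [map_pow, h1]) (fun a ha => ?_) (fun a ha => by rw [map_pow, h2])
  · rw [← IsFractionRing.fieldEquivOfAlgEquiv_algebraMap k (ParamField g k) (ParamField g k) s,
      ← IsFractionRing.fieldEquivOfAlgEquiv_algebraMap k (ParamField g k) (ParamField g k) s, ← h1,
      map_mul, map_pow]
  · obtain ⟨c, hc, hd⟩ := exists_subst_eq M _ ha
    rw [hM] at hc
    rw [toPoly_injective hc] at hd
    have h3 : Moduli.mk (⟨normalForm a, ha⟩ : Form g k) = Moduli.mk ⟨normalForm (t a), hd⟩ :=
      Quot.sound ⟨M, (hM a).symm⟩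
    rw [hst, hst, h3, map_pow, h2]

end Pullback

/-! ### The effect of the changes of coordinate on the parameters -/

theorem subst_scaleGL_normalForm {k : Type*} [Field k] {g : ℕ} (ε : kˣ)
    (hε : (ε : k) ^ (2 * g + 2) = 1) (a : Fin g → k) :
    subst (scaleGL ε) (toPoly (normalForm a)) =
      toPoly (normalForm fun i : Fin g => (ε : k) ^ (2 * ((i : ℕ) + 1)) * a i) := by
  rw [subst_diagonal _ (by simp [scaleGL, Matrix.GeneralLinearGroup.mkOfDetNeZero])
    (by simp [scaleGL, Matrix.GeneralLinearGroup.mkOfDetNeZero])]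
  have h00 : scaleGL ε 0 0 = (ε : k) := by
    simp [scaleGL, Matrix.GeneralLinearGroup.mkOfDetNeZero]
  have h11 : scaleGL ε 1 1 = (1 : k) := by
    simp [scaleGL, Matrix.GeneralLinearGroup.mkOfDetNeZero]
  rw [h00, h11]
  congr 1
  funext j
  rw [one_pow, mul_one]
  rcases index_cases j with h | rfl | rfl | ⟨i, rfl⟩
  · rw [normalForm_odd _ j h, normalForm_odd _ j h, mul_zero]
  · rw [normalForm_zero, normalForm_zero]
    simp
  · rw [normalForm_last, normalForm_last, mul_one, Fin.val_last, hε]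
  · rw [normalForm_middle, normalForm_middle]

theorem normalForm_rev {R : Type*} [CommRing R] {g : ℕ} (a : Fin g → R) (j : Fin (2 * g + 3)) :
    normalForm a j.rev = normalForm (fun i => a i.rev) j := by
  have hv : (j.rev : ℕ) = 2 * g + 2 - j := by rw [Fin.val_rev]; omega
  rcases index_cases j with h | rfl | rfl | ⟨i, rfl⟩
  · rw [normalForm_odd _ j h, normalForm_odd _ _ (by omega)]
  · rw [normalForm_zero, Fin.rev_zero, normalForm_last]
  · rw [normalForm_last, Fin.rev_last, normalForm_zero]
  · rw [normalForm_middle, ← normalForm_middle a i.rev]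
    congr 1
    ext
    rw [hv]
    simp only [Fin.val_rev]
    omega

theorem subst_swapGL_normalForm {k : Type*} [Field k] {g : ℕ} (a : Fin g → k) :
    subst (swapGL k) (toPoly (normalForm a)) = toPoly (normalForm fun i : Fin g => a i.rev) := by
  rw [subst_antidiagonal _ (by simp [swapGL, Matrix.GeneralLinearGroup.mkOfDetNeZero])
    (by simp [swapGL, Matrix.GeneralLinearGroup.mkOfDetNeZero])]
  have h01 : swapGL k 0 1 = 1 := by simp [swapGL, Matrix.GeneralLinearGroup.mkOfDetNeZero]
  have h10 : swapGL k 1 0 = 1 := by simp [swapGL, Matrix.GeneralLinearGroup.mkOfDetNeZero]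
  rw [h01, h10]
  congr 1
  funext j
  rw [one_pow, one_pow, one_mul, one_mul, normalForm_rev]

theorem pullback_mem_fixedField {k : Type*} [Field k] [IsAlgClosed k] {g : ℕ}
    (hN : normalDisc g k ≠ 0) (ε : kˣ) (hε : (ε : k) ^ (2 * g + 2) = 1) (F : coordRing g k) :
    pullback hN F ∈ IntermediateField.fixedField (dihedralAut g ε) := by
  have h : dihedralAut g ε ≤ MulAction.stabilizer (ParamField g k ≃ₐ[k] ParamField g k)
      (pullback hN F) := by
    rw [dihedralAut, Subgroup.closure_le]
    rintro s (rfl | rfl)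
    · refine map_pullback_eq hN F (scalePoly g ε) (fun a i => (ε : k) ^ (2 * ((i : ℕ) + 1)) * a i)
        (fun a q => ?_) (scaleGL ε) (subst_scaleGL_normalForm ε hε)
      simp only [scalePoly, AlgEquiv.ofAlgHom_apply]
      rw [← MvPolynomial.coe_aeval_eq_eval, ← MvPolynomial.coe_aeval_eq_eval, RingHom.coe_coe,
        RingHom.coe_coe, MvPolynomial.comp_aeval_apply]
      simp
    · refine map_pullback_eq hN F _ (fun a i => a i.rev) (fun a q => ?_) (swapGL k)
        subst_swapGL_normalForm
      rw [MvPolynomial.renameEquiv_apply, MvPolynomial.eval_rename]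
      rfl
  rw [IntermediateField.mem_fixedField_iff]
  intro s hs
  exact h hs


/-! ### Homomorphisms from dihedral groups -/

section Dihedral

variable {G : Type*} [Group G]

/-- The homomorphism from `ZMod n` given by an element with `n`-th power `1`. -/
def zmodHom (n : ℕ) (a : G) (ha : a ^ n = 1) : Multiplicative (ZMod n) →* G :=
  AddMonoidHom.toMultiplicativeLeft (ZMod.lift n ⟨zmultiplesHom (Additive G) (Additive.ofMul a), by
    simpa using congrArg Additive.ofMul ha⟩)

theorem zmodHom_intCast (n : ℕ) (a : G) (ha : a ^ n = 1) (i : ℤ) :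
    zmodHom n a ha (Multiplicative.ofAdd (i : ZMod n)) = a ^ i := by
  simp [zmodHom]

/-- The homomorphism from the dihedral group given by `a` and `b` with `a ^ n = b ^ 2 = 1` and
`b a b = a⁻¹`. -/
def dihedralHom (n : ℕ) (a b : G) (ha : a ^ n = 1) (hb : b * b = 1) (hab : b * a * b = a⁻¹) :
    DihedralGroup n →* G where
  toFun
    | .r i => zmodHom n a ha (Multiplicative.ofAdd i)
    | .sr i => b * zmodHom n a ha (Multiplicative.ofAdd i)
  map_one' := map_one (zmodHom n a ha)
  map_mul' := by
    have hbi : b⁻¹ = b := inv_eq_of_mul_eq_one_left hb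
    -- The commutation rule `a^j b = b a^(-j)` is all that the four cases of the multiplication
    -- table require.
    have key : ∀ i : ZMod n, zmodHom n a ha (Multiplicative.ofAdd i) * b =
        b * zmodHom n a ha (Multiplicative.ofAdd (-i)) := by
      intro i
      obtain ⟨j, rfl⟩ := ZMod.intCast_surjective i
      rw [← Int.cast_neg, zmodHom_intCast, zmodHom_intCast, zpow_neg, ← inv_zpow, ← hab]
      have h : (b * a * b) ^ j = b * a ^ j * b := by
        have := conj_zpow (a := b) (b := a) (i := j)
        rwa [hbi] at this
      rw [h, mul_assoc, ← mul_assoc, hb, one_mul]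
    rintro (i | i) (j | j)
    · rw [DihedralGroup.r_mul_r]
      exact map_mul (zmodHom n a ha) _ _
    · rw [DihedralGroup.r_mul_sr]
      simp only
      rw [← mul_assoc, key, mul_assoc, ← map_mul, ← ofAdd_add, neg_add_eq_sub]
    · rw [DihedralGroup.sr_mul_r]
      simp only
      rw [mul_assoc, ← map_mul, ← ofAdd_add]
    · rw [DihedralGroup.sr_mul_sr]
      simp only
      rw [mul_assoc, ← mul_assoc (zmodHom n a ha _), key, ← mul_assoc, ← mul_assoc, hb, one_mul,
        ← map_mul, ← ofAdd_add, neg_add_eq_sub]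

variable (n : ℕ) (a b : G) (ha : a ^ n = 1) (hb : b * b = 1) (hab : b * a * b = a⁻¹)

theorem dihedralHom_r (i : ℤ) : dihedralHom n a b ha hb hab (.r (i : ZMod n)) = a ^ i :=
  zmodHom_intCast n a ha i

theorem dihedralHom_sr (i : ℤ) : dihedralHom n a b ha hb hab (.sr (i : ZMod n)) = b * a ^ i :=
  congrArg (b * ·) (zmodHom_intCast n a ha i)

theorem dihedralHom_r_one : dihedralHom n a b ha hb hab (.r 1) = a := by
  have := dihedralHom_r n a b ha hb hab 1
  rwa [Int.cast_one, zpow_one] at this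

theorem dihedralHom_sr_zero : dihedralHom n a b ha hb hab (.sr 0) = b := by
  have := dihedralHom_sr n a b ha hb hab 0
  rwa [Int.cast_zero, zpow_zero, mul_one] at this

theorem dihedralHom_range : (dihedralHom n a b ha hb hab).range = Subgroup.closure {a, b} := by
  have ha' : a ∈ Subgroup.closure {a, b} := Subgroup.subset_closure (Or.inl rfl)
  have hb' : b ∈ Subgroup.closure {a, b} := Subgroup.subset_closure (Or.inr rfl)
  apply le_antisymm
  · rintro _ ⟨i | i, rfl⟩
    · obtain ⟨j, rfl⟩ := ZMod.intCast_surjective i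
      rw [dihedralHom_r]
      exact zpow_mem ha' j
    · obtain ⟨j, rfl⟩ := ZMod.intCast_surjective i
      rw [dihedralHom_sr]
      exact mul_mem hb' (zpow_mem ha' j)
  · rw [Subgroup.closure_le]
    rintro _ (rfl | rfl)
    · exact ⟨_, dihedralHom_r_one n _ b ha hb hab⟩
    · exact ⟨_, dihedralHom_sr_zero n a _ ha hb hab⟩

theorem dihedralHom_injective (h1 : ∀ i : ℤ, a ^ i = 1 → (n : ℤ) ∣ i)
    (h2 : ∀ i : ℤ, b * a ^ i ≠ 1) : Function.Injective (dihedralHom n a b ha hb hab) := by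
  rw [injective_iff_map_eq_one]
  rintro (i | i) hi
  · obtain ⟨j, rfl⟩ := ZMod.intCast_surjective i
    rw [dihedralHom_r] at hi
    rw [(ZMod.intCast_zmod_eq_zero_iff_dvd j n).2 (h1 j hi)]
    rfl
  · obtain ⟨j, rfl⟩ := ZMod.intCast_surjective i
    rw [dihedralHom_sr] at hi
    exact absurd hi (h2 j)

end Dihedral

/-! ### The two dihedral groups -/

section Groups

variable {k : Type*} [Field k]

theorem coe_scaleGL (u : kˣ) : (scaleGL u : Matrix (Fin 2) (Fin 2) k) = !![(u : k), 0; 0, 1] := rfl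

theorem coe_swapGL : (swapGL k : Matrix (Fin 2) (Fin 2) k) = !![0, 1; 1, 0] := rfl

/-- `u ↦ (X ↦ u X)` as a homomorphism. -/
def scaleHom (k : Type*) [Field k] : kˣ →* Matrix.ProjGenLinGroup (Fin 2) k where
  toFun u := Matrix.ProjGenLinGroup.mk (scaleGL u)
  map_one' := by
    rw [← map_one Matrix.ProjGenLinGroup.mk]
    congr 1
    apply Units.ext
    rw [coe_scaleGL, Units.val_one, Units.val_one, Matrix.one_fin_two]
  map_mul' u v := by
    rw [← map_mul]
    congr 1
    apply Units.ext
    rw [Units.val_mul, coe_scaleGL, coe_scaleGL, coe_scaleGL, Matrix.mul_fin_two]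
    simp

theorem mk_eq_mk_iff (M N : GL (Fin 2) k) :
    Matrix.ProjGenLinGroup.mk M = Matrix.ProjGenLinGroup.mk N ↔
      ∃ u : kˣ, (M : Matrix (Fin 2) (Fin 2) k) = (u : k) • (N : Matrix (Fin 2) (Fin 2) k) := by
  rw [eq_comm, Matrix.ProjGenLinGroup.mk_eq_mk_iff]
  refine exists_congr fun u => ?_
  rw [← Units.val_inj, Units.val_mul, Matrix.GeneralLinearGroup.coe_scalar, eq_comm,
    ← Matrix.scalar_comm _ (fun r => Commute.all _ _), Matrix.scalar_apply,
    ← Matrix.smul_eq_diagonal_mul]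

theorem scaleHom_injective : Function.Injective (scaleHom k) := by
  intro u v h
  obtain ⟨w, hw⟩ := (mk_eq_mk_iff _ _).1 h
  rw [coe_scaleGL, coe_scaleGL] at hw
  have h00 := congrFun (congrFun hw 0) 0
  have h11 := congrFun (congrFun hw 1) 1
  simp at h00 h11
  apply Units.ext
  rw [h00, ← h11]
  simp

theorem mk_swap_mul_self : Matrix.ProjGenLinGroup.mk (swapGL k) * Matrix.ProjGenLinGroup.mk (swapGL k) = 1 := by
  rw [← map_mul, ← map_one Matrix.ProjGenLinGroup.mk]
  congr 1
  apply Units.ext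
  rw [Units.val_mul, coe_swapGL, Matrix.mul_fin_two, Units.val_one, Matrix.one_fin_two]
  simp

theorem swap_mul_scale_mul_swap (u : kˣ) :
    Matrix.ProjGenLinGroup.mk (swapGL k) * scaleHom k u * Matrix.ProjGenLinGroup.mk (swapGL k) =
      (scaleHom k u)⁻¹ := by
  rw [← map_inv]
  change _ = Matrix.ProjGenLinGroup.mk (scaleGL u⁻¹)
  change _ * Matrix.ProjGenLinGroup.mk (scaleGL u) * _ = _
  rw [← map_mul, ← map_mul, mk_eq_mk_iff]
  refine ⟨u, ?_⟩
  rw [Units.val_mul, Units.val_mul, coe_swapGL, coe_scaleGL, coe_scaleGL, Matrix.mul_fin_two,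
    Matrix.mul_fin_two]
  ext i j
  fin_cases i <;> fin_cases j <;> simp

theorem swap_mul_scale_ne_one (u : kˣ) :
    Matrix.ProjGenLinGroup.mk (swapGL k) * scaleHom k u ≠ 1 := by
  intro h
  change _ * Matrix.ProjGenLinGroup.mk (scaleGL u) = 1 at h
  rw [← map_mul, ← map_one Matrix.ProjGenLinGroup.mk, mk_eq_mk_iff] at h
  obtain ⟨w, hw⟩ := h
  have h00 := congrFun (congrFun hw 0) 0
  rw [Units.val_mul, coe_swapGL, coe_scaleGL, Matrix.mul_fin_two] at h00
  simp at h00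
  exact w.ne_zero h00.symm

variable {g : ℕ}

/-- The parameter `a_(i+1)` as an element of `k(a_1, …, a_g)`. -/
def param (k : Type*) [Field k] {g : ℕ} (i : Fin g) : ParamField g k :=
  algebraMap (MvPolynomial (Fin g) k) (ParamField g k) (MvPolynomial.X i)

/-- An automorphism of `k(a_1, …, a_g)` is determined by its effect on the parameters. -/
theorem algHom_paramField_ext {A : Type*} [Semiring A] [Algebra k A]
    {s t : ParamField g k →ₐ[k] A}
    (h : ∀ i, s (param k i) = t (param k i)) :
    s = t := by
  apply AlgHom.coe_ringHom_injective
  apply IsLocalization.ringHom_ext (nonZeroDivisors (MvPolynomial (Fin g) k))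
  apply MvPolynomial.ringHom_ext
  · intro c
    have h1 : algebraMap (MvPolynomial (Fin g) k) (ParamField g k) (MvPolynomial.C c) =
      algebraMap k _ c := (IsScalarTower.algebraMap_apply k _ _ c).symm
    simp [h1]
  · exact h

theorem scaleAut_X (u : kˣ) (i : Fin g) : scaleAut g u (param k i) =
    algebraMap k _ ((u : k) ^ (2 * ((i : ℕ) + 1))) * param k i := by
  rw [param, scaleAut, IsFractionRing.fieldEquivOfAlgEquiv_algebraMap, scalePoly,
    AlgEquiv.ofAlgHom_apply, MvPolynomial.aeval_X, map_mul]
  rfl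

theorem swapAut_X (i : Fin g) : swapAut g k (param k i) =
    param k i.rev := by
  rw [param, swapAut, IsFractionRing.fieldEquivOfAlgEquiv_algebraMap]
  simp [param]

theorem paramAut_ext {s t : ParamField g k ≃ₐ[k] ParamField g k}
    (h : ∀ i, s (param k i) = t (param k i)) :
    s = t := by
  have h1 : (s : ParamField g k →ₐ[k] ParamField g k) = t := algHom_paramField_ext h
  exact AlgEquiv.ext fun x => congrArg (fun w : ParamField g k →ₐ[k] ParamField g k => w x) h1

/-- `u ↦ (a_i ↦ u ^ (2 i) a_i)` as a homomorphism. -/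
def scaleAutHom (g : ℕ) (k : Type*) [Field k] : kˣ →* (ParamField g k ≃ₐ[k] ParamField g k) where
  toFun u := scaleAut g u
  map_one' := paramAut_ext fun i => by
    rw [scaleAut_X]
    simp
  map_mul' u v := paramAut_ext fun i => by
    rw [AlgEquiv.mul_apply, scaleAut_X, scaleAut_X, map_mul, scaleAut_X, AlgEquiv.commutes,
      ← mul_assoc, ← map_mul, Units.val_mul, mul_pow, mul_comm ((u : k) ^ _)]

theorem param_X_ne_zero (i : Fin g) :
    param k i ≠ 0 :=
  (map_ne_zero_iff _ (IsFractionRing.injective _ _)).2 (MvPolynomial.X_ne_zero i)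

/-- The first parameter is multiplied by `u²` and every other one by a power of `u²`. -/
theorem scaleAutHom_eq_one_iff (hg : 2 ≤ g) (u : kˣ) : scaleAutHom g k u = 1 ↔ u ^ 2 = 1 := by
  constructor
  · intro h
    have h1 := scaleAut_X u (⟨0, by omega⟩ : Fin g)
    have h2 : scaleAut g u = 1 := h
    rw [h2, AlgEquiv.one_apply] at h1
    have h3 := mul_right_cancel₀ (param_X_ne_zero _) ((one_mul _).trans h1)
    rw [← map_one (algebraMap k _)] at h3
    have h4 := (algebraMap k (ParamField g k)).injective h3
    apply Units.ext
    simpa using h4.symm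
  · intro h
    have h' : (u : k) ^ 2 = 1 := by
      have := congrArg Units.val h
      simpa using this
    refine paramAut_ext fun i => ?_
    change scaleAut g u _ = _
    rw [scaleAut_X, pow_mul, h', one_pow, map_one, one_mul, AlgEquiv.one_apply]

theorem swapAut_mul_self : swapAut g k * swapAut g k = 1 := paramAut_ext fun i => by
  rw [AlgEquiv.mul_apply, swapAut_X, swapAut_X, Fin.rev_rev, AlgEquiv.one_apply]

/-- For `g ≥ 2` the first and the last parameter differ, so a multiple of one cannot equal the
other. -/
theorem swapAut_mul_scaleAut_ne_one (hg : 2 ≤ g) (u : kˣ) :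
    swapAut g k * scaleAutHom g k u ≠ 1 := by
  intro h
  have hg' : 0 < g := by omega
  have h1 : (swapAut g k * scaleAut g u) (param k ⟨0, hg'⟩) =
      param k ⟨0, hg'⟩ :=
    congrArg (fun s : ParamField g k ≃ₐ[k] ParamField g k =>
      s (param k ⟨0, hg'⟩)) h
  rw [AlgEquiv.mul_apply, scaleAut_X, map_mul, AlgEquiv.commutes, swapAut_X, param, param,
    IsScalarTower.algebraMap_apply k (MvPolynomial (Fin g) k), ← map_mul] at h1
  have h2 := IsFractionRing.injective (MvPolynomial (Fin g) k) (ParamField g k) h1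
  have h3 := congrArg (MvPolynomial.eval fun j : Fin g => if (j : ℕ) = 0 then (1 : k) else 0) h2
  rw [map_mul, MvPolynomial.eval_X, MvPolynomial.eval_X, if_neg, if_pos rfl, mul_zero] at h3
  · exact zero_ne_one h3
  · rw [Fin.val_rev]
    simp only
    omega

/-- The exponents `2i` and `2(g+1-i)` add up to `2g+2`, so reversing the parameters inverts the
factors. -/
theorem swapAut_mul_scaleAut_mul_swapAut (u : kˣ) (hu : u ^ (2 * g + 2) = 1) :
    swapAut g k * scaleAutHom g k u * swapAut g k = (scaleAutHom g k u)⁻¹ := by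
  rw [← map_inv]
  refine paramAut_ext fun i => ?_
  change swapAut g k (scaleAut g u (swapAut g k _)) = scaleAut g u⁻¹ _
  rw [swapAut_X, scaleAut_X, map_mul, AlgEquiv.commutes, swapAut_X, Fin.rev_rev, scaleAut_X]
  congr 2
  rw [← Units.val_pow_eq_pow_val, ← Units.val_pow_eq_pow_val]
  congr 1
  rw [inv_pow, eq_inv_iff_mul_eq_one, ← pow_add, Fin.val_rev, ← hu]
  congr 1
  omega

end Groups


section Groups

variable {k : Type*} [Field k] {g : ℕ}

/-- The dihedral group of order `2 (2 g + 2)` as a group of changes of coordinate. -/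
def coordHom (ε : kˣ) (hε : IsPrimitiveRoot ε (2 * g + 2)) :
    DihedralGroup (2 * g + 2) →* Matrix.ProjGenLinGroup (Fin 2) k :=
  dihedralHom (2 * g + 2) (scaleHom k ε) (Matrix.ProjGenLinGroup.mk (swapGL k))
    (by rw [← map_pow, hε.pow_eq_one, map_one]) mk_swap_mul_self (swap_mul_scale_mul_swap ε)

theorem coordHom_r (ε : kˣ) (hε : IsPrimitiveRoot ε (2 * g + 2)) (i : ℤ) :
    coordHom ε hε (.r (i : ZMod _)) = scaleHom k (ε ^ i) :=
  (dihedralHom_r ..).trans (map_zpow _ _ _).symm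

theorem coordHom_sr (ε : kˣ) (hε : IsPrimitiveRoot ε (2 * g + 2)) (i : ℤ) :
    coordHom ε hε (.sr (i : ZMod _)) =
      Matrix.ProjGenLinGroup.mk (swapGL k) * scaleHom k (ε ^ i) :=
  (dihedralHom_sr ..).trans (by rw [map_zpow])

theorem coordHom_injective (ε : kˣ) (hε : IsPrimitiveRoot ε (2 * g + 2)) :
    Function.Injective (coordHom ε hε) := by
  apply dihedralHom_injective
  · intro i hi
    rw [← map_zpow, ← map_one (scaleHom k)] at hi
    exact (hε.zpow_eq_one_iff_dvd i).1 (scaleHom_injective hi)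
  · intro i hi
    rw [← map_zpow] at hi
    exact swap_mul_scale_ne_one _ hi

theorem coordHom_range (ε : kˣ) (hε : IsPrimitiveRoot ε (2 * g + 2)) :
    (coordHom ε hε).range = coordGroup ε :=
  dihedralHom_range ..

/-- The dihedral group of order `2 (2 g + 2)` acting on the parameters. -/
def paramHom (ε : kˣ) (hε : IsPrimitiveRoot ε (2 * g + 2)) :
    DihedralGroup (2 * g + 2) →* (ParamField g k ≃ₐ[k] ParamField g k) :=
  dihedralHom (2 * g + 2) (scaleAutHom g k ε) (swapAut g k)
    (by rw [← map_pow, hε.pow_eq_one, map_one]) swapAut_mul_self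
    (swapAut_mul_scaleAut_mul_swapAut ε hε.pow_eq_one)

theorem paramHom_r (ε : kˣ) (hε : IsPrimitiveRoot ε (2 * g + 2)) (i : ℤ) :
    paramHom ε hε (.r (i : ZMod _)) = scaleAutHom g k (ε ^ i) :=
  (dihedralHom_r ..).trans (map_zpow _ _ _).symm

theorem paramHom_sr (ε : kˣ) (hε : IsPrimitiveRoot ε (2 * g + 2)) (i : ℤ) :
    paramHom ε hε (.sr (i : ZMod _)) = swapAut g k * scaleAutHom g k (ε ^ i) :=
  (dihedralHom_sr ..).trans (by rw [map_zpow])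

theorem paramHom_range (ε : kˣ) (hε : IsPrimitiveRoot ε (2 * g + 2)) :
    (paramHom ε hε).range = dihedralAut g ε :=
  dihedralHom_range ..

theorem eq_one_or_eq_neg_one_of_sq (u : kˣ) (h : u ^ 2 = 1) : u = 1 ∨ u = -1 := by
  have h1 : (u : k) * u = 1 := by
    rw [← sq, ← Units.val_pow_eq_pow_val, h, Units.val_one]
  rcases mul_self_eq_one_iff.1 h1 with h2 | h2
  · exact Or.inl (Units.ext h2)
  · exact Or.inr (Units.ext h2)

/-- The changes of coordinate act on the parameters, with kernel generated by `X ↦ -X`. -/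
theorem exists_hom_coordGroup (hg : 2 ≤ g) (ε : kˣ) (hε : IsPrimitiveRoot ε (2 * g + 2)) :
    ∃ ρ : coordGroup ε →* dihedralAut g ε,
      Function.Surjective ρ ∧
      (ρ ⟨_, scale_mem ε⟩ : ParamField g k ≃ₐ[k] ParamField g k) = scaleAut g ε ∧
      (ρ ⟨_, swap_mem ε⟩ : ParamField g k ≃ₐ[k] ParamField g k) = swapAut g k ∧
      ρ.ker.map (coordGroup ε).subtype =
        Subgroup.zpowers (Matrix.ProjGenLinGroup.mk (scaleGL (-1 : kˣ))) := by
  -- Both groups are images of the dihedral group with rotation subgroup of order `2g+2`, faithfully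
  -- in the case of `coordGroup`; so `ρ` is `paramHom` composed with the inverse of `e`.
  let e : DihedralGroup (2 * g + 2) ≃* coordGroup ε :=
    (MonoidHom.ofInjective (coordHom_injective ε hε)).trans
      (MulEquiv.subgroupCongr (coordHom_range ε hε))
  have he : ∀ d, (e d : Matrix.ProjGenLinGroup (Fin 2) k) = coordHom ε hε d := fun d => rfl
  let ψ : DihedralGroup (2 * g + 2) →* dihedralAut g ε :=
    (paramHom ε hε).codRestrict _ fun d => paramHom_range ε hε ▸ ⟨d, rfl⟩
  have hψ : ∀ d, (ψ d : ParamField g k ≃ₐ[k] ParamField g k) = paramHom ε hε d := fun d => rfl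
  have hρ : ∀ d (x : coordGroup ε), (x : Matrix.ProjGenLinGroup (Fin 2) k) = coordHom ε hε d →
      e.symm x = d := by
    intro d x hx
    rw [MulEquiv.symm_apply_eq]
    exact Subtype.ext hx
  refine ⟨ψ.comp (e.symm : coordGroup ε →* _), ?_, ?_, ?_, ?_⟩
  · rintro ⟨s, hs⟩
    rw [← paramHom_range ε hε] at hs
    obtain ⟨d, rfl⟩ := hs
    refine ⟨e d, Subtype.ext ?_⟩
    change (ψ (e.symm (e d)) : ParamField g k ≃ₐ[k] ParamField g k) = _
    rw [MulEquiv.symm_apply_apply, hψ]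
  · change (ψ (e.symm _) : ParamField g k ≃ₐ[k] ParamField g k) = _
    rw [hρ (.r ((1 : ℤ) : ZMod _)) ⟨_, scale_mem ε⟩ (by rw [coordHom_r, zpow_one]; rfl), hψ,
      paramHom_r, zpow_one]
    rfl
  · change (ψ (e.symm _) : ParamField g k ≃ₐ[k] ParamField g k) = _
    rw [hρ (.sr ((0 : ℤ) : ZMod _)) ⟨_, swap_mem ε⟩
      (by rw [coordHom_sr, zpow_zero, map_one, mul_one]), hψ, paramHom_sr, zpow_zero, map_one,
      mul_one]
  · apply le_antisymm
    · rintro _ ⟨x, hx, rfl⟩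
      obtain ⟨d, rfl⟩ := e.surjective x
      have hd : paramHom ε hε d = 1 := by
        have h1 : ψ (e.symm (e d)) = 1 := hx
        rw [MulEquiv.symm_apply_apply] at h1
        rw [← hψ, h1]
        rfl
      rw [Subgroup.coe_subtype, he]
      rcases d with i | i
      · obtain ⟨j, rfl⟩ := ZMod.intCast_surjective i
        rw [paramHom_r, scaleAutHom_eq_one_iff hg] at hd
        rw [coordHom_r]
        rcases eq_one_or_eq_neg_one_of_sq _ hd with h | h
        · rw [h, map_one]
          exact one_mem _
        · rw [h]
          exact Subgroup.mem_zpowers _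
      · obtain ⟨j, rfl⟩ := ZMod.intCast_surjective i
        rw [paramHom_sr] at hd
        exact absurd hd (swapAut_mul_scaleAut_ne_one hg _)
    · rw [Subgroup.zpowers_le]
      -- The rotation in the kernel is the power `g+1` of the generator: primitivity excludes
      -- `ε^(g+1) = 1`.
      have hε2 : ε ^ ((g + 1 : ℕ) : ℤ) = -1 := by
        rw [zpow_natCast]
        refine (eq_one_or_eq_neg_one_of_sq _ ?_).resolve_left ?_
        · rw [← pow_mul, ← hε.pow_eq_one]
          congr 1
          ring
        · intro h
          have := Nat.le_of_dvd (by omega) ((hε.pow_eq_one_iff_dvd _).1 h)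
          omega
      refine ⟨e (.r (((g + 1 : ℕ) : ℤ) : ZMod _)), ?_, ?_⟩
      · change ψ (e.symm (e _)) = 1
        rw [MulEquiv.symm_apply_apply]
        apply Subtype.ext
        rw [hψ, paramHom_r, hε2]
        exact (scaleAutHom_eq_one_iff hg _).2 (by simp)
      · rw [Subgroup.coe_subtype, he, coordHom_r, hε2]
        rfl

/-- On the parameters `ε^i` acts trivially exactly when `2g+2` divides `2i`, so the rotation
subgroup is halved. -/
theorem nonempty_dihedralGroup_equiv (hg : 2 ≤ g) (ε : kˣ) (hε : IsPrimitiveRoot ε (2 * g + 2)) :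
    Nonempty (DihedralGroup (g + 1) ≃* dihedralAut g ε) := by
  have h1 : scaleAutHom g k ε ^ (g + 1) = 1 := by
    rw [← map_pow, scaleAutHom_eq_one_iff hg, ← pow_mul, ← hε.pow_eq_one]
    congr 1
    ring
  have hinj := dihedralHom_injective (g + 1) (scaleAutHom g k ε) (swapAut g k) h1 swapAut_mul_self
    (swapAut_mul_scaleAut_mul_swapAut ε hε.pow_eq_one) (fun i hi => by
      rw [← map_zpow, scaleAutHom_eq_one_iff hg, ← zpow_natCast, ← zpow_mul] at hi
      have := (hε.zpow_eq_one_iff_dvd _).1 hi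
      obtain ⟨c, hc⟩ := this
      refine ⟨c, ?_⟩
      push_cast at hc ⊢
      linarith) (fun i hi => by
      rw [← map_zpow] at hi
      exact swapAut_mul_scaleAut_ne_one hg _ hi)
  exact ⟨(MonoidHom.ofInjective hinj).trans (MulEquiv.subgroupCongr (dihedralHom_range ..))⟩

end Groups

/-! ### The changes of coordinate which preserve the normal form -/

/-- A scalar matrix multiplies a form of degree `2g+2` by the corresponding power. Thus the choice
of a representative in `GL₂` affects a form only by a constant. -/
theorem subst_eq_smul {k : Type*} [Field k] {g : ℕ} (M N : GL (Fin 2) k) (u : kˣ)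
    (h : (M : Matrix (Fin 2) (Fin 2) k) = (u : k) • (N : Matrix (Fin 2) (Fin 2) k))
    (c : Fin (2 * g + 3) → k) :
    subst M (toPoly c) = ((u ^ (2 * g + 2) : kˣ) : k) • subst N (toPoly c) := by
  have hM : M = Matrix.GeneralLinearGroup.scalar (Fin 2) u * N := by
    apply Units.ext
    rw [h, Units.val_mul, Matrix.GeneralLinearGroup.coe_scalar, Matrix.scalar_apply,
      ← Matrix.smul_eq_diagonal_mul]
  have h00 : Matrix.GeneralLinearGroup.scalar (Fin 2) u 0 0 = (u : k) := by simp
  have h11 : Matrix.GeneralLinearGroup.scalar (Fin 2) u 1 1 = (u : k) := by simp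
  rw [hM, subst_mul, subst_diagonal _ (by simp) (by simp), h00, h11, ← map_smul, ← toPoly_smul]
  congr 2
  funext j
  rw [← pow_add, Units.val_pow_eq_pow_val]
  congr 2
  omega

/-- Commuting in `PGL₂` means commuting up to a scalar `w`. If `w = 1`, the entries off the diagonal
vanish because `2 ≠ 0`; otherwise the diagonal entries vanish. -/
theorem diagonal_or_antidiagonal {k : Type*} [Field k] (h2 : (2 : k) ≠ 0) (M : GL (Fin 2) k)
    (h : Matrix.ProjGenLinGroup.mk M ∈
      Subgroup.centralizer {Matrix.ProjGenLinGroup.mk (scaleGL (-1 : kˣ))}) :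
    (M 0 1 = 0 ∧ M 1 0 = 0) ∨ (M 0 0 = 0 ∧ M 1 1 = 0) := by
  rw [Subgroup.mem_centralizer_singleton_iff, ← map_mul, ← map_mul, mk_eq_mk_iff] at h
  obtain ⟨w, hw⟩ := h
  rw [Units.val_mul, Units.val_mul, coe_scaleGL, Matrix.eta_fin_two (M : Matrix (Fin 2) (Fin 2) k),
    Matrix.mul_fin_two, Matrix.mul_fin_two] at hw
  have h00 := congrFun (congrFun hw 0) 0
  have h01 := congrFun (congrFun hw 0) 1
  have h10 := congrFun (congrFun hw 1) 0
  have h11 := congrFun (congrFun hw 1) 1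
  simp only [Units.val_neg, Units.val_one, mul_neg, mul_one, mul_zero, add_zero, zero_add, neg_mul,
    one_mul, zero_mul, Matrix.smul_apply, Matrix.of_apply, Matrix.cons_val', Matrix.cons_val_zero,
    Matrix.cons_val_one, Matrix.cons_val_fin_one, smul_eq_mul] at h00 h01 h10 h11
  by_cases hw1 : (w : k) = 1
  · rw [hw1] at h01 h10
    refine Or.inl ⟨(mul_eq_zero.1 ?_).resolve_left h2, (mul_eq_zero.1 ?_).resolve_left h2⟩
    · linear_combination h01
    · linear_combination -h10
  · have hw2 : (w : k) - 1 ≠ 0 := sub_ne_zero.2 hw1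
    refine Or.inr ⟨(mul_eq_zero.1 ?_).resolve_left hw2, (mul_eq_zero.1 ?_).resolve_left hw2⟩
    · linear_combination h00
    · linear_combination -h11

/-- In characteristic 2 the element `ε^(g+1)`, whose square is 1, would itself be 1. -/
theorem two_ne_zero_of_isPrimitiveRoot {k : Type*} [Field k] {g : ℕ} (ε : kˣ)
    (hε : IsPrimitiveRoot ε (2 * g + 2)) : (2 : k) ≠ 0 := by
  intro h2
  have h1 : ε ^ (g + 1) = 1 := by
    rcases eq_one_or_eq_neg_one_of_sq (ε ^ (g + 1)) (by
      rw [← pow_mul, ← hε.pow_eq_one]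
      congr 1
      ring) with h | h
    · exact h
    · rw [h]
      apply Units.ext
      rw [Units.val_neg, Units.val_one]
      linear_combination -h2
  have := Nat.le_of_dvd (by omega) ((hε.pow_eq_one_iff_dvd _).1 h1)
  omega

theorem natCast_ne_zero_of_isPrimitiveRoot {k : Type*} [Field k] {n : ℕ} (hn : n ≠ 0) (ε : kˣ)
    (hε : IsPrimitiveRoot ε n) : (n : k) ≠ 0 := by
  have : NeZero n := ⟨hn⟩
  exact (IsPrimitiveRoot.coe_units_iff.2 hε).neZero'.out

/-- The changes of coordinate commuting with `X ↦ -X` which preserve the normal form. -/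
theorem exists_subst_normalForm_iff {k : Type*} [Field k] {g : ℕ} (ε : kˣ)
    (hε : IsPrimitiveRoot ε (2 * g + 2)) (a : Fin g → k) (M : GL (Fin 2) k)
    (hM : Matrix.ProjGenLinGroup.mk M ∈
      Subgroup.centralizer {Matrix.ProjGenLinGroup.mk (scaleGL (-1 : kˣ))}) :
    (∃ (a' : Fin g → k) (c : kˣ),
      subst M (toPoly (normalForm a)) = (c : k) • toPoly (normalForm a')) ↔
        Matrix.ProjGenLinGroup.mk M ∈ coordGroup ε := by
  have hscale : ∀ u : kˣ, u ^ (2 * g + 2) = 1 → scaleHom k u ∈ coordGroup ε := by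
    intro u hu
    have : NeZero (2 * g + 2) := ⟨by omega⟩
    obtain ⟨i, -, hi⟩ := (IsPrimitiveRoot.coe_units_iff.2 hε).eq_pow_of_pow_eq_one (ξ := (u : k))
      (by rw [← Units.val_pow_eq_pow_val, hu, Units.val_one])
    have hi' : ε ^ i = u := Units.ext (by rw [Units.val_pow_eq_pow_val, hi])
    rw [← hi', map_pow]
    exact pow_mem (scale_mem ε) i
  have hdet := det_ne_zero_of_GL M
  constructor
  · rintro ⟨a', c, h⟩
    rw [← toPoly_smul] at h
    rcases diagonal_or_antidiagonal (two_ne_zero_of_isPrimitiveRoot ε hε) M hM with ⟨h01, h10⟩ | ⟨h00, h11⟩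
    · rw [subst_diagonal M h01 h10] at h
      -- The constant and the leading coefficient of both normal forms are 1, so `M₀₀` and `M₁₁`
      -- have the same power `2g+2`; their quotient is a power of `ε`. The antidiagonal case runs in
      -- parallel.
      have h1 := congrFun (toPoly_injective h) 0
      have h2 := congrFun (toPoly_injective h) (Fin.last _)
      simp only [normalForm_zero, normalForm_last, Fin.val_zero, Fin.val_last, pow_zero, one_mul,
        mul_one, Nat.sub_zero, Nat.sub_self] at h1 h2
      have ha0 : M 0 0 ≠ 0 := fun h0 => c.ne_zero (by rw [← h2, h0, zero_pow (by omega)])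
      have hd0 : M 1 1 ≠ 0 := fun h0 => c.ne_zero (by rw [← h1, h0, zero_pow (by omega)])
      have h3 : Matrix.ProjGenLinGroup.mk M = scaleHom k (Units.mk0 _ ha0 / Units.mk0 _ hd0) := by
        refine (mk_eq_mk_iff _ _).2 ⟨Units.mk0 _ hd0, ?_⟩
        rw [coe_scaleGL]
        ext i j
        fin_cases i <;> fin_cases j <;> simp [h01, h10]
        field_simp
      rw [h3]
      refine hscale _ ?_
      rw [div_pow, div_eq_one]
      apply Units.ext
      rw [Units.val_pow_eq_pow_val, Units.val_pow_eq_pow_val, Units.val_mk0, Units.val_mk0, h1, h2]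
    · rw [subst_antidiagonal M h00 h11] at h
      have h1 := congrFun (toPoly_injective h) 0
      have h2 := congrFun (toPoly_injective h) (Fin.last _)
      simp only [normalForm_zero, normalForm_last, Fin.val_zero, Fin.val_last, pow_zero, one_mul,
        mul_one, Nat.sub_zero, Nat.sub_self, Fin.rev_zero, Fin.rev_last] at h1 h2
      have hb0 : M 0 1 ≠ 0 := fun h0 => c.ne_zero (by rw [← h1, h0, zero_pow (by omega)])
      have hc0 : M 1 0 ≠ 0 := fun h0 => c.ne_zero (by rw [← h2, h0, zero_pow (by omega)])
      have h3 : Matrix.ProjGenLinGroup.mk M = scaleHom k (Units.mk0 _ hb0 / Units.mk0 _ hc0) *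
          Matrix.ProjGenLinGroup.mk (swapGL k) := by
        change _ = Matrix.ProjGenLinGroup.mk (scaleGL _) * _
        rw [← map_mul]
        refine (mk_eq_mk_iff _ _).2 ⟨Units.mk0 _ hc0, ?_⟩
        rw [Units.val_mul, coe_scaleGL, coe_swapGL, Matrix.mul_fin_two]
        ext i j
        fin_cases i <;> fin_cases j <;> simp [h00, h11]
        field_simp
      rw [h3]
      refine mul_mem (hscale _ ?_) (swap_mem ε)
      rw [div_pow, div_eq_one]
      apply Units.ext
      rw [Units.val_pow_eq_pow_val, Units.val_pow_eq_pow_val, Units.val_mk0, Units.val_mk0, h1, h2]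
  · intro h
    rw [← coordHom_range ε hε] at h
    have hpow : ∀ j : ℤ, ((ε ^ j : kˣ) : k) ^ (2 * g + 2) = 1 := by
      intro j
      rw [← Units.val_pow_eq_pow_val, ← zpow_natCast, ← zpow_mul, mul_comm, zpow_mul, zpow_natCast,
        hε.pow_eq_one, one_zpow, Units.val_one]
    obtain ⟨i | i, hi⟩ := h
    · obtain ⟨j, rfl⟩ := ZMod.intCast_surjective i
      rw [coordHom_r] at hi
      obtain ⟨u, hu⟩ := (mk_eq_mk_iff _ _).1 hi.symm
      refine ⟨fun i => ((ε ^ j : kˣ) : k) ^ (2 * ((i : ℕ) + 1)) * a i, u ^ (2 * g + 2), ?_⟩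
      rw [subst_eq_smul _ _ u hu, subst_scaleGL_normalForm _ (hpow j)]
    · obtain ⟨j, rfl⟩ := ZMod.intCast_surjective i
      rw [coordHom_sr] at hi
      change _ * Matrix.ProjGenLinGroup.mk (scaleGL _) = _ at hi
      rw [← map_mul] at hi
      obtain ⟨u, hu⟩ := (mk_eq_mk_iff _ _).1 hi.symm
      refine ⟨fun i => ((ε ^ j : kˣ) : k) ^ (2 * ((i : ℕ) + 1)) * a i.rev, u ^ (2 * g + 2), ?_⟩
      rw [subst_eq_smul _ _ u hu, subst_mul, subst_swapGL_normalForm, subst_scaleGL_normalForm _ (hpow j)]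


/-! ### Points in opposite pairs -/

/-- The indices `0, …, 2g+1` arranged in `g+1` pairs. -/
def pairIndex (g : ℕ) : Fin (2 * g + 2) ≃ Fin (g + 1) × Bool :=
  Fintype.equivOfCardEq (by simp; ring)

/-- The pair of an index. -/
def idx {g : ℕ} (p : Fin (2 * g + 2)) : Fin (g + 1) := (pairIndex g p).1

/-- The points `± b_i`. -/
def pts {R : Type*} [CommRing R] {g : ℕ} (b : Fin (g + 1) → R) (p : Fin (2 * g + 2)) : R :=
  if (pairIndex g p).2 then b (idx p) else -b (idx p)

/-- The involution which exchanges the members of each pair. -/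
def partner (g : ℕ) : Equiv.Perm (Fin (2 * g + 2)) :=
  ((pairIndex g).trans (Equiv.prodCongr (Equiv.refl _) Equiv.boolNot)).trans (pairIndex g).symm

section Pairs

variable {R : Type*} [CommRing R] {g : ℕ}

theorem idx_partner (p : Fin (2 * g + 2)) : idx (partner g p) = idx p := by
  simp [idx, partner]

theorem partner_ne (p : Fin (2 * g + 2)) : partner g p ≠ p := by
  intro h
  have h1 := congrArg (fun q => (pairIndex g q).2) h
  simp [partner] at h1

theorem eq_or_eq_partner {p r : Fin (2 * g + 2)} (h : idx r = idx p) : r = p ∨ r = partner g p := by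
  by_cases h1 : (pairIndex g r).2 = (pairIndex g p).2
  · exact Or.inl ((pairIndex g).injective (Prod.ext h h1))
  · refine Or.inr ((pairIndex g).injective (Prod.ext (h.trans (idx_partner p).symm) ?_))
    simp only [partner, Equiv.trans_apply, Equiv.apply_symm_apply, Equiv.prodCongr_apply,
      Prod.map_snd, Equiv.boolNot_apply]
    cases h3 : (pairIndex g r).2 <;> cases h4 : (pairIndex g p).2 <;> simp_all

theorem exists_idx_eq (i : Fin (g + 1)) : ∃ p : Fin (2 * g + 2), idx p = i :=
  ⟨(pairIndex g).symm (i, true), by simp [idx]⟩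

theorem pts_partner (b : Fin (g + 1) → R) (p : Fin (2 * g + 2)) :
    pts b (partner g p) = -pts b p := by
  rw [pts, pts, idx_partner]
  cases h : (pairIndex g p).2 <;> simp [partner, h]

theorem pts_eq_or (b : Fin (g + 1) → R) (p : Fin (2 * g + 2)) :
    pts b p = b (idx p) ∨ pts b p = -b (idx p) := by
  unfold pts
  split_ifs
  · exact Or.inl rfl
  · exact Or.inr rfl

theorem pts_sq (b : Fin (g + 1) → R) (p : Fin (2 * g + 2)) : pts b p ^ 2 = b (idx p) ^ 2 := by
  rcases pts_eq_or b p with h | h <;> rw [h]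
  ring

theorem pts_map {S : Type*} [CommRing S] (φ : R →+* S) (b : Fin (g + 1) → R)
    (p : Fin (2 * g + 2)) : φ (pts b p) = pts (fun i => φ (b i)) p := by
  unfold pts
  split_ifs <;> simp

theorem prod_pts {M : Type*} [CommMonoid M] (f : R → M) (b : Fin (g + 1) → R) :
    ∏ p, f (pts b p) = ∏ i, (f (b i) * f (-b i)) := by
  rw [← (pairIndex g).symm.prod_comp, Fintype.prod_prod_type]
  refine Finset.prod_congr rfl fun i _ => ?_
  simp [pts, idx]

end Pairs

/-! ### Permutations which preserve the cross ratios of all families of opposite points -/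

section Injective

variable {K : Type*} [Field K] {g : ℕ}

theorem pts_ne_zero {w : Fin (g + 1) → K} {p : Fin (2 * g + 2)} (hw : w (idx p) ≠ 0) :
    pts w p ≠ 0 := by
  rcases pts_eq_or w p with h | h <;> rw [h]
  · exact hw
  · exact neg_ne_zero.2 hw

theorem pts_injective (h2 : (2 : K) ≠ 0) {w : Fin (g + 1) → K} (hw : ∀ i, w i ≠ 0)
    (hw2 : Function.Injective fun i => w i ^ 2) : Function.Injective (pts w) := by
  intro p r h
  have h1 : idx p = idx r := hw2 (by simp only; rw [← pts_sq, ← pts_sq, h])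
  rcases eq_or_eq_partner h1 with h3 | h3
  · exact h3
  · rw [h3, pts_partner] at h
    have h4 : 2 * pts w r = 0 := by linear_combination -h
    exact absurd ((mul_eq_zero.1 h4).resolve_left h2) (pts_ne_zero (hw _))

/-- Supplies a specialization over `k` at which the points `± w_i` are distinct; it serves to refute
relations between generic roots. -/
theorem exists_sq_injective (k : Type*) [Field k] [IsAlgClosed k] (n : ℕ) :
    ∃ w : Fin n → k, (∀ i, w i ≠ 0) ∧ Function.Injective fun i => w i ^ 2 := by
  have : Infinite k := IsAlgClosed.instInfinite
  have hinf : ({0}ᶜ : Set k).Infinite := (Set.finite_singleton (0 : k)).infinite_compl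
  let s := hinf.natEmbedding
  have hs : ∀ i : Fin n, ∃ w : k, w ^ 2 = s i := fun i =>
    IsAlgClosed.exists_pow_nat_eq _ (by norm_num)
  choose w hw using hs
  refine ⟨w, fun i h => ?_, fun i j h => ?_⟩
  · have h1 : ((s i : ({0}ᶜ : Set k)) : k) ≠ 0 := (s i).2
    apply h1
    rw [← hw, h]
    ring
  · simp only [hw] at h
    exact Fin.ext (s.injective (Subtype.ext h))

theorem exists_third (hg : 2 ≤ g) (i j : Fin (g + 1)) : ∃ l, l ≠ i ∧ l ≠ j := by
  have h : ({i, j} : Finset (Fin (g + 1))).card < Fintype.card (Fin (g + 1)) := by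
    rw [Fintype.card_fin]
    exact lt_of_le_of_lt Finset.card_le_two (by omega)
  obtain ⟨l, hl⟩ := Finset.exists_mem_notMem_of_card_lt_card (s := {i, j}) (t := Finset.univ) h
  simp at hl
  exact ⟨l, hl.1, hl.2⟩

/-- A permutation preserves the cross ratios of the points `± v_i`, in the form of an identity
without denominators. -/
def PreservesCrossRatios (v : Fin (g + 1) → K) (π : Equiv.Perm (Fin (2 * g + 2))) : Prop :=
  ∀ p₀ p₁ p₂ p₃ : Fin (2 * g + 2), p₀ ≠ p₁ → p₀ ≠ p₂ → p₀ ≠ p₃ → p₁ ≠ p₂ → p₁ ≠ p₃ → p₂ ≠ p₃ →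
    (pts v p₀ - pts v p₁) * (pts v p₂ - pts v p₃) *
      ((pts v (π p₀) - pts v (π p₃)) * (pts v (π p₂) - pts v (π p₁))) =
    (pts v (π p₀) - pts v (π p₁)) * (pts v (π p₂) - pts v (π p₃)) *
      ((pts v p₀ - pts v p₃) * (pts v p₂ - pts v p₁))

theorem ne_of_idx_ne {p r : Fin (2 * g + 2)} (h : idx p ≠ idx r) : p ≠ r := fun h' => h (h' ▸ rfl)

/-- A permutation which preserves cross ratios of the points `± v_i` for all `v` preserves the
pairs. -/
theorem idx_perm_eq (hg : 2 ≤ g) (h2 : (2 : K) ≠ 0) {w : Fin (g + 1) → K} (hw : ∀ i, w i ≠ 0)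
    (hw2 : Function.Injective fun i => w i ^ 2) {π : Equiv.Perm (Fin (2 * g + 2))}
    (h : ∀ v : Fin (g + 1) → K, PreservesCrossRatios v π) (p : Fin (2 * g + 2)) :
    idx (π p) = idx p := by
  -- The specialization lets the two points of the pair of `p` collide at 0 and keeps all other
  -- points distinct and nonzero.
  set v := Function.update w (idx p) 0 with hv
  have hv0 : v (idx p) = 0 := Function.update_self ..
  have hv1 : ∀ i, i ≠ idx p → v i = w i := fun i hi => Function.update_of_ne hi ..
  have hp0 : ∀ r, idx r = idx p → pts v r = 0 := by
    intro r hr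
    rcases pts_eq_or v r with h | h <;> rw [h, hr, hv0]
    rw [neg_zero]
  have hr0 : ∀ r, idx r ≠ idx p → pts v r ≠ 0 := fun r hr =>
    pts_ne_zero (by rw [hv1 _ hr]; exact hw _)
  have hrt : ∀ r t, pts v r = pts v t → r ≠ t → idx r = idx p ∧ idx t = idx p := by
    intro r t hrt hne
    by_cases h1 : idx r = idx p
    · refine ⟨h1, ?_⟩
      by_contra h3
      exact hr0 t h3 (by rw [← hrt, hp0 r h1])
    · exfalso
      by_cases h3 : idx t = idx p
      · exact hr0 r h1 (by rw [hrt, hp0 t h3])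
      · have hsq := congrArg (· ^ 2) hrt
        simp only [pts_sq, hv1 _ h1, hv1 _ h3] at hsq
        have h4 := hw2 hsq
        rcases eq_or_eq_partner h4 with h5 | h5
        · exact hne h5
        · rw [h5, pts_partner] at hrt
          have h6 : 2 * pts v t = 0 := by linear_combination -hrt
          exact hr0 t h3 ((mul_eq_zero.1 h6).resolve_left h2)
  -- For the quadruple `p`, `partner p`, `r`, `t` the left side vanishes, so a difference on the
  -- right must vanish: either the image of the pair of `p`, or that of `r` and `t`, is the
  -- colliding pair.
  have key : ∀ r t, idx r ≠ idx p → idx t ≠ idx p → r ≠ t →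
      idx (π p) = idx p ∨ (idx (π r) = idx p ∧ idx (π t) = idx p) := by
    intro r t hr ht hne
    have hσ := idx_partner p
    have h1 := h v p (partner g p) r t (partner_ne p).symm (ne_of_idx_ne hr.symm)
      (ne_of_idx_ne ht.symm) (ne_of_idx_ne (by rw [hσ]; exact hr.symm))
      (ne_of_idx_ne (by rw [hσ]; exact ht.symm)) hne
    rw [hp0 p rfl, hp0 _ hσ, sub_self, zero_mul, zero_mul, eq_comm] at h1
    rcases mul_eq_zero.1 h1 with h3 | h3
    · rcases mul_eq_zero.1 h3 with h4 | h4
      · exact Or.inl (hrt _ _ (sub_eq_zero.1 h4) (π.injective.ne (partner_ne p).symm)).1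
      · exact Or.inr (hrt _ _ (sub_eq_zero.1 h4) (π.injective.ne hne))
    · rcases mul_eq_zero.1 h3 with h4 | h4
      · exact absurd (by simpa using h4) (hr0 t ht)
      · exact absurd (by simpa using h4) (hr0 r hr)
  obtain ⟨j, hj, -⟩ := exists_third hg (idx p) (idx p)
  obtain ⟨l, hl, hlj⟩ := exists_third hg (idx p) j
  obtain ⟨r, hr⟩ := exists_idx_eq j
  obtain ⟨t, ht⟩ := exists_idx_eq l
  by_contra hne
  have hrp : idx r ≠ idx p := by rw [hr]; exact hj
  have htp : idx t ≠ idx p := by rw [ht]; exact hl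
  have hrt' : idx r ≠ idx t := by rw [hr, ht]; exact hlj.symm
  -- If `p` left its pair, then `r`, `t` and `partner t` would all be mapped into that pair, which
  -- has only two members.
  have h1 := (key r t hrp htp (ne_of_idx_ne hrt')).resolve_left hne
  have h3 := (key r (partner g t) hrp (by rw [idx_partner]; exact htp)
    (ne_of_idx_ne (by rw [idx_partner]; exact hrt'))).resolve_left hne
  have h4 := (eq_or_eq_partner (h1.2.trans h1.1.symm)).resolve_left
    (π.injective.ne (ne_of_idx_ne hrt'.symm))
  have h5 := (eq_or_eq_partner (h3.2.trans h1.1.symm)).resolve_left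
    (π.injective.ne (ne_of_idx_ne (by rw [idx_partner]; exact hrt'.symm)))
  exact partner_ne t (π.injective (h5.trans h4.symm))

/-- A permutation which preserves cross ratios of the points `± v_i` for all `v` is the identity
or exchanges the members of each pair. -/
theorem eq_one_or_eq_partner (hg : 2 ≤ g) (h2 : (2 : K) ≠ 0) {w : Fin (g + 1) → K}
    (hw : ∀ i, w i ≠ 0) (hw2 : Function.Injective fun i => w i ^ 2)
    {π : Equiv.Perm (Fin (2 * g + 2))}
    (h : ∀ v : Fin (g + 1) → K, PreservesCrossRatios v π) : π = 1 ∨ π = partner g := by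
  have hidx := idx_perm_eq hg h2 hw hw2 h
  have hcase : ∀ p, π p = p ∨ π p = partner g p := fun p => eq_or_eq_partner (hidx p)
  have hσ : ∀ p, π (partner g p) = partner g (π p) := by
    intro p
    have h1 : idx (π (partner g p)) = idx (π p) := by rw [hidx, hidx, idx_partner]
    exact (eq_or_eq_partner h1).resolve_left (π.injective.ne (partner_ne p))
  have key : ∀ r t, idx r ≠ idx t → π r = r → π t = t := by
    intro r t hrt hr
    obtain ⟨l, hlr, hlt⟩ := exists_third hg (idx r) (idx t)
    obtain ⟨p, hp⟩ := exists_idx_eq l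
    have hpr : idx p ≠ idx r := by rw [hp]; exact hlr
    have hpt : idx p ≠ idx t := by rw [hp]; exact hlt
    -- The specialization moves the pair of `t` so that `t` collides with `r`. The cross ratio
    -- identity then forces the images of `r` and `t` to collide, which they would not if `r` were
    -- fixed and `t` exchanged with its partner.
    obtain ⟨e, he⟩ : ∃ e : K, pts (Function.update w (idx t) e) t = pts w r := by
      by_cases hs : (pairIndex g t).2
      · exact ⟨pts w r, by simp [pts, hs]⟩
      · exact ⟨-pts w r, by simp [pts, hs]⟩
    set v := Function.update w (idx t) e with hv
    have hv1 : ∀ q, idx q ≠ idx t → pts v q = pts w q := by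
      intro q hq
      simp only [pts, hv, Function.update_of_ne hq]
    have hinj := pts_injective h2 hw hw2
    have h1 := h v p (partner g p) r t (partner_ne p).symm (ne_of_idx_ne hpr) (ne_of_idx_ne hpt)
      (ne_of_idx_ne (by rw [idx_partner]; exact hpr)) (ne_of_idx_ne (by rw [idx_partner]; exact hpt))
      (ne_of_idx_ne hrt)
    have hvr : pts v r = pts v t := by rw [hv1 r hrt, he]
    rw [hvr, sub_self, mul_zero, zero_mul, eq_comm, hσ] at h1
    rcases hcase t with h3 | h3
    · exact h3
    exfalso
    have hne0 : pts v t ≠ 0 := by rw [← hvr, hv1 r hrt]; exact pts_ne_zero (hw _)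
    have hpv : pts v p ≠ 0 := by rw [hv1 p hpt]; exact pts_ne_zero (hw _)
    have e1 : pts v (π p) - pts v (partner g (π p)) ≠ 0 := by
      rw [pts_partner, sub_neg_eq_add, ← two_mul]
      refine mul_ne_zero h2 ?_
      rcases hcase p with h4 | h4 <;> rw [h4]
      · exact hpv
      · rw [pts_partner]
        exact neg_ne_zero.2 hpv
    have e2 : pts v (π r) - pts v (π t) ≠ 0 := by
      rw [hr, h3, pts_partner, hvr, sub_neg_eq_add, ← two_mul]
      exact mul_ne_zero h2 hne0
    have e3 : pts v p - pts v t ≠ 0 := by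
      rw [← hvr, hv1 p hpt, hv1 r hrt]
      exact sub_ne_zero.2 (hinj.ne (ne_of_idx_ne hpr))
    have e4 : pts v t - pts v (partner g p) ≠ 0 := by
      rw [← hvr, hv1 r hrt, hv1 _ (by rw [idx_partner]; exact hpt)]
      exact sub_ne_zero.2 (hinj.ne (ne_of_idx_ne (by rw [idx_partner]; exact hpr.symm)))
    exact mul_ne_zero (mul_ne_zero e1 e2) (mul_ne_zero e3 e4) h1
  by_cases h1 : ∃ p, π p = p
  · obtain ⟨p, hp⟩ := h1
    left
    ext1 r
    by_cases hr : idx p = idx r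
    · obtain ⟨l, hl, -⟩ := exists_third hg (idx p) (idx p)
      obtain ⟨t, ht⟩ := exists_idx_eq l
      exact key t r (by rw [ht, ← hr]; exact hl) (key p t (by rw [ht]; exact hl.symm) hp)
    · exact key p r hr hp
  · push Not at h1
    right
    ext1 r
    exact (hcase r).resolve_left (h1 r)

end Injective


/-! ### The roots of the generic normal form -/

/-- An even polynomial with leading coefficient and constant term `1` splits into factors
`X ∓ b_i`. -/
theorem exists_pts {Ω : Type*} [Field Ω] [IsAlgClosed Ω] {g : ℕ} (a : Fin g → Ω) :
    ∃ b : Fin (g + 1) → Ω, affinePoly (normalForm a) =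
      ∏ p, (Polynomial.X - Polynomial.C (pts b p)) := by
  obtain ⟨Q, hQ⟩ : ∃ Q, Q = Polynomial.contract 2 (affinePoly (normalForm a)) := ⟨_, rfl⟩
  have hodd : ∀ j : ℕ, j % 2 = 1 → (affinePoly (normalForm a)).coeff j = 0 := by
    intro j hj
    by_cases h : j < 2 * g + 3
    · exact (coeff_affinePoly _ ⟨j, h⟩).trans (normalForm_odd _ _ hj)
    · exact Polynomial.coeff_eq_zero_of_natDegree_lt
        (lt_of_le_of_lt (natDegree_affinePoly_le _) (by omega))
  have hexp : affinePoly (normalForm a) = Polynomial.expand Ω 2 Q := by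
    ext j
    rw [Polynomial.coeff_expand (by norm_num), hQ, Polynomial.coeff_contract (by norm_num)]
    split_ifs with h
    · rw [Nat.div_mul_cancel h]
    · exact hodd j (by omega)
  have hlast : (affinePoly (normalForm a)).coeff (2 * g + 2) = 1 :=
    (coeff_affinePoly _ (Fin.last _)).trans (normalForm_last a)
  have hdeg : (affinePoly (normalForm a)).natDegree = 2 * g + 2 :=
    le_antisymm (natDegree_affinePoly_le _)
      (Polynomial.le_natDegree_of_ne_zero (by rw [hlast]; exact one_ne_zero))
  have hQdeg : Q.natDegree = g + 1 := by
    rw [hexp, Polynomial.natDegree_expand] at hdeg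
    omega
  have hQmonic : Q.Monic := by
    rw [Polynomial.Monic, Polynomial.leadingCoeff, hQdeg, hQ,
      Polynomial.coeff_contract (by norm_num)]
    convert hlast using 2
    ring
  have hsplit := IsAlgClosed.splits Q
  have hcard : Q.roots.card = g + 1 := by rw [← hQdeg, hsplit.natDegree_eq_card_roots]
  obtain ⟨s, hs⟩ : ∃ s : Fin (g + 1) → Ω, Multiset.map s Finset.univ.val = Q.roots := by
    refine ⟨fun i => Q.roots.toList.get (i.cast (by rw [Multiset.length_toList, hcard])), ?_⟩
    have h1 : (List.ofFn fun i : Fin (g + 1) =>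
        Q.roots.toList.get (i.cast (by rw [Multiset.length_toList, hcard]))) = Q.roots.toList := by
      apply List.ext_get
      · simp [hcard]
      · intro n h1 h2
        simp only [List.get_eq_getElem, List.getElem_ofFn, Fin.val_cast]
    rw [Fin.univ_val_map, h1, Multiset.coe_toList]
  have hb : ∀ i, ∃ b : Ω, b ^ 2 = s i := fun i => IsAlgClosed.exists_pow_nat_eq _ (by norm_num)
  choose b hb using hb
  refine ⟨b, ?_⟩
  rw [hexp, prod_pts (fun x => Polynomial.X - Polynomial.C x), hsplit.eq_prod_roots_of_monic hQmonic,
    ← hs, Multiset.map_map]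
  change Polynomial.expand Ω 2 (∏ i, (Polynomial.X - Polynomial.C (s i))) = _
  rw [map_prod]
  refine Finset.prod_congr rfl fun i _ => ?_
  rw [map_sub, Polynomial.expand_X, Polynomial.expand_C, ← hb, map_pow, map_neg]
  ring

/-! ### The generic normal form over an algebraic closure of the field of parameters -/

section Generic

variable {k : Type*} [Field k] {g : ℕ}

/-- An algebraic closure of `k(a_1, …, a_g)`. -/
abbrev ParamClosure (g : ℕ) (k : Type*) [Field k] : Type _ := AlgebraicClosure (ParamField g k)

/-- The parameter `a_(i+1)` as an element of the algebraic closure. -/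
def gparam (k : Type*) [Field k] {g : ℕ} (i : Fin g) : ParamClosure g k :=
  algebraMap (ParamField g k) _ (param k i)

theorem algebraicIndependent_gparam : AlgebraicIndependent k (gparam k : Fin g → _) := by
  have h1 := MvPolynomial.algebraicIndependent_X (Fin g) k
  have h2 := h1.map' (f := IsScalarTower.toAlgHom k (MvPolynomial (Fin g) k) (ParamField g k))
    (IsFractionRing.injective _ _)
  exact h2.map' (f := IsScalarTower.toAlgHom k (ParamField g k) (ParamClosure g k))
    (algebraMap (ParamField g k) _).injective

/-- A subfield which contains the parameters contains the rational functions in them. -/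
theorem algebraMap_mem_of_gparam_mem {F : Type*} [Field F] [Algebra k F]
    [Algebra F (ParamClosure g k)] [IsScalarTower k F (ParamClosure g k)]
    (A : IntermediateField F (ParamClosure g k)) (h : ∀ i, gparam k i ∈ A) (z : ParamField g k) :
    algebraMap _ (ParamClosure g k) z ∈ A := by
  obtain ⟨u, v, -, rfl⟩ := IsFractionRing.div_surjective (A := MvPolynomial (Fin g) k) z
  have hmem : ∀ u : MvPolynomial (Fin g) k,
      algebraMap (ParamField g k) (ParamClosure g k) (algebraMap _ _ u) ∈ A := by
    intro u
    induction u using MvPolynomial.induction_on with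
    | C c =>
      have h1 : algebraMap (ParamField g k) (ParamClosure g k)
          (algebraMap (MvPolynomial (Fin g) k) _ (MvPolynomial.C c)) =
          algebraMap F (ParamClosure g k) (algebraMap k F c) := by
        rw [← IsScalarTower.algebraMap_apply k F,
          IsScalarTower.algebraMap_apply k (ParamField g k) (ParamClosure g k),
          IsScalarTower.algebraMap_apply k (MvPolynomial (Fin g) k) (ParamField g k)]
        rfl
      rw [h1]
      exact A.algebraMap_mem _
    | add p q hp hq =>
      rw [map_add, map_add]
      exact add_mem hp hq
    | mul_X p i hp =>
      rw [map_mul, map_mul]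
      exact mul_mem hp (h i)
  rw [map_div₀]
  exact div_mem (hmem u) (hmem v)

/-- The algebraic closure is algebraic over every subfield over which the parameters are. -/
theorem isAlgebraic_of_gparam {F : Type*} [Field F] [Algebra k F]
    [Algebra F (ParamClosure g k)] [IsScalarTower k F (ParamClosure g k)]
    (h : ∀ i : Fin g, IsAlgebraic F (gparam k i)) : Algebra.IsAlgebraic F (ParamClosure g k) := by
  refine ⟨fun ω => ?_⟩
  have hmem := algebraMap_mem_of_gparam_mem (algebraicClosure F (ParamClosure g k))
    (fun i => mem_algebraicClosure_iff.2 (h i))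
  let φ : ParamField g k →+* algebraicClosure F (ParamClosure g k) :=
    (algebraMap (ParamField g k) (ParamClosure g k)).codRestrict _ hmem
  have h1 : IsAlgebraic (ParamField g k) ω := Algebra.IsAlgebraic.isAlgebraic ω
  obtain ⟨P, hP0, hP⟩ := h1
  have h2 : IsAlgebraic (algebraicClosure F (ParamClosure g k)) ω := by
    refine ⟨P.map φ, (Polynomial.map_ne_zero_iff φ.injective).2 hP0, ?_⟩
    rw [Polynomial.aeval_def, Polynomial.eval₂_map]
    exact hP
  have h3 : ω ∈ algebraicClosure (algebraicClosure F (ParamClosure g k)) (ParamClosure g k) :=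
    mem_algebraicClosure_iff.2 h2
  rw [algebraicClosure.algebraicClosure_eq_bot] at h3
  obtain ⟨x, hx⟩ := IntermediateField.mem_bot.1 h3
  rw [← hx]
  exact mem_algebraicClosure_iff.1 x.2

/-- The coefficients of a product of linear factors lie in the field of the roots. -/
theorem coeff_prod_X_sub_C_mem {F Ω : Type*} [Field F] [Field Ω] [Algebra F Ω]
    (A : IntermediateField F Ω) {ι : Type*} [Fintype ι] (s : ι → Ω) (hs : ∀ i, s i ∈ A) (j : ℕ) :
    (∏ i, (Polynomial.X - Polynomial.C (s i))).coeff j ∈ A := by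
  have h : ∏ i, (Polynomial.X - Polynomial.C (s i)) =
      (∏ i, (Polynomial.X - Polynomial.C (⟨s i, hs i⟩ : A))).map (algebraMap A Ω) := by
    rw [Polynomial.map_prod]
    refine Finset.prod_congr rfl fun i _ => ?_
    simp
  rw [h, Polynomial.coeff_map]
  exact Subtype.prop _

theorem gparam_mem_of_pts {F : Type*} [Field F] [Algebra F (ParamClosure g k)]
    (A : IntermediateField F (ParamClosure g k)) {b : Fin (g + 1) → ParamClosure g k}
    (hb : affinePoly (normalForm (gparam k)) = ∏ p, (Polynomial.X - Polynomial.C (pts b p)))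
    (h : ∀ i, b i ∈ A) (i : Fin g) : gparam k i ∈ A := by
  have h1 := (coeff_affinePoly (normalForm (gparam k)) ⟨2 * (i + 1), by omega⟩).trans
    (normalForm_middle _ i)
  rw [← h1, hb]
  refine coeff_prod_X_sub_C_mem A _ (fun p => ?_) _
  rcases pts_eq_or b p with h2 | h2 <;> rw [h2]
  · exact h _
  · exact neg_mem (h _)

/-- This is the constant term 1 of the normal form. The normalization ties the common scale of the
roots to their ratios. -/
theorem prod_sq_of_pts {Ω : Type*} [Field Ω] {a : Fin g → Ω} {b : Fin (g + 1) → Ω}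
    (hb : affinePoly (normalForm a) = ∏ p, (Polynomial.X - Polynomial.C (pts b p))) :
    (∏ i, b i) ^ 2 = (-1) ^ (g + 1) := by
  have h1 := congrArg (Polynomial.eval 0) hb
  rw [← Polynomial.coeff_zero_eq_eval_zero] at h1
  have h2 : (affinePoly (normalForm a)).coeff 0 = 1 :=
    (coeff_affinePoly _ 0).trans (normalForm_zero a)
  rw [h2, prod_pts (fun x => Polynomial.X - Polynomial.C x), Polynomial.eval_prod] at h1
  have h3 : ∀ i, Polynomial.eval 0 ((Polynomial.X - Polynomial.C (b i)) *
      (Polynomial.X - Polynomial.C (-b i))) = -1 * b i ^ 2 := by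
    intro i
    simp
    ring
  simp only [h3, Finset.prod_mul_distrib, Finset.prod_const, Finset.card_univ, Fintype.card_fin,
    Finset.prod_pow] at h1
  have h4 : ((-1 : Ω) ^ (g + 1)) * (-1) ^ (g + 1) = 1 := by
    rw [← mul_pow]
    simp
  linear_combination (-1) ^ (g + 1) * (-h1) - (∏ i, b i) ^ 2 * h4

theorem ne_zero_of_pts {Ω : Type*} [Field Ω] {a : Fin g → Ω} {b : Fin (g + 1) → Ω}
    (hb : affinePoly (normalForm a) = ∏ p, (Polynomial.X - Polynomial.C (pts b p)))
    (i : Fin (g + 1)) : b i ≠ 0 := by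
  intro h
  have h1 := prod_sq_of_pts hb
  rw [Finset.prod_eq_zero (Finset.mem_univ i) h] at h1
  exact pow_ne_zero (g + 1) (neg_ne_zero.2 one_ne_zero) (h1.symm.trans (by ring))

/-- The power of the last root in terms of the ratios of the roots. -/
theorem pow_last_mul {Ω : Type*} [Field Ω] {a : Fin g → Ω} {b : Fin (g + 1) → Ω}
    (hb : affinePoly (normalForm a) = ∏ p, (Polynomial.X - Polynomial.C (pts b p)))
    (j : Fin (g + 1)) :
    b j ^ (2 * g + 2) = (-1) ^ (g + 1) * (∏ i, (b i / b j) ^ 2)⁻¹ := by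
  have h0 := ne_zero_of_pts hb j
  have h1 := prod_sq_of_pts hb
  have h2 : (∏ i, b i) ≠ 0 := Finset.prod_ne_zero_iff.2 fun i _ => ne_zero_of_pts hb i
  rw [Finset.prod_pow, Finset.prod_div_distrib, Finset.prod_const, Finset.card_univ,
    Fintype.card_fin, ← h1, div_pow, inv_div, mul_div_cancel₀]
  · ring
  · exact pow_ne_zero 2 h2

open IntermediateField.algebraAdjoinAdjoin in
/-- The ratios of the roots of the generic normal form are algebraically independent. -/
theorem algebraicIndependent_ratios {b : Fin (g + 1) → ParamClosure g k}
    (hb : affinePoly (normalForm (gparam k)) = ∏ p, (Polynomial.X - Polynomial.C (pts b p))) :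
    AlgebraicIndependent k fun i : Fin g => b i.castSucc / b (Fin.last g) := by
  set ρ : Fin g → ParamClosure g k := fun i => b i.castSucc / b (Fin.last g) with hρ
  -- The power `2g+2` of the last root is a rational function of the ratios; hence the last root,
  -- then all roots, then all parameters are algebraic over the field of the ratios.
  have hF : Algebra.IsAlgebraic (IntermediateField.adjoin k (Set.range ρ)) (ParamClosure g k) := by
    apply isAlgebraic_of_gparam
    intro i
    have hratio : ∀ i, b i / b (Fin.last g) ∈ IntermediateField.adjoin k (Set.range ρ) := by
      intro i
      refine Fin.lastCases ?_ (fun i => ?_) i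
      · rw [div_self (ne_zero_of_pts hb _)]
        exact one_mem _
      · exact IntermediateField.subset_adjoin _ _ ⟨i, rfl⟩
    have hlast : b (Fin.last g) ∈
        algebraicClosure (IntermediateField.adjoin k (Set.range ρ)) (ParamClosure g k) := by
      rw [mem_algebraicClosure_iff]
      apply IsAlgebraic.of_pow (n := 2 * g + 2) (by omega)
      have hmem : b (Fin.last g) ^ (2 * g + 2) ∈ IntermediateField.adjoin k (Set.range ρ) := by
        rw [pow_last_mul hb]
        exact mul_mem (pow_mem (neg_mem (one_mem _)) _)
          (inv_mem (prod_mem fun i _ => pow_mem (hratio i) 2))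
      exact isAlgebraic_algebraMap (⟨_, hmem⟩ : IntermediateField.adjoin k (Set.range ρ))
    refine mem_algebraicClosure_iff.1 (gparam_mem_of_pts _ hb (fun i => ?_) i)
    rw [← div_mul_cancel₀ (b i) (ne_zero_of_pts hb (Fin.last g))]
    refine mul_mem ?_ hlast
    exact (algebraicClosure (IntermediateField.adjoin k (Set.range ρ))
      (ParamClosure g k)).algebraMap_mem ⟨_, hratio i⟩
  have hF' : Algebra.IsAlgebraic (Algebra.adjoin k (Set.range ρ)) (ParamClosure g k) :=
    (IsFractionRing.comap_isAlgebraic_iff (A := Algebra.adjoin k (Set.range ρ))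
      (K := IntermediateField.adjoin k (Set.range ρ))).2 hF
  -- The `g` ratios generate a field over which everything is algebraic, while the transcendence
  -- degree is at least `g`; so they are independent.
  refine (Algebra.IsAlgebraic.isTranscendenceBasis_of_lift_le_trdeg_of_finite k ρ ?_).1
  exact algebraicIndependent_gparam.lift_cardinalMk_le_trdeg

theorem aeval_mul_of_isHomogeneous {A σ : Type*} [CommRing A] [Algebra k A] [Fintype σ]
    {H : MvPolynomial σ k} {d : ℕ} (hH : H.IsHomogeneous d) (c : A) (x : σ → A) :
    MvPolynomial.aeval (fun i => c * x i) H = c ^ d * MvPolynomial.aeval x H := by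
  rw [MvPolynomial.aeval_def, MvPolynomial.aeval_def, MvPolynomial.eval₂_eq',
    MvPolynomial.eval₂_eq', Finset.mul_sum]
  refine Finset.sum_congr rfl fun e he => ?_
  have h1 : ∑ i, e i = d := by
    have h2 := hH (MvPolynomial.mem_support_iff.1 he)
    rw [Finsupp.weight_apply, Finsupp.sum_fintype _ _ (by simp)] at h2
    simpa using h2
  simp only [mul_pow, Finset.prod_mul_distrib, Finset.prod_pow_eq_pow_sum, h1]
  ring

/-- The roots of the generic normal form satisfy no homogeneous relation. -/
theorem eq_zero_of_aeval_roots_eq_zero [Infinite k] {b : Fin (g + 1) → ParamClosure g k}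
    (hb : affinePoly (normalForm (gparam k)) = ∏ p, (Polynomial.X - Polynomial.C (pts b p)))
    {H : MvPolynomial (Fin (g + 1)) k} {d : ℕ} (hH : H.IsHomogeneous d)
    (h : MvPolynomial.aeval b H = 0) : H = 0 := by
  have h0 := ne_zero_of_pts hb (Fin.last g)
  let D : MvPolynomial (Fin g) k := MvPolynomial.aeval
    (Fin.snoc (α := fun _ => MvPolynomial (Fin g) k) MvPolynomial.X 1) H
  have hD : D = 0 := by
    apply (algebraicIndependent_ratios hb).eq_zero_of_aeval_eq_zero
    rw [MvPolynomial.comp_aeval_apply]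
    have h1 : b = fun i => b (Fin.last g) * (b i / b (Fin.last g)) := by
      funext i
      rw [mul_div_cancel₀ _ h0]
    rw [h1, aeval_mul_of_isHomogeneous hH] at h
    refine Eq.trans (congrArg (fun x => MvPolynomial.aeval x H) (funext fun i => ?_))
      ((mul_eq_zero.1 h).resolve_left (pow_ne_zero d h0))
    refine Fin.lastCases ?_ (fun i => ?_) i
    · rw [Fin.snoc_last, map_one, div_self h0]
    · rw [Fin.snoc_castSucc, MvPolynomial.aeval_X]
  -- Dehomogenizing determines `H` only where the last coordinate is nonzero; the extra factor takes
  -- care of the other points.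
  have h2 : H * MvPolynomial.X (Fin.last g) = 0 := by
    apply MvPolynomial.funext
    intro v
    rw [map_mul, MvPolynomial.eval_X, map_zero]
    by_cases hv : v (Fin.last g) = 0
    · rw [hv, mul_zero]
    have h3 : MvPolynomial.aeval (fun i => v i / v (Fin.last g)) H = (0 : k) := by
      have h4 := congrArg (MvPolynomial.aeval fun i : Fin g => v i.castSucc / v (Fin.last g)) hD
      rw [MvPolynomial.comp_aeval_apply, map_zero] at h4
      convert h4 using 3
      funext i
      refine Fin.lastCases ?_ (fun i => ?_) i
      · rw [Fin.snoc_last, map_one, div_self hv]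
      · rw [Fin.snoc_castSucc, MvPolynomial.aeval_X]
    have h5 := aeval_mul_of_isHomogeneous hH (v (Fin.last g)) (fun i => v i / v (Fin.last g))
    rw [h3, mul_zero] at h5
    simp only [mul_div_cancel₀ _ hv] at h5
    rw [show MvPolynomial.eval v H = 0 from h5, zero_mul]
  exact (mul_eq_zero.1 h2).resolve_right (MvPolynomial.X_ne_zero _)

end Generic


/-! ### Cross ratios of the roots of the generic normal form -/

section AffineRoots

variable {R K : Type*} [CommRing R] [Field K] {n g : ℕ}

/-- The root vectors `(x_i, 1)`. -/
def affineRoots (x : Fin n → R) : Fin n → Fin 2 → R := fun i => ![x i, 1]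

theorem bracket_affineRoots (x : Fin n → R) (i j : Fin n) :
    bracket (affineRoots x) i j = x i - x j := by
  simp [bracket, affineRoots]

theorem rootPoly_affineRoots (x : Fin n → R) :
    rootPoly (affineRoots x) = ∏ i, (Polynomial.X - Polynomial.C (x i)) := by
  simp [rootPoly, affineRoots]

theorem rootForm_affineRoots {x : Fin (2 * g + 2) → R} {c : Fin (2 * g + 3) → R}
    (h : affinePoly c = ∏ p, (Polynomial.X - Polynomial.C (x p))) : rootForm (affineRoots x) = c :=
  affinePoly_injective (by rw [affinePoly_rootForm, rootPoly_affineRoots, h])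

theorem bracketProd_affineRoots_ne_zero {x : Fin n → K} (hx : Function.Injective x) :
    bracketProd (affineRoots x) ≠ 0 := by
  rw [bracketProd_ne_zero_iff]
  intro i j hij
  rw [bracket_affineRoots]
  exact sub_ne_zero.2 (hx.ne hij)

theorem crossRatio_affineRoots (x : Fin n → K) (q : Fin 4 ↪ Fin n) :
    crossRatio (affineRoots x) q =
      (x (q 0) - x (q 1)) * (x (q 2) - x (q 3)) / ((x (q 0) - x (q 3)) * (x (q 2) - x (q 1))) := by
  simp only [crossRatio, bracket_affineRoots]

/-- Equality of cross ratios without denominators. -/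
theorem crossRatio_affineRoots_eq_iff {x y : Fin n → K} (hx : Function.Injective x)
    (hy : Function.Injective y) (q : Fin 4 ↪ Fin n) :
    crossRatio (affineRoots x) q = crossRatio (affineRoots y) q ↔
      (x (q 0) - x (q 1)) * (x (q 2) - x (q 3)) * ((y (q 0) - y (q 3)) * (y (q 2) - y (q 1))) =
      (y (q 0) - y (q 1)) * (y (q 2) - y (q 3)) * ((x (q 0) - x (q 3)) * (x (q 2) - x (q 1))) := by
  have h : ∀ {z : Fin n → K}, Function.Injective z →
      (z (q 0) - z (q 3)) * (z (q 2) - z (q 1)) ≠ 0 := fun {z} hz =>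
    mul_ne_zero (sub_ne_zero.2 (hz.ne (q.injective.ne (by decide))))
      (sub_ne_zero.2 (hz.ne (q.injective.ne (by decide))))
  rw [crossRatio_affineRoots, crossRatio_affineRoots, div_eq_div_iff (h hx) (h hy)]

/-- The embedding of four distinct indices. -/
def quad (p₀ p₁ p₂ p₃ : Fin n) (h01 : p₀ ≠ p₁) (h02 : p₀ ≠ p₂) (h03 : p₀ ≠ p₃) (h12 : p₁ ≠ p₂)
    (h13 : p₁ ≠ p₃) (h23 : p₂ ≠ p₃) : Fin 4 ↪ Fin n :=
  ⟨![p₀, p₁, p₂, p₃], by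
    intro i j h
    fin_cases i <;> fin_cases j <;> simp_all⟩

end AffineRoots

section Relations

variable {k : Type*} [Field k] {g : ℕ} {b : Fin (g + 1) → ParamClosure g k}

theorem aeval_pts {A : Type*} [CommRing A] [Algebra k A] (b : Fin (g + 1) → A)
    (p : Fin (2 * g + 2)) :
    MvPolynomial.aeval b (pts (MvPolynomial.X : _ → MvPolynomial (Fin (g + 1)) k) p) = pts b p := by
  have h := pts_map (MvPolynomial.aeval (R := k) b).toRingHom MvPolynomial.X p
  simpa using h

theorem eval_pts (v : Fin (g + 1) → k) (p : Fin (2 * g + 2)) :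
    MvPolynomial.eval v (pts (MvPolynomial.X : _ → MvPolynomial (Fin (g + 1)) k) p) = pts v p :=
  aeval_pts v p

theorem isHomogeneous_pts (p : Fin (2 * g + 2)) :
    (pts (MvPolynomial.X : _ → MvPolynomial (Fin (g + 1)) k) p).IsHomogeneous 1 := by
  rcases pts_eq_or (MvPolynomial.X : _ → MvPolynomial (Fin (g + 1)) k) p with h | h <;> rw [h]
  · exact MvPolynomial.isHomogeneous_X ..
  · exact (MvPolynomial.isHomogeneous_X ..).neg

/-- A coincidence would be a linear relation between the roots, hence an identity, and it fails at a
point with distinct `± w_i`. -/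
theorem pts_generic_injective [IsAlgClosed k] (h2 : (2 : k) ≠ 0)
    (hb : affinePoly (normalForm (gparam k)) = ∏ p, (Polynomial.X - Polynomial.C (pts b p))) :
    Function.Injective (pts b) := by
  have : Infinite k := IsAlgClosed.instInfinite
  intro p r h
  obtain ⟨w, hw, hw2⟩ := exists_sq_injective k (g + 1)
  apply pts_injective h2 hw hw2
  have h1 := eq_zero_of_aeval_roots_eq_zero hb
    ((isHomogeneous_pts (k := k) p).sub (isHomogeneous_pts r))
    (by rw [map_sub, aeval_pts, aeval_pts, h, sub_self])
  have h3 := congrArg (MvPolynomial.eval w) h1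
  rw [map_sub, eval_pts, eval_pts, map_zero] at h3
  exact sub_eq_zero.1 h3

/-- Only the identity and the exchange of all the pairs preserve the cross ratios of the generic
roots. -/
theorem eq_one_or_eq_partner_of_crossRatio [IsAlgClosed k] (hg : 2 ≤ g) (h2 : (2 : k) ≠ 0)
    (hb : affinePoly (normalForm (gparam k)) = ∏ p, (Polynomial.X - Polynomial.C (pts b p)))
    {π : Equiv.Perm (Fin (2 * g + 2))}
    (h : ∀ q, crossRatio (affineRoots fun p => pts b (π p)) q =
      crossRatio (affineRoots (pts b)) q) : π = 1 ∨ π = partner g := by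
  have : Infinite k := IsAlgClosed.instInfinite
  have hinj := pts_generic_injective h2 hb
  obtain ⟨w, hw, hw2⟩ := exists_sq_injective k (g + 1)
  refine eq_one_or_eq_partner hg h2 hw hw2 fun v p₀ p₁ p₂ p₃ h01 h02 h03 h12 h13 h23 => ?_
  have h1 := (crossRatio_affineRoots_eq_iff (hinj.comp π.injective) hinj _).1
    (h (quad p₀ p₁ p₂ p₃ h01 h02 h03 h12 h13 h23))
  change (pts b (π p₀) - pts b (π p₁)) * (pts b (π p₂) - pts b (π p₃)) *
    ((pts b p₀ - pts b p₃) * (pts b p₂ - pts b p₁)) =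
    (pts b p₀ - pts b p₁) * (pts b p₂ - pts b p₃) *
    ((pts b (π p₀) - pts b (π p₃)) * (pts b (π p₂) - pts b (π p₁))) at h1
  let X := pts (MvPolynomial.X : _ → MvPolynomial (Fin (g + 1)) k)
  have hX : ∀ p r, (X p - X r).IsHomogeneous 1 := fun p r =>
    (isHomogeneous_pts p).sub (isHomogeneous_pts r)
  -- With denominators cleared, the equality of cross ratios is a homogeneous relation of degree 4
  -- between the roots. It therefore holds at every specialization, including those where points
  -- collide.
  have hH : ((X p₀ - X p₁) * (X p₂ - X p₃) * ((X (π p₀) - X (π p₃)) * (X (π p₂) - X (π p₁))) -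
      (X (π p₀) - X (π p₁)) * (X (π p₂) - X (π p₃)) *
        ((X p₀ - X p₃) * (X p₂ - X p₁))).IsHomogeneous 4 :=
    (((hX _ _).mul (hX _ _)).mul ((hX _ _).mul (hX _ _))).sub
      (((hX _ _).mul (hX _ _)).mul ((hX _ _).mul (hX _ _)))
  have h3 := congrArg (MvPolynomial.eval v) (eq_zero_of_aeval_roots_eq_zero hb hH (by
    simp only [X, map_sub, map_mul, aeval_pts]
    rw [h1, sub_self]))
  simp only [X, map_sub, map_mul, eval_pts, map_zero] at h3
  exact sub_eq_zero.1 h3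

end Relations

/-! ### Fields of definition -/

section Field

/-- A polynomial over an extension whose values at sufficiently many points of the base lie in an
intermediate field has coefficients in this field. -/
theorem exists_map_eq_of_eval_mem {k Ω : Type*} [Field k] [Infinite k] [Field Ω] [Algebra k Ω]
    (L : IntermediateField k Ω) (P : Polynomial Ω)
    (h : ∀ T : k, P.eval (algebraMap k Ω T) ∈ L) : ∃ Q : Polynomial L, Q.map (algebraMap L Ω) = P := by
  classical
  obtain ⟨s, hs⟩ := Infinite.exists_subset_card_eq k (P.natDegree + 1)
  let Q : Polynomial L := Lagrange.interpolate s (fun T => algebraMap k L T)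
    (fun T => (⟨_, h T⟩ : L))
  have hinj : Set.InjOn (fun T => algebraMap k L T) s := (algebraMap k L).injective.injOn
  refine ⟨Q, ?_⟩
  refine Polynomial.eq_of_degrees_lt_of_eval_index_eq s (v := fun T => algebraMap k Ω T)
    (algebraMap k Ω).injective.injOn ?_ ?_ fun T hT => ?_
  · exact lt_of_le_of_lt Polynomial.degree_map_le (Lagrange.degree_interpolate_lt _ hinj)
  · rw [hs]
    exact lt_of_le_of_lt Polynomial.degree_le_natDegree (by exact_mod_cast Nat.lt_succ_self _)
  · have h1 := Lagrange.eval_interpolate_at_node (fun T => (⟨_, h T⟩ : L)) hinj hT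
    have h2 := congrArg (algebraMap L Ω) h1
    rw [← Polynomial.eval₂_at_apply, ← Polynomial.eval_map] at h2
    exact h2

/-- An element which is a root of multiplicity at most two is separable, in characteristic
different from two. -/
theorem isSeparable_of_rootMultiplicity_le_two {L Ω : Type*} [Field L] [Field Ω] [Algebra L Ω]
    (h2 : (2 : L) ≠ 0) {Q : Polynomial L} (hQ : Q ≠ 0) {θ : Ω} (hθ : Polynomial.aeval θ Q = 0)
    (hm : (Q.map (algebraMap L Ω)).rootMultiplicity θ ≤ 2) : IsSeparable L θ := by
  have hint : IsIntegral L θ := IsAlgebraic.isIntegral ⟨Q, hQ, hθ⟩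
  rw [IsSeparable, Polynomial.separable_iff_derivative_ne_zero (minpoly.irreducible hint)]
  intro hder
  have hne : (minpoly L θ).map (algebraMap L Ω) ≠ 0 :=
    Polynomial.map_ne_zero (minpoly.ne_zero hint)
  -- With vanishing derivative the minimal polynomial and its first two derivatives vanish at `θ`.
  -- As `2! ≠ 0`, this makes `θ` a root of multiplicity at least 3.
  have h3 : 2 < ((minpoly L θ).map (algebraMap L Ω)).rootMultiplicity θ := by
    rw [Polynomial.lt_rootMultiplicity_iff_isRoot_iterate_derivative_of_mem_nonZeroDivisors hne]
    · intro m hm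
      interval_cases m
      · rw [Function.iterate_zero, id, Polynomial.IsRoot, Polynomial.eval_map_algebraMap]
        exact minpoly.aeval L θ
      · simp [hder]
      · simp [hder]
    · apply mem_nonZeroDivisors_of_ne_zero
      have h5 := (map_ne_zero (algebraMap L Ω)).2 h2
      rwa [map_ofNat] at h5
  have h4 := Polynomial.rootMultiplicity_le_rootMultiplicity_of_dvd
    (Polynomial.map_ne_zero (f := algebraMap L Ω) hQ)
    (Polynomial.map_dvd (algebraMap L Ω) (minpoly.dvd L θ hθ)) θ
  omega

/-- A simple root of a polynomial with separable coefficients is separable. -/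
theorem mem_separableClosure_of_simple_root {L Ω : Type*} [Field L] [Field Ω] [Algebra L Ω]
    (p : Polynomial (separableClosure L Ω)) {w : Ω} (h : Polynomial.aeval w p = 0)
    (h' : Polynomial.aeval w p.derivative ≠ 0) : w ∈ separableClosure L Ω := by
  have hp : p ≠ 0 := by
    rintro rfl
    simp at h'
  have hint : IsIntegral (separableClosure L Ω) w := IsAlgebraic.isIntegral ⟨p, hp, h⟩
  have h1 : IsSeparable (separableClosure L Ω) w := by
    rw [IsSeparable, Polynomial.separable_iff_derivative_ne_zero (minpoly.irreducible hint)]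
    intro hder
    obtain ⟨c, hc⟩ := minpoly.dvd _ w h
    apply h'
    rw [hc, Polynomial.derivative_mul, hder, zero_mul, zero_add, map_mul, minpoly.aeval, zero_mul]
  have h2 := mem_separableClosure_iff.2 h1
  rw [separableClosure.separableClosure_eq_bot] at h2
  obtain ⟨x, hx⟩ := IntermediateField.mem_bot.1 h2
  rw [← hx]
  exact x.2

end Field


/-! ### Separability of the parameters over the invariants -/

/-- A subspace which together with finitely many proper subspaces covers a space over an infinite
field is everything. -/
theorem eq_top_of_forall_mem_or {k V ι : Type*} [Field k] [Infinite k] [AddCommGroup V] [Module k V]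
    [Finite ι] (W : Submodule k V) (U : ι → Submodule k V) (hU : ∀ i, U i ≠ ⊤)
    (h : ∀ v, v ∈ W ∨ ∃ i, v ∈ U i) : W = ⊤ := by
  obtain ⟨i, hi⟩ := Subspace.exists_eq_top_of_iUnion_eq_univ (k := k) (E := V)
    (p := fun i : Option ι => i.elim W U) (Set.eq_univ_of_forall fun v => by
      rcases h v with h | ⟨i, h⟩
      · exact Set.mem_iUnion.2 ⟨none, h⟩
      · exact Set.mem_iUnion.2 ⟨some i, h⟩)
  cases i with
  | none => exact hi
  | some i => exact absurd hi (hU i)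

theorem exists_eq_top_of_forall_mem {k V ι : Type*} [Field k] [Infinite k] [AddCommGroup V]
    [Module k V] [Finite ι] (U : ι → Submodule k V) (h : ∀ v, ∃ i, v ∈ U i) : ∃ i, U i = ⊤ :=
  Subspace.exists_eq_top_of_iUnion_eq_univ (Set.eq_univ_of_forall fun v => Set.mem_iUnion.2 (h v))

/-- The linear combinations of cross ratios as a linear map. -/
def crossSumLin (k : Type*) {K : Type*} [Field k] [Field K] [Algebra k K] {n : ℕ}
    (r : Fin n → Fin 2 → K) : ((Fin 4 ↪ Fin n) → k) →ₗ[k] K :=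
  Fintype.linearCombination k (crossRatio r)

theorem crossSumLin_apply {k K : Type*} [Field k] [Field K] [Algebra k K] {n : ℕ}
    (r : Fin n → Fin 2 → K) (u : (Fin 4 ↪ Fin n) → k) : crossSumLin k r u = crossSum u r := rfl

theorem crossSum_single {k K : Type*} [Field k] [Field K] [Algebra k K] {n : ℕ}
    (r : Fin n → Fin 2 → K) (q : Fin 4 ↪ Fin n) :
    crossSum (Pi.single q (1 : k)) r = crossRatio r q := by
  rw [crossSum, Finset.sum_eq_single q]
  · rw [Pi.single_eq_same, one_smul]
  · intro q' _ h
    rw [Pi.single_eq_of_ne h, zero_smul]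
  · simp

section Separable

variable {k : Type u} [Field k] [IsAlgClosed k] {g : ℕ} {b : Fin (g + 1) → ParamClosure g k}

/-- The field generated by the pull-backs of the regular functions on the moduli space, in the
algebraic closure. -/
def invField (hN : normalDisc g k ≠ 0) : IntermediateField k (ParamClosure g k) :=
  IntermediateField.adjoin k
    (Set.range fun F => algebraMap (ParamField g k) (ParamClosure g k) (pullback hN F))

theorem algebraMap_aeval_param {k : Type*} [Field k] {g : ℕ} (P : MvPolynomial (Fin (2 * g + 3)) k) :
    algebraMap (ParamField g k) (ParamClosure g k) (MvPolynomial.aeval (normalForm (param k)) P) =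
      MvPolynomial.aeval (normalForm (gparam k)) P := by
  rw [← MvPolynomial.aeval_algebraMap_apply]
  congr 2
  funext j
  exact normalForm_map _ _ _

/-- The product is the pull-back of a regular function on `H_g`, evaluated through the root vectors
`(± b_i, 1)` of the generic normal form. -/
theorem prod_sub_crossSum_mem (h2 : (2 : k) ≠ 0) (hN : normalDisc g k ≠ 0)
    (hb : affinePoly (normalForm (gparam k)) = ∏ p, (Polynomial.X - Polynomial.C (pts b p)))
    (u : (Fin 4 ↪ Fin (2 * g + 2)) → k) (T : k) :
    ∏ π : Equiv.Perm (Fin (2 * g + 2)), (algebraMap k (ParamClosure g k) T -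
      crossSum u (affineRoots fun p => pts b (π p))) ∈ invField hN := by
  obtain ⟨F, P, m, h1, h3⟩ := exists_coordRing_prod_crossSum (g := g) u T
  have hne := bracketProd_affineRoots_ne_zero (pts_generic_injective h2 hb)
  have h4 := h3 (affineRoots (pts b)) hne
  have hd : MvPolynomial.aeval (rootForm (affineRoots (pts b))) (disc g k) ≠ 0 := by
    rw [aeval_disc_rootForm]
    exact mul_ne_zero (discSign_ne_zero _ _) hne
  rw [rootForm_affineRoots hb] at h4 hd
  have h5 := (isPullback_pullback hN F).unique hN (isPullback_of_eval_eq hN h1)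
  have h6 : algebraMap (ParamField g k) (ParamClosure g k)
      (algebraMap (MvPolynomial (Fin g) k) (ParamField g k) (normalDisc g k)) =
      MvPolynomial.aeval (normalForm (gparam k)) (disc g k) := by
    rw [← algebraMap_aeval_param, ← aeval_normalDisc]
    congr 1
    have h7 := MvPolynomial.aeval_algebraMap_apply (R := k) (ParamField g k)
      (MvPolynomial.X : _ → MvPolynomial (Fin g) k) (normalDisc g k)
    rw [MvPolynomial.aeval_X_left_apply] at h7
    exact h7.symm
  have h8 : algebraMap (ParamField g k) (ParamClosure g k) (pullback hN F) =
      ∏ π : Equiv.Perm (Fin (2 * g + 2)), (algebraMap k (ParamClosure g k) T -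
        crossSum u (affineRoots fun p => pts b (π p))) := by
    have h9 : algebraMap (ParamField g k) (ParamClosure g k) (MvPolynomial.aeval
        (normalForm fun i : Fin g => algebraMap (MvPolynomial (Fin g) k) (ParamField g k)
          (MvPolynomial.X i)) P) = MvPolynomial.aeval (normalForm (gparam k)) P :=
      algebraMap_aeval_param P
    rw [h5, map_div₀, map_pow, h6, h9, h4, mul_div_cancel_left₀ _ (pow_ne_zero m hd)]
    rfl
  rw [← h8]
  exact IntermediateField.subset_adjoin _ _ ⟨F, rfl⟩

/-- The monic polynomial with roots the values of `crossSum u` at the permuted generic roots has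
coefficients in the field of invariants. -/
theorem exists_map_eq_prod_crossSum (h2 : (2 : k) ≠ 0) (hN : normalDisc g k ≠ 0)
    (hb : affinePoly (normalForm (gparam k)) = ∏ p, (Polynomial.X - Polynomial.C (pts b p)))
    (u : (Fin 4 ↪ Fin (2 * g + 2)) → k) :
    ∃ Q : Polynomial (invField hN), Q.map (algebraMap (invField hN) (ParamClosure g k)) =
      ∏ π : Equiv.Perm (Fin (2 * g + 2)),
        (Polynomial.X - Polynomial.C (crossSum u (affineRoots fun p => pts b (π p)))) := by
  have : Infinite k := IsAlgClosed.instInfinite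
  apply exists_map_eq_of_eval_mem
  intro T
  rw [Polynomial.eval_prod]
  simp only [Polynomial.eval_sub, Polynomial.eval_X, Polynomial.eval_C]
  exact prod_sub_crossSum_mem h2 hN hb u T

theorem rootMultiplicity_prod_X_sub_C_le {K ι : Type*} [Field K] [Fintype ι] (f : ι → K)
    (θ : K) (s : Finset ι) (hs : ∀ i, f i = θ → i ∈ s) :
    (∏ i, (Polynomial.X - Polynomial.C (f i))).rootMultiplicity θ ≤ s.card := by
  classical
  have h : (∏ i, (Polynomial.X - Polynomial.C (f i))) =
      (((Finset.univ.val.map f)).map fun a => Polynomial.X - Polynomial.C a).prod := by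
    rw [Multiset.map_map]
    rfl
  rw [h, ← Polynomial.count_roots, Polynomial.roots_multiset_prod_X_sub_C, Multiset.count_map]
  have h1 : (Finset.univ.filter fun i => θ = f i) ⊆ s := fun i hi =>
    hs i (Finset.mem_filter.1 hi).2.symm
  exact Finset.card_le_card h1

/-- The cross ratios of the generic roots are separable over the field of invariants. -/
theorem crossRatio_mem_separableClosure (hg : 2 ≤ g) (h2 : (2 : k) ≠ 0) (hN : normalDisc g k ≠ 0)
    (hb : affinePoly (normalForm (gparam k)) = ∏ p, (Polynomial.X - Polynomial.C (pts b p)))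
    (q : Fin 4 ↪ Fin (2 * g + 2)) :
    crossRatio (affineRoots (pts b)) q ∈ separableClosure (invField hN) (ParamClosure g k) := by
  classical
  have : Infinite k := IsAlgClosed.instInfinite
  -- `W` collects the coefficients `u` whose combination of cross ratios is separable, and `U π`
  -- those whose combination is unchanged by `π`. For `π` other than the identity and `partner`, `U
  -- π` is a proper subspace. Outside all of these the combination is a root of multiplicity at most
  -- 2, hence separable. So `W` and finitely many proper subspaces cover everything.
  let W : Submodule k ((Fin 4 ↪ Fin (2 * g + 2)) → k) :=
    Submodule.comap (crossSumLin k (affineRoots (pts b)))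
      (Submodule.restrictScalars k
        (Subalgebra.toSubmodule (separableClosure (invField hN) (ParamClosure g k)).toSubalgebra))
  let U : {π : Equiv.Perm (Fin (2 * g + 2)) // π ≠ 1 ∧ π ≠ partner g} →
      Submodule k ((Fin 4 ↪ Fin (2 * g + 2)) → k) := fun π =>
    LinearMap.ker (crossSumLin k (affineRoots fun p => pts b (π.1 p)) -
      crossSumLin k (affineRoots (pts b)))
  have hW : W = ⊤ := by
    refine eq_top_of_forall_mem_or W U (fun π hπ => ?_) fun u => ?_
    · have hq : ∀ q, crossRatio (affineRoots fun p => pts b (π.1 p)) q =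
          crossRatio (affineRoots (pts b)) q := by
        intro q
        have h1 : Pi.single q (1 : k) ∈ U π := by rw [hπ]; trivial
        have h3 := LinearMap.mem_ker.1 h1
        rw [LinearMap.sub_apply, crossSumLin_apply, crossSumLin_apply, crossSum_single,
          crossSum_single] at h3
        exact sub_eq_zero.1 h3
      exact (eq_one_or_eq_partner_of_crossRatio hg h2 hb hq).elim π.2.1 π.2.2
    · by_cases hu : ∃ π, u ∈ U π
      · exact Or.inr hu
      · left
        obtain ⟨Q, hQ⟩ := exists_map_eq_prod_crossSum h2 hN hb u
        have hQ0 : Q ≠ 0 := by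
          rintro rfl
          rw [Polynomial.map_zero, eq_comm, Finset.prod_eq_zero_iff] at hQ
          obtain ⟨π, -, hπ⟩ := hQ
          exact Polynomial.X_sub_C_ne_zero _ hπ
        change crossSum u (affineRoots (pts b)) ∈ separableClosure _ _
        rw [mem_separableClosure_iff]
        refine isSeparable_of_rootMultiplicity_le_two ?_ hQ0 ?_ ?_
        · have h5 := (map_ne_zero (algebraMap k (invField hN))).2 h2
          rwa [map_ofNat] at h5
        · rw [← Polynomial.eval_map_algebraMap, hQ, Polynomial.eval_prod]
          apply Finset.prod_eq_zero (Finset.mem_univ 1)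
          simp
        · rw [hQ]
          refine (rootMultiplicity_prod_X_sub_C_le _ _ {1, partner g} fun π hπ => ?_).trans
            Finset.card_le_two
          by_contra hne
          rw [Finset.mem_insert, Finset.mem_singleton, not_or] at hne
          apply hu
          refine ⟨⟨π, hne⟩, ?_⟩
          rw [LinearMap.mem_ker, LinearMap.sub_apply, sub_eq_zero]
          exact hπ
  have h : Pi.single q (1 : k) ∈ W := by rw [hW]; trivial
  change crossSum (Pi.single q (1 : k)) (affineRoots (pts b)) ∈ separableClosure _ _ at h
  rwa [crossSum_single] at h

/-- The cross ratio of two pairs. -/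
def pairQuad {p r : Fin (2 * g + 2)} (h : idx p ≠ idx r) : Fin 4 ↪ Fin (2 * g + 2) :=
  quad p (partner g p) r (partner g r) (partner_ne p).symm (ne_of_idx_ne h)
    (ne_of_idx_ne (by rwa [idx_partner])) (ne_of_idx_ne (by rwa [idx_partner]))
    (ne_of_idx_ne (by rwa [idx_partner, idx_partner])) (partner_ne r).symm

theorem crossRatio_pairQuad {K : Type*} [Field K] {x : Fin (2 * g + 2) → K}
    (hx : ∀ p, x (partner g p) = - x p) {p r : Fin (2 * g + 2)} (h : idx p ≠ idx r) :
    crossRatio (affineRoots x) (pairQuad h) = 4 * (x p * x r) / (x p + x r) ^ 2 := by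
  rw [crossRatio_affineRoots]
  change (x p - x (partner g p)) * (x r - x (partner g r)) /
    ((x p - x (partner g r)) * (x r - x (partner g p))) = _
  rw [hx, hx]
  congr 1 <;> ring

/-- If `l` is the cross ratio of the pairs `± x` and `± y`, then `x/y` is a root of `l (1 + T)² - 4
T`. The derivative there is `4 (x - y) / (x + y)`, so the root is simple. -/
theorem ratio_mem_separableClosure (hg : 2 ≤ g) (h2 : (2 : k) ≠ 0) (hN : normalDisc g k ≠ 0)
    (hb : affinePoly (normalForm (gparam k)) = ∏ p, (Polynomial.X - Polynomial.C (pts b p)))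
    (i j : Fin (g + 1)) :
    b i / b j ∈ separableClosure (invField hN) (ParamClosure g k) := by
  by_cases hij : i = j
  · rw [hij, div_self (ne_zero_of_pts hb j)]
    exact one_mem _
  obtain ⟨p, rfl⟩ := exists_idx_eq i
  obtain ⟨r, rfl⟩ := exists_idx_eq j
  have hinj := pts_generic_injective h2 hb
  have hr : pts b r ≠ 0 := pts_ne_zero (ne_zero_of_pts hb _)
  have hp : pts b p ≠ 0 := pts_ne_zero (ne_zero_of_pts hb _)
  have h4 : (2 : ParamClosure g k) ≠ 0 := by
    have h5 := (map_ne_zero (algebraMap k (ParamClosure g k))).2 h2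
    rwa [map_ofNat] at h5
  have hw : pts b p / pts b r ∈ separableClosure (invField hN) (ParamClosure g k) := by
    have hq := crossRatio_mem_separableClosure hg h2 hN hb (pairQuad hij)
    rw [crossRatio_pairQuad (pts_partner b)] at hq
    have hsub : pts b p - pts b r ≠ 0 := sub_ne_zero.2 (hinj.ne (ne_of_idx_ne hij))
    have hadd : pts b p + pts b r ≠ 0 := by
      have h5 : pts b p - pts b (partner g r) ≠ 0 :=
        sub_ne_zero.2 (hinj.ne (ne_of_idx_ne (by rwa [idx_partner])))
      rwa [pts_partner, sub_neg_eq_add] at h5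
    set l := 4 * (pts b p * pts b r) / (pts b p + pts b r) ^ 2 with hl
    apply mem_separableClosure_of_simple_root
      (Polynomial.C (⟨l, hq⟩ : separableClosure (invField hN) (ParamClosure g k)) *
        (1 + Polynomial.X) ^ 2 - 4 * Polynomial.X)
    · simp only [map_sub, map_mul, map_pow, map_add, map_one, Polynomial.aeval_X,
        Polynomial.aeval_C, map_ofNat]
      change l * _ - _ = 0
      rw [hl]
      field_simp
      ring
    · have h5 : Polynomial.derivative
          (Polynomial.C (⟨l, hq⟩ : separableClosure (invField hN) (ParamClosure g k)) *
            (1 + Polynomial.X) ^ 2 - 4 * Polynomial.X) =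
          Polynomial.C ⟨l, hq⟩ * (2 * (1 + Polynomial.X)) - 4 := by
        simp only [Polynomial.derivative_sub, Polynomial.derivative_mul, Polynomial.derivative_C,
          Polynomial.derivative_sq, Polynomial.derivative_add, Polynomial.derivative_one,
          Polynomial.derivative_X, Polynomial.derivative_ofNat, Polynomial.C_ofNat]
        ring
      rw [h5]
      simp only [map_sub, map_mul, map_add, map_one, Polynomial.aeval_X,
        Polynomial.aeval_C, map_ofNat]
      change l * _ - _ ≠ 0
      have h6 : l * (2 * (1 + pts b p / pts b r)) - 4 =
          2 * 2 * (pts b p - pts b r) / (pts b p + pts b r) := by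
        rw [hl]
        field_simp
        ring
      rw [h6]
      exact div_ne_zero (mul_ne_zero (mul_ne_zero h4 h4) hsub) hadd
  rcases pts_eq_or b p with h5 | h5 <;> rcases pts_eq_or b r with h6 | h6 <;> rw [h5, h6] at hw
  · exact hw
  · rw [div_neg] at hw
    exact neg_mem_iff.1 hw
  · rw [neg_div] at hw
    exact neg_mem_iff.1 hw
  · rwa [neg_div_neg_eq] at hw

/-- The roots of the generic normal form are separable over the field of invariants. -/
theorem root_mem_separableClosure (hg : 2 ≤ g) (hn : ((2 * g + 2 : ℕ) : k) ≠ 0) (h2 : (2 : k) ≠ 0)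
    (hN : normalDisc g k ≠ 0)
    (hb : affinePoly (normalForm (gparam k)) = ∏ p, (Polynomial.X - Polynomial.C (pts b p)))
    (j : Fin (g + 1)) : b j ∈ separableClosure (invField hN) (ParamClosure g k) := by
  have hmem : b j ^ (2 * g + 2) ∈ separableClosure (invField hN) (ParamClosure g k) := by
    rw [pow_last_mul hb]
    exact mul_mem (pow_mem (neg_mem (one_mem _)) _)
      (inv_mem (prod_mem fun i _ => pow_mem (ratio_mem_separableClosure hg h2 hN hb i j) 2))
  -- The power `2g+2` of the root is separable by the ratios, and extracting this root is separable
  -- because `2g+2 ≠ 0` in `k`.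
  apply mem_separableClosure_of_simple_root
    (Polynomial.X ^ (2 * g + 2) -
      Polynomial.C (⟨_, hmem⟩ : separableClosure (invField hN) (ParamClosure g k)))
  · simp only [map_sub, map_pow, Polynomial.aeval_X, Polynomial.aeval_C]
    exact sub_self _
  · rw [Polynomial.derivative_sub, Polynomial.derivative_C, sub_zero, Polynomial.derivative_X_pow]
    simp only [map_mul, map_pow, Polynomial.aeval_X, map_natCast]
    refine mul_ne_zero ?_ (pow_ne_zero _ (ne_zero_of_pts hb j))
    have h5 := (map_ne_zero (algebraMap k (ParamClosure g k))).2 hn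
    rwa [map_natCast] at h5

theorem algebraMap_mem_separableClosure (hg : 2 ≤ g) (hn : ((2 * g + 2 : ℕ) : k) ≠ 0)
    (h2 : (2 : k) ≠ 0) (hN : normalDisc g k ≠ 0) (z : ParamField g k) :
    algebraMap (ParamField g k) (ParamClosure g k) z ∈
      separableClosure (invField hN) (ParamClosure g k) := by
  obtain ⟨b, hb⟩ := exists_pts (gparam k : Fin g → ParamClosure g k)
  exact algebraMap_mem_of_gparam_mem _
    (gparam_mem_of_pts _ hb (root_mem_separableClosure hg hn h2 hN hb)) z

theorem isAlgebraic_invField (hg : 2 ≤ g) (hn : ((2 * g + 2 : ℕ) : k) ≠ 0)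
    (h2 : (2 : k) ≠ 0) (hN : normalDisc g k ≠ 0) :
    Algebra.IsAlgebraic (invField hN) (ParamClosure g k) :=
  isAlgebraic_of_gparam fun i => (mem_separableClosure_iff.1
    (algebraMap_mem_separableClosure hg hn h2 hN (param k i))).isIntegral.isAlgebraic

end Separable


/-! ### Automorphisms over the field of invariants -/

section Pure

variable {K : Type*} [Field K] {g : ℕ}

/-- Two equivalence relations which together relate every pair of elements cannot both be proper, as
a group is not the union of two proper subgroups. It makes the choice between scaling and inversion
uniform over all roots. -/
theorem forall_eq_or_forall_eq {ι A B : Type*} {f : ι → A} {h : ι → B}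
    (hfh : ∀ p r, f p = f r ∨ h p = h r) : (∀ p r, f p = f r) ∨ ∀ p r, h p = h r := by
  by_contra hne
  push Not at hne
  obtain ⟨⟨p, r, hpr⟩, s, t, hst⟩ := hne
  have h1 := (hfh p r).resolve_left hpr
  have h2 : ∀ s, h s = h p := by
    intro s
    by_cases hs : f s = f p
    · have h3 : f s ≠ f r := by rw [hs]; exact hpr
      rw [(hfh s r).resolve_left h3, h1]
    · exact (hfh s p).resolve_left hs
  exact hst (by rw [h2 s, h2 t])

/-- Two families of points `± y_i` and `± x_i` with equal cross ratios agree up to scaling and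
inversion. -/
theorem eq_mul_or_eq_div (h2 : (2 : K) ≠ 0) {x y : Fin (2 * g + 2) → K}
    (hx0 : ∀ p, x p ≠ 0) (hy0 : ∀ p, y p ≠ 0)
    (hx : Function.Injective x) (hy : Function.Injective y)
    (hxσ : ∀ p, x (partner g p) = -x p) (hyσ : ∀ p, y (partner g p) = -y p)
    (h : ∀ q, crossRatio (affineRoots y) q = crossRatio (affineRoots x) q) :
    ∃ c : K, c ≠ 0 ∧ ((∀ p, y p = c * x p) ∨ ∀ p, y p = c * (x p)⁻¹) := by
  have hadd : ∀ {z : Fin (2 * g + 2) → K}, Function.Injective z →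
      (∀ p, z (partner g p) = -z p) → ∀ {p r}, idx p ≠ idx r → z p + z r ≠ 0 := by
    intro z hz hzσ p r hpr
    have h5 : z p - z (partner g r) ≠ 0 :=
      sub_ne_zero.2 (hz.ne (ne_of_idx_ne (by rwa [idx_partner])))
    rwa [hzσ, sub_neg_eq_add] at h5
  have key : ∀ p r, y p / x p = y r / x r ∨ y p * x p = y r * x r := by
    intro p r
    by_cases hpr : idx p = idx r
    · rcases eq_or_eq_partner hpr with h3 | h3
      · exact Or.inl (by rw [h3])
      · left
        rw [h3, hxσ, hyσ, neg_div_neg_eq]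
    · have h3 := h (pairQuad hpr)
      rw [crossRatio_pairQuad hxσ, crossRatio_pairQuad hyσ,
        div_eq_div_iff (pow_ne_zero 2 (hadd hy hyσ hpr)) (pow_ne_zero 2 (hadd hx hxσ hpr))] at h3
      -- The equality of the two cross ratios factors: either the quotients `y/x` or the products `y
      -- x` agree at `p` and `r`.
      have h4 : 2 * 2 * ((y r * x p - y p * x r) * (y p * x p - y r * x r)) = 0 := by
        linear_combination h3
      rcases mul_eq_zero.1 ((mul_eq_zero.1 h4).resolve_left (mul_ne_zero h2 h2)) with h5 | h5
      · left
        rw [div_eq_div_iff (hx0 p) (hx0 r)]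
        linear_combination -h5
      · exact Or.inr (sub_eq_zero.1 h5)
  rcases forall_eq_or_forall_eq key with h3 | h3
  · refine ⟨y 0 / x 0, div_ne_zero (hy0 0) (hx0 0), Or.inl fun p => ?_⟩
    rw [← h3 p 0, div_mul_cancel₀ _ (hx0 p)]
  · refine ⟨y 0 * x 0, mul_ne_zero (hy0 0) (hx0 0), Or.inr fun p => ?_⟩
    rw [← h3 p 0, mul_inv_cancel_right₀ (hx0 p)]

/-- The effect of scaling the roots on the normal form. -/
theorem normalForm_of_scaled_roots {a a' : Fin g → K} {x : Fin (2 * g + 2) → K} {c : K}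
    (hc : c ≠ 0) (π : Equiv.Perm (Fin (2 * g + 2)))
    (h : affinePoly (normalForm a) = ∏ p, (Polynomial.X - Polynomial.C (x p)))
    (h' : affinePoly (normalForm a') = ∏ p, (Polynomial.X - Polynomial.C (c * x (π p)))) :
    c ^ (2 * g + 2) = 1 ∧ ∀ i, a' i = c⁻¹ ^ (2 * ((i : ℕ) + 1)) * a i := by
  replace h' := h'.trans (Equiv.prod_comp π fun p => Polynomial.X - Polynomial.C (c * x p))
  have h1 : (affinePoly (normalForm a')).comp (Polynomial.C c * Polynomial.X) =
      Polynomial.C (c ^ (2 * g + 2)) * affinePoly (normalForm a) := by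
    rw [h, h', Polynomial.prod_comp, map_pow]
    have h3 : ∀ p, (Polynomial.X - Polynomial.C (c * x p)).comp (Polynomial.C c * Polynomial.X) =
        Polynomial.C c * (Polynomial.X - Polynomial.C (x p)) := by
      intro p
      rw [Polynomial.sub_comp, Polynomial.X_comp, Polynomial.C_comp, Polynomial.C_mul]
      ring
    simp only [h3, Finset.prod_mul_distrib, Finset.prod_const, Finset.card_univ, Fintype.card_fin]
  have h2 : ∀ j : Fin (2 * g + 3), normalForm a' j * c ^ (j : ℕ) =
      c ^ (2 * g + 2) * normalForm a j := by
    intro j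
    have h3 := congrArg (fun P => P.coeff (j : ℕ)) h1
    simp only [Polynomial.comp_C_mul_X_coeff, Polynomial.coeff_C_mul, coeff_affinePoly] at h3
    exact h3
  have hcn : c ^ (2 * g + 2) = 1 := by
    -- Both constant terms are 1, which forces `c^(2g+2) = 1`.
    have h3 := h2 0
    rw [normalForm_zero, normalForm_zero, mul_one, one_mul] at h3
    rw [← h3]
    simp
  refine ⟨hcn, fun i => ?_⟩
  have h3 := h2 ⟨2 * (i + 1), by omega⟩
  rw [normalForm_middle, normalForm_middle, hcn, one_mul] at h3
  rw [← h3, inv_pow, mul_comm (a' i), inv_mul_cancel_left₀ (pow_ne_zero _ hc)]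

/-- The reversed normal form has the inverse roots. -/
theorem affinePoly_normalForm_rev {a : Fin g → K} {x : Fin (2 * g + 2) → K}
    (hx : ∀ p, x p ≠ 0)
    (h : affinePoly (normalForm a) = ∏ p, (Polynomial.X - Polynomial.C (x p))) :
    affinePoly (normalForm fun i => a i.rev) =
      ∏ p, (Polynomial.X - Polynomial.C (x p)⁻¹) := by
  have h1 := subst_swapGL_normalForm a
  rw [← rootForm_affineRoots h, subst_toPoly_rootForm] at h1
  rw [← toPoly_injective h1, affinePoly_rootForm, rootPoly]
  have h3 : ∀ p, Polynomial.C (substRoots (swapGL K) (affineRoots x) p 1) * Polynomial.X -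
      Polynomial.C (substRoots (swapGL K) (affineRoots x) p 0) =
      Polynomial.C (-x p) * (Polynomial.X - Polynomial.C (x p)⁻¹) := by
    intro p
    have h4 : substRoots (swapGL K) (affineRoots x) p 0 = -1 := by
      simp [substRoots, affineRoots, coe_swapGL]
    have h5 : substRoots (swapGL K) (affineRoots x) p 1 = -x p := by
      simp [substRoots, affineRoots, coe_swapGL]
    rw [h4, h5, mul_sub, ← Polynomial.C_mul, neg_mul, mul_inv_cancel₀ (hx p)]
  have h6 : ∏ p, -x p = 1 := by
    have h7 := congrArg (Polynomial.eval 0) h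
    rw [← Polynomial.coeff_zero_eq_eval_zero, Polynomial.eval_prod] at h7
    have h8 : (affinePoly (normalForm a)).coeff 0 = 1 :=
      (coeff_affinePoly _ 0).trans (normalForm_zero a)
    rw [h8] at h7
    rw [h7]
    exact Finset.prod_congr rfl fun p _ => by simp
  simp only [h3, Finset.prod_mul_distrib, ← map_prod, h6, map_one, one_mul]

end Pure

section Automorphisms

variable {k : Type u} [Field k] [IsAlgClosed k] {g : ℕ} {b : Fin (g + 1) → ParamClosure g k}

/-- An automorphism over the field of invariants permutes the generic roots up to a projective
transformation. -/
theorem exists_perm_crossRatio (h2 : (2 : k) ≠ 0) (hN : normalDisc g k ≠ 0)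
    (hb : affinePoly (normalForm (gparam k)) = ∏ p, (Polynomial.X - Polynomial.C (pts b p)))
    (τ : ParamClosure g k ≃ₐ[invField hN] ParamClosure g k) :
    ∃ π : Equiv.Perm (Fin (2 * g + 2)), ∀ q,
      crossRatio (affineRoots fun p => τ (pts b p)) q =
        crossRatio (affineRoots fun p => pts b (π p)) q := by
  classical
  have : Infinite k := IsAlgClosed.instInfinite
  have hτ : ∀ q, τ (crossRatio (affineRoots (pts b)) q) =
      crossRatio (affineRoots fun p => τ (pts b p)) q := by
    intro q
    simp only [crossRatio_affineRoots, map_div₀, map_mul, map_sub]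
  have hτu : ∀ u : (Fin 4 ↪ Fin (2 * g + 2)) → k, τ (crossSum u (affineRoots (pts b))) =
      crossSum u (affineRoots fun p => τ (pts b p)) := by
    intro u
    rw [crossSum, crossSum, map_sum]
    refine Finset.sum_congr rfl fun q _ => ?_
    rw [← hτ]
    exact map_smul (AlgEquiv.restrictScalars k τ) (u q) _
  -- For each `u` the image of the combination under `τ` is again a root of the same polynomial over
  -- the invariants, so some `π`, depending on `u`, works. The finitely many subspaces of those `u`
  -- for which a given `π` works cover the whole space, so one `π` works for all `u`.
  obtain ⟨π, hπ⟩ := exists_eq_top_of_forall_mem (k := k)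
    (fun π : Equiv.Perm (Fin (2 * g + 2)) =>
      LinearMap.ker (crossSumLin k (affineRoots fun p => τ (pts b p)) -
        crossSumLin k (affineRoots fun p => pts b (π p)))) (fun u => by
      obtain ⟨Q, hQ⟩ := exists_map_eq_prod_crossSum h2 hN hb u
      have h1 : Polynomial.aeval (crossSum u (affineRoots (pts b))) Q = 0 := by
        rw [← Polynomial.eval_map_algebraMap, hQ, Polynomial.eval_prod]
        apply Finset.prod_eq_zero (Finset.mem_univ 1)
        simp
      have h3 := congrArg τ h1
      rw [map_zero, ← Polynomial.aeval_algHom_apply, hτu, ← Polynomial.eval_map_algebraMap, hQ,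
        Polynomial.eval_prod, Finset.prod_eq_zero_iff] at h3
      obtain ⟨π, -, hπ⟩ := h3
      refine ⟨π, ?_⟩
      rw [LinearMap.mem_ker, LinearMap.sub_apply, crossSumLin_apply, crossSumLin_apply]
      simpa using hπ)
  refine ⟨π, fun q => ?_⟩
  have h1 : Pi.single q (1 : k) ∈ LinearMap.ker (crossSumLin k (affineRoots fun p => τ (pts b p)) -
      crossSumLin k (affineRoots fun p => pts b (π p))) := by rw [hπ]; trivial
  rw [LinearMap.mem_ker, LinearMap.sub_apply, crossSumLin_apply, crossSumLin_apply,
    crossSum_single, crossSum_single] at h1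
  exact sub_eq_zero.1 h1

/-- An automorphism over the field of invariants scales the generic roots or their inverses. -/
theorem exists_perm_eq_mul (hg : 2 ≤ g) (h2 : (2 : k) ≠ 0) (hN : normalDisc g k ≠ 0)
    (hb : affinePoly (normalForm (gparam k)) = ∏ p, (Polynomial.X - Polynomial.C (pts b p)))
    (τ : ParamClosure g k ≃ₐ[invField hN] ParamClosure g k) :
    ∃ (π : Equiv.Perm (Fin (2 * g + 2))) (c : ParamClosure g k), c ≠ 0 ∧
      ((∀ p, τ (pts b p) = c * pts b (π p)) ∨ ∀ p, τ (pts b p) = c * (pts b (π p))⁻¹) := by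
  obtain ⟨π, hπ⟩ := exists_perm_crossRatio h2 hN hb τ
  have hinj := pts_generic_injective h2 hb
  have hne : ∀ p, pts b p ≠ 0 := fun p => pts_ne_zero (ne_zero_of_pts hb _)
  have h4 : (2 : ParamClosure g k) ≠ 0 := by
    have h5 := (map_ne_zero (algebraMap k (ParamClosure g k))).2 h2
    rwa [map_ofNat] at h5
  have hcomp : ∀ (x : Fin (2 * g + 2) → ParamClosure g k) (s : Equiv.Perm (Fin (2 * g + 2))) q,
      crossRatio (affineRoots fun p => x (s p)) q =
        crossRatio (affineRoots x) (q.trans s.toEmbedding) := fun x s q => rfl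
  -- `τ` commutes with negation, and negating all points does not change their cross ratios.
  have hσ : ∀ q, crossRatio (affineRoots fun p => pts b (π (partner g p))) q =
      crossRatio (affineRoots fun p => pts b (π p)) q := by
    intro q
    rw [hcomp (fun p => pts b (π p)) (partner g), ← hπ, ← hπ,
      ← hcomp (fun p => τ (pts b p)) (partner g)]
    simp only [pts_partner, map_neg, crossRatio_affineRoots]
    congr 1 <;> ring
  have hcomm : ∀ p, π (partner g p) = partner g (π p) := by
    -- The conjugate of `partner` by `π` preserves the cross ratios of the generic roots. It is not
    -- the identity, so it is `partner`.
    have h5 := eq_one_or_eq_partner_of_crossRatio hg h2 hb (π := π⁻¹.trans ((partner g).trans π))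
      (fun q => by
        have h6 := hσ (q.trans (π⁻¹ : Equiv.Perm (Fin (2 * g + 2))).toEmbedding)
        rw [← hcomp, ← hcomp (fun p => pts b (π p))] at h6
        simpa using h6)
    rcases h5 with h5 | h5
    · have h6 := congrArg (fun s : Equiv.Perm (Fin (2 * g + 2)) => s (π 0)) h5
      simp at h6
      exact absurd h6 (partner_ne 0)
    · intro p
      have h6 := congrArg (fun s : Equiv.Perm (Fin (2 * g + 2)) => s (π p)) h5
      simpa using h6
  obtain ⟨c, hc, h⟩ := eq_mul_or_eq_div h4 (x := fun p => pts b (π p)) (y := fun p => τ (pts b p))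
    (fun p => hne _) (fun p => (map_ne_zero τ).2 (hne p)) (hinj.comp π.injective)
    (τ.injective.comp hinj) (fun p => by rw [hcomm, pts_partner])
    (fun p => by rw [pts_partner, map_neg]) hπ
  exact ⟨π, c, hc, h⟩

/-- Automorphisms over the field of invariants act on the parameters through the dihedral
group. -/
theorem exists_mem_dihedralAut (hg : 2 ≤ g) (h2 : (2 : k) ≠ 0) (hN : normalDisc g k ≠ 0)
    (ε : kˣ) (hε : IsPrimitiveRoot ε (2 * g + 2))
    (τ : ParamClosure g k ≃ₐ[invField hN] ParamClosure g k) :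
    ∃ s ∈ dihedralAut g ε, ∀ z : ParamField g k,
      τ (algebraMap (ParamField g k) (ParamClosure g k) z) =
        algebraMap (ParamField g k) (ParamClosure g k) (s z) := by
  obtain ⟨b, hb⟩ := exists_pts (gparam k : Fin g → ParamClosure g k)
  obtain ⟨π, c, hc, h⟩ := exists_perm_eq_mul hg h2 hN hb τ
  have hmap : affinePoly (normalForm fun i => τ (gparam k i)) =
      ∏ p, (Polynomial.X - Polynomial.C (τ (pts b p))) := by
    have h1 := congrArg (Polynomial.map (τ : ParamClosure g k →+* ParamClosure g k)) hb
    rw [map_affinePoly, Polynomial.map_prod] at h1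
    simp only [Polynomial.map_sub, Polynomial.map_X, Polynomial.map_C] at h1
    refine Eq.trans (congrArg affinePoly (funext fun j => ?_)) h1
    exact (normalForm_map (τ : ParamClosure g k →+* ParamClosure g k) _ j).symm
  suffices hs : ∃ s ∈ dihedralAut g ε, ∀ i, τ (gparam k i) =
      algebraMap (ParamField g k) (ParamClosure g k) (s (param k i)) by
    obtain ⟨s, hs, h1⟩ := hs
    refine ⟨s, hs, fun z => ?_⟩
    have h3 : ((AlgEquiv.restrictScalars k τ).toAlgHom.comp
        (IsScalarTower.toAlgHom k (ParamField g k) (ParamClosure g k))) =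
        (IsScalarTower.toAlgHom k (ParamField g k) (ParamClosure g k)).comp s.toAlgHom :=
      algHom_paramField_ext h1
    exact DFunLike.congr_fun h3 z
  have hroot : ∀ c : ParamClosure g k, c ^ (2 * g + 2) = 1 → ∃ j : ℕ,
      c⁻¹ = algebraMap k (ParamClosure g k) ((ε ^ j : kˣ) : k) := by
    intro c hc
    have : NeZero (2 * g + 2) := ⟨by omega⟩
    have h1 := (IsPrimitiveRoot.coe_units_iff.2 hε).map_of_injective
      (algebraMap k (ParamClosure g k)).injective
    obtain ⟨j, -, hj⟩ := h1.eq_pow_of_pow_eq_one (ξ := c⁻¹) (by rw [inv_pow, hc, inv_one])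
    exact ⟨j, by rw [← hj, Units.val_pow_eq_pow_val, map_pow]⟩
  have hscale : ∀ j : ℕ, scaleAut g (ε ^ j) ∈ dihedralAut g ε := by
    intro j
    have h1 : scaleAut g (ε ^ j) = scaleAut g ε ^ j := map_pow (scaleAutHom g k) ε j
    have h3 : scaleAut g ε ∈ dihedralAut g ε := Subgroup.subset_closure (Or.inl rfl)
    rw [h1]
    exact pow_mem h3 j
  have hscale_apply : ∀ (v : kˣ) (i : Fin g),
      algebraMap (ParamField g k) (ParamClosure g k) (algebraMap k (ParamField g k)
        ((v : k) ^ (2 * ((i : ℕ) + 1)))) = algebraMap k (ParamClosure g k) (v : k) ^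
          (2 * ((i : ℕ) + 1)) := by
    intro v i
    rw [← IsScalarTower.algebraMap_apply, map_pow]
  rcases h with h | h
  · simp only [h] at hmap
    obtain ⟨h1, h3⟩ := normalForm_of_scaled_roots hc π hb hmap
    obtain ⟨j, hj⟩ := hroot c h1
    refine ⟨scaleAut g (ε ^ j), hscale j, fun i => ?_⟩
    rw [h3, scaleAut_X, map_mul, hscale_apply, ← hj]
    rfl
  · simp only [h] at hmap
    obtain ⟨h1, h3⟩ := normalForm_of_scaled_roots (x := fun p => (pts b p)⁻¹) hc π
      (affinePoly_normalForm_rev (fun p => pts_ne_zero (ne_zero_of_pts hb _)) hb) hmap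
    obtain ⟨j, hj⟩ := hroot c h1
    refine ⟨swapAut g k * scaleAut g (ε ^ j),
      mul_mem (Subgroup.subset_closure (Or.inr rfl)) (hscale j), fun i => ?_⟩
    rw [h3, AlgEquiv.mul_apply, scaleAut_X, map_mul, AlgEquiv.commutes, swapAut_X, map_mul,
      hscale_apply, ← hj]
    rfl

/-- The fixed field of the dihedral group is generated by the pull-backs of the regular
functions on the moduli space. -/
theorem fixedField_dihedralAut (hg : 2 ≤ g) (hN : normalDisc g k ≠ 0)
    (ε : kˣ) (hε : IsPrimitiveRoot ε (2 * g + 2)) :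
    IntermediateField.fixedField (dihedralAut g ε) =
      IntermediateField.adjoin k (Set.range (pullback (g := g) hN)) := by
  have h2 := two_ne_zero_of_isPrimitiveRoot ε hε
  have hn : ((2 * g + 2 : ℕ) : k) ≠ 0 := natCast_ne_zero_of_isPrimitiveRoot (by omega) ε hε
  apply le_antisymm
  · intro z hz
    have halg := isAlgebraic_invField hg hn h2 hN
    have hnormal : Normal (invField hN) (ParamClosure g k) := normal_iff.2 fun x =>
      ⟨(halg.isAlgebraic x).isIntegral, IsAlgClosed.splits _⟩
    have hmem : algebraMap (ParamField g k) (ParamClosure g k) z ∈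
        (⊥ : Subalgebra (invField hN) (ParamClosure g k)) := by
      -- `Ω` is only known to be normal over the field of invariants, but `z` is separable. If it
      -- were not invariant, it would have another conjugate, reached by some `τ`; yet `τ` acts on
      -- `k(a)` through the dihedral group, which fixes `z`.
      by_contra hne
      have hsep := mem_separableClosure_iff.1 (algebraMap_mem_separableClosure hg hn h2 hN z)
      obtain ⟨w, hw, hconj⟩ := (notMem_iff_exists_ne_and_isConjRoot hsep
        (IsAlgClosed.splits _)).1 hne
      obtain ⟨τ, hτ⟩ := isConjRoot_iff_exists_algEquiv.1 hconj.symm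
      obtain ⟨s, hs, h⟩ := exists_mem_dihedralAut hg h2 hN ε hε τ
      rw [h, (IntermediateField.mem_fixedField_iff _ _).1 hz s hs] at hτ
      exact hw hτ
    obtain ⟨l, hl⟩ := Algebra.mem_bot.1 hmem
    have h1 : algebraMap (ParamField g k) (ParamClosure g k) z ∈ invField hN := by
      rw [← hl]
      exact l.2
    have h3 : invField hN = (IntermediateField.adjoin k (Set.range (pullback (g := g) hN))).map
        (IsScalarTower.toAlgHom k (ParamField g k) (ParamClosure g k)) := by
      rw [IntermediateField.adjoin_map, ← Set.range_comp]
      rfl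
    rw [h3, IntermediateField.mem_map] at h1
    obtain ⟨y, hy, hyz⟩ := h1
    rwa [← (algebraMap (ParamField g k) (ParamClosure g k)).injective hyz]
  · rw [IntermediateField.adjoin_le_iff]
    rintro _ ⟨F, rfl⟩
    apply pullback_mem_fixedField
    rw [← Units.val_pow_eq_pow_val, hε.pow_eq_one, Units.val_one]

end Automorphisms


/-! ### The function field of the locus -/

section FunctionField

variable {k : Type*} [Field k] [IsAlgClosed k] {g : ℕ}

/-- The pull-back of the functions on the locus to the fixed field of the dihedral group. -/
def locusPullback (hg : 2 ≤ g) (hN : normalDisc g k ≠ 0) (ε : kˣ)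
    (hε : IsPrimitiveRoot ε (2 * g + 2)) :
    LocusCoordRing g k →ₐ[k] IntermediateField.fixedField (dihedralAut g ε) :=
  Ideal.Quotient.liftₐ (locusIdeal g k)
    ((pullback hN).codRestrict (IntermediateField.fixedField (dihedralAut g ε)).toSubalgebra
      fun F => pullback_mem_fixedField hN ε
        (by rw [← Units.val_pow_eq_pow_val, hε.pow_eq_one, Units.val_one]) F)
    fun F hF => Subtype.ext
      ((mem_locusIdeal_iff hg (two_ne_zero_of_isPrimitiveRoot ε hε) hN F).1 hF)

theorem coe_locusPullback_toLocus (hg : 2 ≤ g) (hN : normalDisc g k ≠ 0) (ε : kˣ)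
    (hε : IsPrimitiveRoot ε (2 * g + 2)) (F : coordRing g k) :
    (locusPullback hg hN ε hε (toLocus g k F) : ParamField g k) = pullback hN F := rfl

theorem toLocus_surjective (g : ℕ) (k : Type*) [Field k] : Function.Surjective (toLocus g k) :=
  Ideal.Quotient.mkₐ_surjective k (locusIdeal g k)

theorem locusPullback_injective (hg : 2 ≤ g) (hN : normalDisc g k ≠ 0) (ε : kˣ)
    (hε : IsPrimitiveRoot ε (2 * g + 2)) : Function.Injective (locusPullback hg hN ε hε) := by
  rw [injective_iff_map_eq_zero]
  intro x hx
  obtain ⟨F, rfl⟩ := toLocus_surjective g k x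
  have h1 := congrArg Subtype.val hx
  rw [coe_locusPullback_toLocus] at h1
  exact Ideal.Quotient.eq_zero_iff_mem.2
    ((mem_locusIdeal_iff hg (two_ne_zero_of_isPrimitiveRoot ε hε) hN F).2 h1)

/-- The function field of the locus is the fixed field of the dihedral group. -/
theorem exists_equiv_fixedField (hg : 2 ≤ g) (hN : normalDisc g k ≠ 0) (ε : kˣ)
    (hε : IsPrimitiveRoot ε (2 * g + 2)) :
    ∃ e : LocusFunField g k ≃ₐ[k] IntermediateField.fixedField (dihedralAut g ε),
      ∀ F : coordRing g k,
        (e (algebraMap (LocusCoordRing g k) (LocusFunField g k) (toLocus g k F)) :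
          ParamField g k) = pullback hN F := by
  have hdom : IsDomain (LocusCoordRing g k) :=
    (Ideal.Quotient.isDomain_iff_prime (locusIdeal g k)).2
      (locusIdeal_isPrime hg (two_ne_zero_of_isPrimitiveRoot ε hε) hN)
  have hinj := locusPullback_injective hg hN ε hε
  let e : LocusFunField g k →ₐ[k] IntermediateField.fixedField (dihedralAut g ε) :=
    IsFractionRing.liftAlgHom (K := LocusFunField g k) hinj
  have he : ∀ F : coordRing g k,
      (e (algebraMap (LocusCoordRing g k) (LocusFunField g k) (toLocus g k F)) :
        ParamField g k) = pullback hN F := by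
    intro F
    rw [← coe_locusPullback_toLocus hg hN ε hε]
    exact congrArg Subtype.val (IsFractionRing.lift_algebraMap hinj (toLocus g k F))
  have hinj' : Function.Injective e := RingHom.injective e.toRingHom
  refine ⟨AlgEquiv.ofBijective e ⟨hinj', ?_⟩, he⟩
  rintro ⟨x, hx⟩
  -- The pull-backs already form a subalgebra, so every element of the field they generate is a
  -- quotient of two of them.
  rw [fixedField_dihedralAut hg hN ε hε, IntermediateField.mem_adjoin_iff_div] at hx
  obtain ⟨r, hr, s, hs, h⟩ := hx
  rw [← AlgHom.coe_range, Algebra.adjoin_eq] at hr hs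
  obtain ⟨F, rfl⟩ := hr
  obtain ⟨G, rfl⟩ := hs
  refine ⟨algebraMap _ _ (toLocus g k F) / algebraMap _ _ (toLocus g k G), Subtype.ext ?_⟩
  rw [map_div₀]
  change ((e _ : ParamField g k)) / (e _ : ParamField g k) = x
  rw [he, he, h]
  rfl

end FunctionField

end

end Hyperelliptic

open Hyperelliptic in
theorem mainTheorem2 {k : Type*} [Field k] [IsAlgClosed k] (g : ℕ) (hg : 2 ≤ g)
    (ε : kˣ) (hε : IsPrimitiveRoot ε (2 * g + 2)) :
    -- the changes of coordinate that commute with `X ↦ -X` and preserve the normal form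
    (∀ a : Fin g → k, MvPolynomial.eval (normalForm a) (disc g k) ≠ 0 →
      ∀ M : GL (Fin 2) k,
        Matrix.ProjGenLinGroup.mk M ∈
          Subgroup.centralizer {Matrix.ProjGenLinGroup.mk (scaleGL (-1 : kˣ))} →
        ((∃ (a' : Fin g → k) (c : kˣ),
            subst M (toPoly (normalForm a)) = (c : k) • toPoly (normalForm a')) ↔
          Matrix.ProjGenLinGroup.mk M ∈ coordGroup ε)) ∧
    -- their effect on the parameters
    (∀ a : Fin g → k,
      subst (scaleGL ε) (toPoly (normalForm a)) =
        toPoly (normalForm fun i : Fin g => (ε : k) ^ (2 * ((i : ℕ) + 1)) * a i) ∧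
      subst (swapGL k) (toPoly (normalForm a)) =
        toPoly (normalForm fun i : Fin g => a i.rev)) ∧
    -- they act on `k(a_1, …, a_g)`, with kernel generated by `X ↦ -X`
    (∃ ρ : coordGroup ε →* dihedralAut g ε,
      Function.Surjective ρ ∧
      (ρ ⟨_, scale_mem ε⟩ : ParamField g k ≃ₐ[k] ParamField g k) = scaleAut g ε ∧
      (ρ ⟨_, swap_mem ε⟩ : ParamField g k ≃ₐ[k] ParamField g k) = swapAut g k ∧
      ρ.ker.map (coordGroup ε).subtype =
        Subgroup.zpowers (Matrix.ProjGenLinGroup.mk (scaleGL (-1 : kˣ)))) ∧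
    -- through the dihedral group of order `2(g+1)`
    Nonempty (DihedralGroup (g + 1) ≃* dihedralAut g ε) ∧
    -- `L_g` is irreducible and `k(L_g)` is the fixed field, by way of the normal form
    (locusIdeal g k).IsPrime ∧
    ∃ e : LocusFunField g k ≃ₐ[k] IntermediateField.fixedField (dihedralAut g ε),
      ∀ F : coordRing g k,
        IsPullback F.1 (e (algebraMap (LocusCoordRing g k) (LocusFunField g k) (toLocus g k F)) :
          ParamField g k) := by
  have h2 := two_ne_zero_of_isPrimitiveRoot ε hε
  have hn : ((2 * g + 2 : ℕ) : k) ≠ 0 := natCast_ne_zero_of_isPrimitiveRoot (by omega) ε hε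
  have hN : normalDisc g k ≠ 0 := normalDisc_ne_zero hn
  have hε1 : (ε : k) ^ (2 * g + 2) = 1 := by
    rw [← Units.val_pow_eq_pow_val, hε.pow_eq_one, Units.val_one]
  obtain ⟨e, he⟩ := exists_equiv_fixedField hg hN ε hε
  refine ⟨fun a _ M hM => exists_subst_normalForm_iff ε hε a M hM,
    fun a => ⟨subst_scaleGL_normalForm ε hε1 a, subst_swapGL_normalForm a⟩,
    exists_hom_coordGroup hg ε hε, nonempty_dihedralGroup_equiv hg ε hε,
    locusIdeal_isPrime hg h2 hN, e, fun F => ?_⟩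
  rw [he]
  exact isPullback_pullback hN F
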